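/- **Model.** A decision maker (DM) chooses between actions $r$ and $\ell$; the state is $R$ or $L$. Matching action and state ($r$ in $R$, $\ell$ in $L$) pays $\delta>0$, a mismatch pays $0$. Let $U_\rho(p)=\delta\,(\rho p+(1-\rho)(1-p))$ be the payoff of playing $r$ with probability $\rho$ at belief $p=\Pr(R)$, $U_r=U_1$, $U_\ell=U_0$. While she waits the DM pays a flow cost $c>0$ and splits attention between two news sources: with share $\alpha\in[0,1]$, conclusive $R$-evidence arrives at rate $\alpha\lambda$ in state $R$ and conclusive $L$-evidence at rate $(1-\alpha)\lambda$ in state $L$ ($\lambda>0$); after news she takes the correct action. Absent news a belief moves by $\dot p=\eta_\alpha(p):=-(2\alpha-1)\lambda p(1-p)$. The DM has an interval of priors $[\underline p_0,\overline p_0]\subset(0,1)$, is maxmin, and updates prior by prior, so $\Delta=\ln\frac{\overline p_0}{1-\overline p_0}-\ln\frac{\underline p_0}{1-\underline p_0}\ge 0$ stays constant and the state is the highest belief $\overline p\in(0,1)$, with belief set $\mathcal P(\overline p)=\{p\le\overline p:\ln\frac{\overline p}{1-\overline p}-\ln\frac{p}{1-p}\le\Delta\}$ and $\underline p=\underline p(\overline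 p)=\min\mathcal P(\overline p)$. **Equilibrium.** A strategy $\sigma=(\alpha,\nu,m,\rho)$ assigns to each state $\overline p$ an attention share, a stopping rate $\nu\ge0$, an instantaneous stopping probability $m\in[0,1]$ and a probability $\rho\in[0,1]$ of $r$ when stopping; it is measurable, and from every state it induces a unique state path (the law of motion holding for right derivatives), a well-defined stopping time, and a finite payoff. $V(p,\overline p)$ is the expected payoff of $\sigma$ from state $\overline p$ on, evaluated at belief $p$. Put $$\begin{aligned}G(\alpha,\nu,m,\rho;p,\overline p)=\;&m[U_\rho(p)-V]+(1-m)\big[-c+\nu(U_\rho(p)-V)+\alpha\lambda p(\delta-V)\\&+(1-\alpha)\lambda(1-p)(\delta-V)+V_p\,\eta_\alpha(p)+V_{\overline p}\,\eta_\alpha(\overline p)\big],\end{aligned}$$ where $V,V_p,V_{\overline p}$ at $(p,\overline p)$ are limits as the state tends to $\overline p$ from the side to which it drifts: from below if $\alpha>\frac12$, from above if $\alpha<\frac12$, while for $\alpha=\frac12$ they are taken at $\overline p$ itself and the drift terms vanish. The pair $(\sigma,\pi)$ is an intrapersonal equilibrium if for every $\overline p\in(0,1)$, with $\pi=\pi(\overline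 p)$: $\pi\in\arg\min_{p\in\mathcal P(\overline p)}V(p,\overline p)$; $\max\{U_\ell(\pi),U_r(\pi)\}\le V(\pi,\overline p)$, with equality if $\nu(\overline p)>0$ or $m(\overline p)>0$; $\rho(\overline p)$ maximizes $U_\rho(\pi)$; the one-sided limits above exist for all $p\in\mathcal P(\overline p)$; and $G(\sigma(\overline p);\pi,\overline p)=0$, $\sigma(\overline p)$ maximizes $G(\cdot\,;\pi,\overline p)$, and $\pi$ minimizes $G(\sigma(\overline p);\cdot,\overline p)$ over $\mathcal P(\overline p)$. **Bayesian benchmark.** $\Phi^*(p)$ is the supremum of the expected payoffs at belief $p$ over all measurable attention paths $(\alpha_t)_{t\ge0}$, stopping times $T\in[0,\infty]$ (absent news) and terminal mixed actions, with finite expected cost. A policy is Bayesian optimal for belief $p$ if its expected payoff at $p$ is $\Phi^*(p)$. **Theorem.** Let $c<\overline c:=\frac{\lambda\delta}{2}$, and suppose that the cost is low, $c<\underline c^*:=\frac{\lambda\delta}{1+e^2}$, or the ambiguity is small, $\Phi^*(\frac12)\ge U_\ell(\underline p(\frac12))$. Then there is an intrapersonal equilibrium $(\sigma,\pi)$ such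 that for every state $\overline p\in(0,1)$: - if $\overline p\le\frac12$, following $\sigma$ from state $\overline p$ on is Bayesian optimal for belief $\overline p$, and $\pi(\overline p)=\overline p$; - if $\underline p\ge\frac12$, following $\sigma$ from state $\overline p$ on is Bayesian optimal for belief $\underline p$, and $\pi(\overline p)=\underline p$; - if $\underline p<\frac12<\overline p$, then $\pi(\overline p)=\frac12$, and the DM uses whichever of the following has the higher payoff at belief $\frac12$ (the first one in case of a tie): split-attention learning ($\alpha=\frac12$, $\nu=m=0$, forever, of value $u^*=\delta-\frac{2c}{\lambda}$), or the hedged action ($m=1$, $\rho=\frac12$, of value $\hat u=\frac{\delta}{2}$). -/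

import Mathlib

open Set Filter Topology MeasureTheory
open scoped ENNReal

namespace TwoNews

/-- The two-source Poisson model with symmetric payoffs: news arrival rate `lam`, flow cost `c`,
and payoff `δ` from matching the action with the state (a mismatch pays `0`). -/
structure Model where
  lam : ℝ
  c : ℝ
  δ : ℝ
  lam_pos : 0 < lam
  c_pos : 0 < c
  δ_pos : 0 < δ

/-- The choice of the DM at an instant without news: the share `α` of attention given to the source
of `R`-evidence (the rest goes to the source of `L`-evidence), the stopping rate `ν`, the
instantaneous stopping probability `m`, and the probability `ρ` of action `r` when stopping. -/
@[ext]
structure Control where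
  α : ℝ
  ν : ℝ
  m : ℝ
  ρ : ℝ

structure Control.Valid (u : Control) : Prop where
  α_mem : u.α ∈ Icc (0 : ℝ) 1
  ν_nonneg : 0 ≤ u.ν
  m_mem : u.m ∈ Icc (0 : ℝ) 1
  ρ_mem : u.ρ ∈ Icc (0 : ℝ) 1

/-- A time-indexed policy: what the DM does at time `t ≥ 0` if no news has arrived until then. -/
abbrev Policy := ℝ → Control

/-- A Markov strategy: what the DM does when the highest belief (the state) is `q ∈ (0, 1)`. -/
abbrev Strategy := ℝ → Control

noncomputable section

namespace Model

variable (M : Model)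

/-- Expected payoff at belief `p` from stopping with the mixed action that plays `r` with
probability `ρ`; so `M.U 0` is the payoff of `ℓ` and `M.U 1` that of `r`. -/
def U (ρ p : ℝ) : ℝ := M.δ * (ρ * p + (1 - ρ) * (1 - p))

/-- Time derivative, in the absence of news, of a belief `p` under the attention share `α`. -/
def drift (α p : ℝ) : ℝ := -(2 * α - 1) * M.lam * p * (1 - p)

/-- The cost threshold above which experimentation is never optimal for a Bayesian DM. -/
def cBar : ℝ := M.lam * M.δ / 2

/-- The threshold below which the cost is low. -/
def cLow : ℝ := M.lam * M.δ / (1 + Real.exp 2)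

end Model

/-! ### Policies and their payoffs -/

/-- Probability that the DM has not stopped by herself at or before time `t`, absent news. -/
def survival (s : Policy) (t : ℝ) : ℝ :=
  Real.exp (-∫ u in (0 : ℝ)..t, (s u).ν) * ∏' u : Icc (0 : ℝ) t, (1 - (s u).m)

/-- Probability that the DM has not stopped by herself strictly before time `t`, absent news. -/
def survivalBefore (s : Policy) (t : ℝ) : ℝ :=
  Real.exp (-∫ u in (0 : ℝ)..t, (s u).ν) * ∏' u : Ico (0 : ℝ) t, (1 - (s u).m)

/-- Probability of no news up to time `t` in state `R`. -/
def noNewsR (M : Model) (s : Policy) (t : ℝ) : ℝ :=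
  Real.exp (-M.lam * ∫ u in (0 : ℝ)..t, (s u).α)

/-- Probability of no news up to time `t` in state `L`. -/
def noNewsL (M : Model) (s : Policy) (t : ℝ) : ℝ :=
  Real.exp (-M.lam * ∫ u in (0 : ℝ)..t, (1 - (s u).α))

/-- Flow payoff at time `t` in state `R`: stopping at rate `ν`, a breakthrough at rate `lam * α`
(followed by the correct action), and the flow cost. -/
def flowR (M : Model) (s : Policy) (t : ℝ) : ℝ :=
  survival s t * noNewsR M s t *
    ((s t).ν * M.U (s t).ρ 1 + M.lam * (s t).α * M.δ - M.c)

/-- Flow payoff at time `t` in state `L`. -/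
def flowL (M : Model) (s : Policy) (t : ℝ) : ℝ :=
  survival s t * noNewsL M s t *
    ((s t).ν * M.U (s t).ρ 0 + M.lam * (1 - (s t).α) * M.δ - M.c)

def payoffR (M : Model) (s : Policy) : ℝ :=
  (∫ t in Ioi (0 : ℝ), flowR M s t) +
    ∑' t : Ici (0 : ℝ), survivalBefore s t * (s t).m * noNewsR M s t * M.U (s t).ρ 1

def payoffL (M : Model) (s : Policy) : ℝ :=
  (∫ t in Ioi (0 : ℝ), flowL M s t) +
    ∑' t : Ici (0 : ℝ), survivalBefore s t * (s t).m * noNewsL M s t * M.U (s t).ρ 0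

/-- Expected payoff of a policy when state `R` has probability `p`. -/
def payoff (M : Model) (s : Policy) (p : ℝ) : ℝ :=
  p * payoffR M s + (1 - p) * payoffL M s

/-- The expected payoff is finite in both states; otherwise the expected cost is infinite. -/
def FinitePayoff (M : Model) (s : Policy) : Prop :=
  IntegrableOn (flowR M s) (Ioi 0) ∧ IntegrableOn (flowL M s) (Ioi 0)

structure Policy.Admissible (s : Policy) : Prop where
  valid : ∀ t, 0 ≤ t → (s t).Valid
  meas_α : Measurable fun t => (s t).α
  meas_ν : Measurable fun t => (s t).ν
  meas_m : Measurable fun t => (s t).m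
  meas_ρ : Measurable fun t => (s t).ρ
  hazard : ∀ T, IntegrableOn (fun t => (s t).ν) (Icc 0 T)
  /-- An interval of times of certain stopping extends to its left endpoint. -/
  closed_left : ∀ I : Set ℝ, I ⊆ Ici 0 → IsConnected I → (∀ t ∈ I, (s t).m = 1) →
    (s (sInf I)).m = 1
  countable_atoms : {t : ℝ | 0 ≤ t ∧ (s t).m ∈ Ioo (0 : ℝ) 1}.Countable

/-- Attention `1/2` to each source until the state is learned. -/
def splitPolicy : Policy := fun _ => ⟨1 / 2, 0, 0, 1 / 2⟩

/-- Stop at once and play `r` and `ℓ` with equal probabilities. -/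
def hedgedPolicy : Policy := fun _ => ⟨1 / 2, 0, 1, 1 / 2⟩

/-! ### The Bayesian benchmark -/

/-- The plan of a Bayesian DM: allocate attention by `α` and, absent news, stop at time `T`
(never, if `T = ∞`) and take action `r` with probability `ρ`. -/
def plan (α : ℝ → ℝ) (T : ℝ≥0∞) (ρ : ℝ) : Policy :=
  fun t => ⟨α t, 0, if T ≤ ENNReal.ofReal t then 1 else 0, ρ⟩

/-- The payoffs at belief `p` of all plans (plans of infinite expected cost are left out). -/
def planPayoffs (M : Model) (p : ℝ) : Set ℝ :=
  {v | ∃ (α : ℝ → ℝ) (T : ℝ≥0∞) (ρ : ℝ), Measurable α ∧ (∀ t, α t ∈ Icc (0 : ℝ) 1) ∧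
    ρ ∈ Icc (0 : ℝ) 1 ∧ FinitePayoff M (plan α T ρ) ∧ v = payoff M (plan α T ρ) p}

/-- The Bayesian value function. -/
def bayesValue (M : Model) (p : ℝ) : ℝ := sSup (planPayoffs M p)

/-- The policy `s` is optimal for the Bayesian DM with belief `p`: its payoff is the optimal one. -/
def IsBayesOptimal (M : Model) (s : Policy) (p : ℝ) : Prop :=
  IsLUB (planPayoffs M p) (payoff M s p)

/-! ### Beliefs and the evolution of the state -/

/-- The set of posteriors when the highest one is `q` and the degree of ambiguity is `Δ`. -/
def beliefSet (Δ q : ℝ) : Set ℝ :=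
  {p | p ∈ Ioo (0 : ℝ) 1 ∧ p ≤ q ∧ Real.log (q / (1 - q)) - Real.log (p / (1 - p)) ≤ Δ}

/-- The lowest posterior when the highest one is `q`. -/
def lowest (Δ q : ℝ) : ℝ := sInf (beliefSet Δ q)

/-- `x` is the path, absent news and stopping, of the state that starts at `q` when `σ` is used.
As the attention share may jump, the law of motion is imposed on right derivatives. -/
structure IsStatePath (M : Model) (σ : Strategy) (q : ℝ) (x : ℝ → ℝ) : Prop where
  init : ∀ t, t ≤ 0 → x t = q
  cont : Continuous x
  mem : ∀ t, x t ∈ Ioo (0 : ℝ) 1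
  law : ∀ t, 0 ≤ t → HasDerivWithinAt x (M.drift (σ (x t)).α (x t)) (Ioi t) t

def statePath (M : Model) (σ : Strategy) (q : ℝ) : ℝ → ℝ :=
  Classical.epsilon (IsStatePath M σ q)

/-- The policy that results when the strategy `σ` is followed from state `q` on. -/
def induced (M : Model) (σ : Strategy) (q : ℝ) : Policy := fun t => σ (statePath M σ q t)

structure Strategy.Admissible (M : Model) (σ : Strategy) : Prop where
  valid : ∀ q ∈ Ioo (0 : ℝ) 1, (σ q).Valid
  meas_α : Measurable fun q => (σ q).α
  meas_ν : Measurable fun q => (σ q).ν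
  meas_m : Measurable fun q => (σ q).m
  meas_ρ : Measurable fun q => (σ q).ρ
  path : ∀ q ∈ Ioo (0 : ℝ) 1, ∃! x : ℝ → ℝ, IsStatePath M σ q x
  policy : ∀ q ∈ Ioo (0 : ℝ) 1, Policy.Admissible (induced M σ q)
  finite : ∀ q ∈ Ioo (0 : ℝ) 1, FinitePayoff M (induced M σ q)

/-- `V^σ(p, q)`: the payoff, evaluated at belief `p`, of following `σ` from state `q` on. -/
def value (M : Model) (σ : Strategy) (p q : ℝ) : ℝ := payoff M (induced M σ q) p

/-! ### The Hamilton-Jacobi-Bellman conditions -/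

/-- Where the state `q` is an instant later under the attention share `α`: just below `q` if
`R`-evidence gets more attention, just above if `L`-evidence does, at `q` under an equal split. -/
def ahead (α q : ℝ) : Filter ℝ :=
  if 1 / 2 < α then 𝓝[<] q else if α < 1 / 2 then 𝓝[>] q else pure q

/-- The value and its partial derivatives at belief `p` have limits as the state varies
along `F`. -/
def HasLimits (V : ℝ → ℝ → ℝ) (p : ℝ) (F : Filter ℝ) : Prop :=
  (∀ᶠ y in F, DifferentiableAt ℝ (fun x => V x y) p ∧ DifferentiableAt ℝ (fun z => V p z) y) ∧
  (∃ l, Tendsto (fun y => V p y) F (𝓝 l)) ∧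
  (∃ l, Tendsto (fun y => deriv (fun x => V x y) p) F (𝓝 l)) ∧
  (∃ l, Tendsto (fun y => deriv (fun z => V p z) y) F (𝓝 l))

/-- The net value increase at belief `p` and state `q` from the control `u` at this instant, when
`V` is the continuation value. -/
def G (M : Model) (V : ℝ → ℝ → ℝ) (u : Control) (p q : ℝ) : ℝ :=
  let W := limUnder (ahead u.α q) fun y => V p y
  let W₁ := limUnder (ahead u.α q) fun y => deriv (fun x => V x y) p
  let W₂ := limUnder (ahead u.α q) fun y => deriv (fun z => V p z) y
  u.m * (M.U u.ρ p - W) +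
    (1 - u.m) * (-M.c + u.ν * (M.U u.ρ p - W) + M.lam * u.α * p * (M.δ - W) +
      M.lam * (1 - u.α) * (1 - p) * (M.δ - W) +
      W₁ * M.drift u.α p + W₂ * M.drift u.α q)

/-- `σ` is a pseudo equilibrium, supported by the worst-case beliefs `π`. -/
structure IsPseudoEquilibrium (M : Model) (Δ : ℝ) (σ : Strategy) (π : ℝ → ℝ) : Prop where
  admissible : Strategy.Admissible M σ
  π_mem : ∀ q ∈ Ioo (0 : ℝ) 1, π q ∈ beliefSet Δ q
  worst : ∀ q ∈ Ioo (0 : ℝ) 1, ∀ p ∈ beliefSet Δ q, value M σ (π q) q ≤ value M σ p q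
  stop_le : ∀ q ∈ Ioo (0 : ℝ) 1, max (M.U 0 (π q)) (M.U 1 (π q)) ≤ value M σ (π q) q
  stop_eq : ∀ q ∈ Ioo (0 : ℝ) 1, 0 < (σ q).ν ∨ 0 < (σ q).m →
    max (M.U 0 (π q)) (M.U 1 (π q)) = value M σ (π q) q
  action : ∀ q ∈ Ioo (0 : ℝ) 1, ∀ ρ ∈ Icc (0 : ℝ) 1, M.U ρ (π q) ≤ M.U (σ q).ρ (π q)

/-- A pseudo equilibrium that satisfies the saddle-point HJB conditions in every state. -/
structure IsIntrapersonalEquilibrium (M : Model) (Δ : ℝ) (σ : Strategy) (π : ℝ → ℝ) : Prop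
    extends IsPseudoEquilibrium M Δ σ π where
  limits : ∀ q ∈ Ioo (0 : ℝ) 1, ∀ p ∈ beliefSet Δ q,
    HasLimits (value M σ) p (𝓝[<] q) ∧ HasLimits (value M σ) p (𝓝[>] q)
  hjb_zero : ∀ q ∈ Ioo (0 : ℝ) 1, G M (value M σ) (σ q) (π q) q = 0
  hjb_max : ∀ q ∈ Ioo (0 : ℝ) 1, ∀ u : Control, u.Valid →
    G M (value M σ) u (π q) q ≤ G M (value M σ) (σ q) (π q) q
  hjb_min : ∀ q ∈ Ioo (0 : ℝ) 1, ∀ p ∈ beliefSet Δ q,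
    G M (value M σ) (σ q) (π q) q ≤ G M (value M σ) (σ q) p q

/-- The ambiguity is small: `ℓ` at the lowest belief of the set whose highest belief is `1/2` pays
no more than the Bayesian value at `1/2`. -/
def SmallAmbiguity (M : Model) (Δ : ℝ) : Prop :=
  M.U 0 (lowest Δ (1 / 2)) ≤ bayesValue M (1 / 2)

end

end TwoNews

/-! The natural coordinate is the log-odds `y` of the highest belief. In it the state moves with
velocity `-(2α - 1)λ`, the belief set is the interval `[y - Δ, y]`, and the payoff of a fixed
strategy is affine in the belief: `V(p, y) = p R(y) + (1 - p) L(y)`, with `R` and `L` the payoffs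
conditional on the state of the world. With `k = c / λ` the Bayesian solution on `y ≤ 0` is
explicit: stop up to `-r`, look for `R`-evidence up to `s`, and for `L`-evidence between `s` and
`0`, a region that is present only when `s < 0`. The equilibrium plays this solution while the
highest belief is at most `1/2`. When the lowest belief is at least `1/2` it plays the image under
`y ↦ Δ - y`, which exchanges the two worlds and the two ends of the belief set. In between it rests
at a control whose payoff is the same in both worlds.

Worst-case beliefs follow from the sign of `R - L`: nonpositive on the lower side
(`Thresholds.piece_R_le_L`), so the highest belief is worst; nonnegative on the mirrored side; zero
in the middle, so that `1/2` qualifies.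

The saddle-point conditions rest on two facts. At the worst-case belief, neither action and neither
source of news, attended exclusively, yields a gain (`Piece.Good`); every control mixes these four
options, so none gains. Conversely, `V(p, ·)` is what the strategy itself earns at belief `p`, so
its dynamic programming equation holds world by world, at every `p` (`Piece.Balanced`); minimization
over beliefs is then automatic. `Thresholds.exists_sides` verifies both for the pieces to the left
of, at and to the right of each state. Jumps of the value at the ends of the middle region do no
harm: the conditions only involve one-sided limits, and no path enters or leaves that region.

Bayesian optimality is a verification argument. Dividing the loss `δ - V` by the standard deviation
`√(p(1 - p))` makes the discount rate `λ/2`, whatever the attention, and leaves a control problem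
for a path of log-odds of speed at most `λ`. The conditions `Piece.Good` say that the normalized
loss of the candidate is a subsolution (`Thresholds.loss_le_along`), which bounds all plans
(`Thresholds.planPayoffs_le`); the strategy attains the bound. -/

namespace TwoNews

noncomputable section

/-! ### Payoffs of policies without random stopping -/

/-- Discounted flow payoff before stopping in a state whose evidence gets attention `β`. -/
def core (M : Model) (β : ℝ → ℝ) (t : ℝ) : ℝ :=
  Real.exp (-M.lam * ∫ u in (0 : ℝ)..t, β u) * (M.lam * β t * M.δ - M.c)

/-- The policy stops for sure at time `T`, and not before. -/
def StopsAt (s : Policy) (T : ℝ) : Prop :=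
  ∀ t, 0 ≤ t → (s t).ν = 0 ∧ (s t).m = if T ≤ t then 1 else 0

def NeverStops (s : Policy) : Prop :=
  ∀ t, 0 ≤ t → (s t).ν = 0 ∧ (s t).m = 0

lemma integral_rate_eq_zero {s : Policy} (hν : ∀ t, 0 ≤ t → (s t).ν = 0) {t : ℝ} (ht : 0 ≤ t) :
    ∫ u in (0 : ℝ)..t, (s u).ν = 0 := by
  rw [intervalIntegral.integral_congr (g := fun _ => (0 : ℝ))]
  · simp
  · intro u hu
    rw [uIcc_of_le ht] at hu
    exact hν u hu.1

lemma survival_eq_one {s : Policy} (hν : ∀ t, 0 ≤ t → (s t).ν = 0) {t : ℝ} (ht : 0 ≤ t)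
    (hm : ∀ u ∈ Icc 0 t, (s u).m = 0) : survival s t = 1 := by
  have : (fun u : Icc (0 : ℝ) t => 1 - (s u).m) = fun _ => 1 := by
    ext u; rw [hm u u.2, sub_zero]
  rw [survival, integral_rate_eq_zero hν ht, this]; simp

lemma survivalBefore_eq_one {s : Policy} (hν : ∀ t, 0 ≤ t → (s t).ν = 0) {t : ℝ} (ht : 0 ≤ t)
    (hm : ∀ u ∈ Ico 0 t, (s u).m = 0) : survivalBefore s t = 1 := by
  have : (fun u : Ico (0 : ℝ) t => 1 - (s u).m) = fun _ => 1 := by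
    ext u; rw [hm u u.2, sub_zero]
  rw [survivalBefore, integral_rate_eq_zero hν ht, this]; simp

lemma survival_eq_zero {s : Policy} {t u : ℝ} (hu : u ∈ Icc 0 t) (hm : (s u).m = 1) :
    survival s t = 0 := by
  rw [survival, tprod_of_exists_eq_zero ⟨⟨u, hu⟩, by simp [hm]⟩, mul_zero]

lemma survivalBefore_eq_zero {s : Policy} {t u : ℝ} (hu : u ∈ Ico 0 t) (hm : (s u).m = 1) :
    survivalBefore s t = 0 := by
  rw [survivalBefore, tprod_of_exists_eq_zero ⟨⟨u, hu⟩, by simp [hm]⟩, mul_zero]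

lemma flowR_never (M : Model) {s : Policy} (hs : NeverStops s) {t : ℝ} (ht : 0 ≤ t) :
    flowR M s t = core M (fun u => (s u).α) t := by
  rw [flowR, survival_eq_one (fun u hu => (hs u hu).1) ht (fun u hu => (hs u hu.1).2),
    (hs t ht).1, noNewsR, core]
  ring

lemma flowL_never (M : Model) {s : Policy} (hs : NeverStops s) {t : ℝ} (ht : 0 ≤ t) :
    flowL M s t = core M (fun u => 1 - (s u).α) t := by
  rw [flowL, survival_eq_one (fun u hu => (hs u hu).1) ht (fun u hu => (hs u hu.1).2),
    (hs t ht).1, noNewsL, core]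
  ring

lemma survival_stops {s : Policy} {T : ℝ} (hs : StopsAt s T) (hT : 0 ≤ T) {t : ℝ} (ht : 0 ≤ t) :
    survival s t = if t < T then 1 else 0 := by
  split_ifs with h
  · refine survival_eq_one (fun u hu => (hs u hu).1) ht fun u hu => ?_
    rw [(hs u hu.1).2, if_neg (not_le.2 (hu.2.trans_lt h))]
  · exact survival_eq_zero (u := T) ⟨hT, not_lt.1 h⟩ (by rw [(hs T hT).2, if_pos le_rfl])

lemma flowR_stops (M : Model) {s : Policy} {T : ℝ} (hs : StopsAt s T) (hT : 0 ≤ T)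
    {t : ℝ} (ht : 0 ≤ t) :
    flowR M s t = (Iio T).indicator (core M (fun u => (s u).α)) t := by
  rw [flowR, survival_stops hs hT ht, (hs t ht).1, noNewsR, indicator, core]
  simp only [mem_Iio]
  split_ifs <;> ring

lemma flowL_stops (M : Model) {s : Policy} {T : ℝ} (hs : StopsAt s T) (hT : 0 ≤ T)
    {t : ℝ} (ht : 0 ≤ t) :
    flowL M s t = (Iio T).indicator (core M (fun u => 1 - (s u).α)) t := by
  rw [flowL, survival_stops hs hT ht, (hs t ht).1, noNewsL, indicator, core]
  simp only [mem_Iio]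
  split_ifs <;> ring

lemma integral_indicator_core (M : Model) (β : ℝ → ℝ) {T : ℝ} (hT : 0 ≤ T) :
    ∫ t in Ioi (0 : ℝ), (Iio T).indicator (core M β) t = ∫ t in (0 : ℝ)..T, core M β t := by
  rw [setIntegral_indicator measurableSet_Iio, Ioi_inter_Iio,
    intervalIntegral.integral_of_le hT, integral_Ioc_eq_integral_Ioo]

/-- Only the atom at `T` counts: earlier `m` vanishes, later the probability of having survived
does. -/
lemma tsum_atom_stops {s : Policy} {T : ℝ} (hs : StopsAt s T) (hT : 0 ≤ T) (f g : ℝ → ℝ) :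
    ∑' t : Ici (0 : ℝ), survivalBefore s t * (s t).m * f t * g t = f T * g T := by
  rw [tsum_eq_single (⟨T, hT⟩ : Ici (0 : ℝ))]
  · have h1 : survivalBefore s T = 1 :=
      survivalBefore_eq_one (fun u hu => (hs u hu).1) hT fun u hu => by
        rw [(hs u hu.1).2, if_neg (not_le.2 hu.2)]
    simp only [h1, (hs T hT).2, if_pos le_rfl, one_mul]
  · rintro ⟨t, ht⟩ hne
    rcases lt_or_gt_of_ne (fun h => hne (Subtype.ext h) : t ≠ T) with h | h
    · simp [(hs t ht).2, not_le.2 h]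
    · simp [survivalBefore_eq_zero (s := s) (u := T) (t := t) ⟨hT, h⟩
        (by rw [(hs T hT).2, if_pos le_rfl])]

lemma payoffR_stops (M : Model) {s : Policy} {T : ℝ} (hs : StopsAt s T) (hT : 0 ≤ T) :
    payoffR M s = (∫ t in (0 : ℝ)..T, core M (fun u => (s u).α) t) +
      noNewsR M s T * M.U (s T).ρ 1 := by
  rw [payoffR, tsum_atom_stops hs hT (noNewsR M s) (fun t => M.U (s t).ρ 1),
    ← integral_indicator_core M _ hT]
  congr 1
  exact setIntegral_congr_fun measurableSet_Ioi fun t ht => flowR_stops M hs hT (le_of_lt ht)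

lemma payoffL_stops (M : Model) {s : Policy} {T : ℝ} (hs : StopsAt s T) (hT : 0 ≤ T) :
    payoffL M s = (∫ t in (0 : ℝ)..T, core M (fun u => 1 - (s u).α) t) +
      noNewsL M s T * M.U (s T).ρ 0 := by
  rw [payoffL, tsum_atom_stops hs hT (noNewsL M s) (fun t => M.U (s t).ρ 0),
    ← integral_indicator_core M _ hT]
  congr 1
  exact setIntegral_congr_fun measurableSet_Ioi fun t ht => flowL_stops M hs hT (le_of_lt ht)

lemma payoffR_never (M : Model) {s : Policy} (hs : NeverStops s) :
    payoffR M s = ∫ t in Ioi (0 : ℝ), core M (fun u => (s u).α) t := by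
  have : ∀ t : Ici (0 : ℝ), survivalBefore s t * (s t).m * noNewsR M s t * M.U (s t).ρ 1 = 0 := by
    rintro ⟨t, ht⟩; simp [(hs t ht).2]
  rw [payoffR, tsum_congr this, tsum_zero, add_zero]
  exact setIntegral_congr_fun measurableSet_Ioi fun t ht => flowR_never M hs (le_of_lt ht)

lemma payoffL_never (M : Model) {s : Policy} (hs : NeverStops s) :
    payoffL M s = ∫ t in Ioi (0 : ℝ), core M (fun u => 1 - (s u).α) t := by
  have : ∀ t : Ici (0 : ℝ), survivalBefore s t * (s t).m * noNewsL M s t * M.U (s t).ρ 0 = 0 := by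
    rintro ⟨t, ht⟩; simp [(hs t ht).2]
  rw [payoffL, tsum_congr this, tsum_zero, add_zero]
  exact setIntegral_congr_fun measurableSet_Ioi fun t ht => flowL_never M hs (le_of_lt ht)

lemma finitePayoff_never (M : Model) {s : Policy} (hs : NeverStops s) :
    FinitePayoff M s ↔ IntegrableOn (core M fun u => (s u).α) (Ioi 0) ∧
      IntegrableOn (core M fun u => 1 - (s u).α) (Ioi 0) := by
  have hR : EqOn (flowR M s) (core M fun u => (s u).α) (Ioi 0) :=
    fun t ht => flowR_never M hs (le_of_lt ht)
  have hL : EqOn (flowL M s) (core M fun u => 1 - (s u).α) (Ioi 0) :=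
    fun t ht => flowL_never M hs (le_of_lt ht)
  rw [FinitePayoff, integrableOn_congr_fun hR measurableSet_Ioi,
    integrableOn_congr_fun hL measurableSet_Ioi]

/-! ### Measurable attention paths -/

/-- A measurable path of attention shares. -/
structure IsShare (β : ℝ → ℝ) : Prop where
  meas : Measurable β
  mem : ∀ t, β t ∈ Icc (0 : ℝ) 1

lemma IsShare.compl {β : ℝ → ℝ} (h : IsShare β) : IsShare fun t => 1 - β t :=
  ⟨measurable_const.sub h.meas, fun t => ⟨by linarith [(h.mem t).2], by linarith [(h.mem t).1]⟩⟩

lemma IsShare.intervalIntegrable {β : ℝ → ℝ} (h : IsShare β) (a b : ℝ) :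
    IntervalIntegrable β volume a b := by
  refine (intervalIntegrable_const (c := (1 : ℝ))).mono_fun h.meas.aestronglyMeasurable ?_
  refine Eventually.of_forall fun t => ?_
  simpa [abs_of_nonneg (h.mem t).1] using (h.mem t).2

lemma IsShare.integral_sub {β : ℝ → ℝ} (h : IsShare β) (a b : ℝ) :
    (∫ u in (0 : ℝ)..b, β u) - ∫ u in (0 : ℝ)..a, β u = ∫ u in a..b, β u :=
  intervalIntegral.integral_interval_sub_left (h.intervalIntegrable _ _) (h.intervalIntegrable _ _)

lemma IsShare.integral_nonneg {β : ℝ → ℝ} (h : IsShare β) {a b : ℝ} (hab : a ≤ b) :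
    0 ≤ ∫ u in a..b, β u :=
  intervalIntegral.integral_nonneg hab fun t _ => (h.mem t).1

lemma IsShare.integral_le {β : ℝ → ℝ} (h : IsShare β) {a b : ℝ} (hab : a ≤ b) :
    ∫ u in a..b, β u ≤ b - a := by
  have := intervalIntegral.integral_mono_on hab (h.intervalIntegrable a b)
    (intervalIntegrable_const (c := (1 : ℝ))) fun t _ => (h.mem t).2
  simpa using this

lemma IsShare.continuous_integral {β : ℝ → ℝ} (h : IsShare β) :
    Continuous fun t => ∫ u in (0 : ℝ)..t, β u :=
  intervalIntegral.continuous_primitive h.intervalIntegrable 0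

lemma IsShare.integral_compl {β : ℝ → ℝ} (h : IsShare β) (t : ℝ) :
    ∫ u in (0 : ℝ)..t, (1 - β u) = t - ∫ u in (0 : ℝ)..t, β u := by
  rw [intervalIntegral.integral_sub intervalIntegrable_const (h.intervalIntegrable _ _)]
  simp

lemma IsShare.intervalIntegrable_core {β : ℝ → ℝ} (M : Model) (h : IsShare β) (a b : ℝ) :
    IntervalIntegrable (core M β) volume a b := by
  have h1 : IntervalIntegrable (fun t => M.lam * β t * M.δ - M.c) volume a b :=
    (((h.intervalIntegrable a b).const_mul _).mul_const _).sub intervalIntegrable_const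
  exact h1.continuousOn_mul
    (Real.continuous_exp.comp (h.continuous_integral.const_mul (-M.lam))).continuousOn

lemma IsShare.integrableOn_indicator_core {β : ℝ → ℝ} (M : Model) (h : IsShare β) {T : ℝ}
    (hT : 0 ≤ T) : IntegrableOn ((Iio T).indicator (core M β)) (Ioi 0) := by
  rw [IntegrableOn, integrable_indicator_iff measurableSet_Iio, IntegrableOn,
    Measure.restrict_restrict measurableSet_Iio]
  exact ((intervalIntegrable_iff_integrableOn_Ioc_of_le hT).1
    (h.intervalIntegrable_core M 0 T)).mono_set fun t ht => ⟨ht.2, le_of_lt ht.1⟩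

lemma finitePayoff_stops (M : Model) {s : Policy} {T : ℝ} (hs : StopsAt s T) (hT : 0 ≤ T)
    (h : IsShare fun t => (s t).α) : FinitePayoff M s := by
  have hR : EqOn (flowR M s) ((Iio T).indicator (core M fun u => (s u).α)) (Ioi 0) :=
    fun t ht => flowR_stops M hs hT (le_of_lt ht)
  have hL : EqOn (flowL M s) ((Iio T).indicator (core M fun u => 1 - (s u).α)) (Ioi 0) :=
    fun t ht => flowL_stops M hs hT (le_of_lt ht)
  rw [FinitePayoff, integrableOn_congr_fun hR measurableSet_Ioi,
    integrableOn_congr_fun hL measurableSet_Ioi]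
  exact ⟨h.integrableOn_indicator_core M hT, h.compl.integrableOn_indicator_core M hT⟩

/-- The integrand is minus the derivative of the no-news probability. As `β` is only measurable,
that derivative exists almost everywhere; the probability is Lipschitz, hence absolutely continuous,
and the fundamental theorem of calculus applies. -/
lemma IsShare.integral_exp {β : ℝ → ℝ} (M : Model) (h : IsShare β) {T : ℝ} (hT : 0 ≤ T) :
    ∫ t in (0 : ℝ)..T, Real.exp (-M.lam * ∫ u in (0 : ℝ)..t, β u) * (M.lam * β t) =
      1 - Real.exp (-M.lam * ∫ u in (0 : ℝ)..T, β u) := by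
  set f : ℝ → ℝ := fun t => Real.exp (-M.lam * ∫ u in (0 : ℝ)..t, β u) with hf
  have hac : AbsolutelyContinuousOnInterval f 0 T := by
    refine LipschitzOnWith.absolutelyContinuousOnInterval (K := M.lam.toNNReal) ?_
    rw [uIcc_of_le hT]
    refine LipschitzOnWith.of_le_add_mul _ fun x hx y hy => ?_
    rw [Real.coe_toNNReal _ M.lam_pos.le, Real.dist_eq]
    rcases le_total x y with hxy | hxy
    · have h1 := h.integral_nonneg hxy
      have h2 := h.integral_le hxy
      rw [← h.integral_sub] at h1 h2
      have h3 := h.integral_nonneg hx.1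
      rw [abs_of_nonpos (by linarith)]
      have h4 : f x ≤ 1 := Real.exp_le_one_iff.2 (by nlinarith [M.lam_pos])
      have h5 : f y = f x * Real.exp (-(M.lam * ((∫ u in (0 : ℝ)..y, β u) - ∫ u in (0 : ℝ)..x, β u)))
        := by simp only [hf]; rw [← Real.exp_add]; ring_nf
      have h6 := Real.add_one_le_exp
        (-(M.lam * ((∫ u in (0 : ℝ)..y, β u) - ∫ u in (0 : ℝ)..x, β u)))
      have h7 : f x * (1 - Real.exp (-(M.lam * ((∫ u in (0 : ℝ)..y, β u) -
          ∫ u in (0 : ℝ)..x, β u)))) ≤ 1 * (M.lam * (y - x)) := by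
        refine mul_le_mul h4 ?_ ?_ zero_le_one
        · nlinarith [M.lam_pos]
        · rw [sub_nonneg, Real.exp_le_one_iff]; nlinarith [M.lam_pos]
      nlinarith
    · have h1 := h.integral_nonneg hxy
      rw [← h.integral_sub] at h1
      have : f x ≤ f y := Real.exp_le_exp.2 (by nlinarith [M.lam_pos])
      have := mul_nonneg M.lam_pos.le (abs_nonneg (x - y))
      linarith
  have h1 := hac.integral_deriv_eq_sub
  have h2 : f 0 = 1 := by simp [hf]
  have h3 : ∫ t in (0 : ℝ)..T, f t * (M.lam * β t) = ∫ t in (0 : ℝ)..T, -deriv f t := by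
    refine intervalIntegral.integral_congr_ae ?_
    filter_upwards [(h.intervalIntegrable 0 T).ae_hasDerivAt_integral] with x hx hx'
    have h4 := ((hx (uIoc_subset_uIcc hx') 0 left_mem_uIcc).const_mul (-M.lam)).exp
    rw [h4.deriv]
    simp only [hf]; ring
  rw [h3, intervalIntegral.integral_neg, h1, h2]; ring

/-- Reward `M.δ` times the probability of news, minus the cost of the expected waiting time. In this
form attention enters only through its integral, that is, through the path of beliefs. -/
lemma IsShare.integral_core {β : ℝ → ℝ} (M : Model) (h : IsShare β) {T : ℝ} (hT : 0 ≤ T) :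
    ∫ t in (0 : ℝ)..T, core M β t =
      M.δ * (1 - Real.exp (-M.lam * ∫ u in (0 : ℝ)..T, β u)) -
        M.c * ∫ t in (0 : ℝ)..T, Real.exp (-M.lam * ∫ u in (0 : ℝ)..t, β u) := by
  have hc : Continuous fun t => Real.exp (-M.lam * ∫ u in (0 : ℝ)..t, β u) :=
    Real.continuous_exp.comp (h.continuous_integral.const_mul (-M.lam))
  have h1 : IntervalIntegrable (fun t => Real.exp (-M.lam * ∫ u in (0 : ℝ)..t, β u) *
      (M.lam * β t)) volume 0 T :=
    ((h.intervalIntegrable 0 T).const_mul _).continuousOn_mul hc.continuousOn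
  rw [← h.integral_exp M hT, ← intervalIntegral.integral_const_mul,
    ← intervalIntegral.integral_const_mul, ← intervalIntegral.integral_sub (h1.const_mul _)
      ((hc.intervalIntegrable _ _).const_mul _)]
  refine intervalIntegral.integral_congr fun t _ => ?_
  simp only [core]; ring

/-! ### Pieces of the value function

Values are described in the log-odds `y` of the state: a piece is a pair of smooth payoffs `R` and
`L` (conditional on the state of the world), together with their derivatives. -/

lemma sigmoid_eq_exp_mul (y : ℝ) : Real.sigmoid y = Real.exp y * (1 - Real.sigmoid y) := by
  rw [← Real.sigmoid_neg, ← Real.sigmoid_mul_rexp_neg, mul_left_comm, ← Real.exp_add]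
  simp

lemma one_sub_sigmoid_pos (y : ℝ) : 0 < 1 - Real.sigmoid y := sub_pos.2 (Real.sigmoid_lt_one y)

structure Piece where
  R : ℝ → ℝ
  L : ℝ → ℝ
  R' : ℝ → ℝ
  L' : ℝ → ℝ
  hasDerivAt_R : ∀ y, HasDerivAt R (R' y) y
  hasDerivAt_L : ∀ y, HasDerivAt L (L' y) y

namespace Piece

/-- The payoff at belief `p` when the log-odds of the state are `y`. -/
def val (P : Piece) (p y : ℝ) : ℝ := p * P.R y + (1 - p) * P.L y

/-- The net gain at belief `p` from full attention to `R`-evidence. -/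
def gainLeft (M : Model) (P : Piece) (p y : ℝ) : ℝ :=
  p * (-M.c + M.lam * (M.δ - P.R y) - M.lam * P.R' y) + (1 - p) * (-M.c - M.lam * P.L' y)

/-- The net gain at belief `p` from full attention to `L`-evidence. -/
def gainRight (M : Model) (P : Piece) (p y : ℝ) : ℝ :=
  p * (-M.c + M.lam * P.R' y) + (1 - p) * (-M.c + M.lam * (M.δ - P.L y) + M.lam * P.L' y)

/-- At belief `p` and log-odds `y` no control increases the payoff of the piece `P`. -/
structure Good (M : Model) (P : Piece) (p y : ℝ) : Prop where
  le_ℓ : M.U 0 p ≤ P.val p y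
  le_r : M.U 1 p ≤ P.val p y
  left : P.gainLeft M p y ≤ 0
  right : P.gainRight M p y ≤ 0

/-- The drifts cancel and no derivative is left. When one gain vanishes, the other is therefore
nonpositive exactly when the value is at least `M.δ - 2 * M.k`, the value of split attention. -/
lemma gainLeft_add_gainRight (M : Model) (P : Piece) (p y : ℝ) :
    P.gainLeft M p y + P.gainRight M p y = -2 * M.c + M.lam * (M.δ - P.val p y) := by
  simp only [gainLeft, gainRight, val]; ring

/-- The piece obtained by exchanging the roles of the two states of the world. -/
def mirror (P : Piece) (Δ : ℝ) : Piece where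
  R y := P.L (Δ - y)
  L y := P.R (Δ - y)
  R' y := -P.L' (Δ - y)
  L' y := -P.R' (Δ - y)
  hasDerivAt_R y := (P.hasDerivAt_L (Δ - y)).comp_const_sub Δ y
  hasDerivAt_L y := (P.hasDerivAt_R (Δ - y)).comp_const_sub Δ y

lemma val_mirror (P : Piece) (Δ p y : ℝ) : (P.mirror Δ).val p y = P.val (1 - p) (Δ - y) := by
  simp only [val, mirror]; ring

lemma gainLeft_mirror (M : Model) (P : Piece) (Δ p y : ℝ) :
    (P.mirror Δ).gainLeft M p y = P.gainRight M (1 - p) (Δ - y) := by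
  simp only [gainLeft, gainRight, mirror]; ring

lemma gainRight_mirror (M : Model) (P : Piece) (Δ p y : ℝ) :
    (P.mirror Δ).gainRight M p y = P.gainLeft M (1 - p) (Δ - y) := by
  simp only [gainLeft, gainRight, mirror]; ring

lemma Good.mirror {M : Model} {P : Piece} {Δ p y : ℝ} (h : P.Good M (1 - p) (Δ - y)) :
    (P.mirror Δ).Good M p y where
  le_ℓ := by
    rw [val_mirror]; refine le_trans (le_of_eq ?_) h.le_r; simp only [Model.U]; ring
  le_r := by
    rw [val_mirror]; refine le_trans (le_of_eq ?_) h.le_ℓ; simp only [Model.U]; ring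
  left := by rw [gainLeft_mirror]; exact h.right
  right := by rw [gainRight_mirror]; exact h.left

end Piece

/-- The flow cost per unit of the arrival rate. -/
def Model.k (M : Model) : ℝ := M.c / M.lam

lemma Model.lam_mul_k (M : Model) : M.lam * M.k = M.c := mul_div_cancel₀ _ M.lam_pos.ne'

lemma Model.k_pos (M : Model) : 0 < M.k := div_pos M.c_pos M.lam_pos

/-- A constant payoff. -/
def constPiece (w : ℝ) : Piece where
  R _ := w
  L _ := w
  R' _ := 0
  L' _ := 0
  hasDerivAt_R y := hasDerivAt_const y w
  hasDerivAt_L y := hasDerivAt_const y w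

/-- Immediate action `ℓ`. -/
def stopPiece (M : Model) : Piece where
  R _ := 0
  L _ := M.δ
  R' _ := 0
  L' _ := 0
  hasDerivAt_R y := hasDerivAt_const y 0
  hasDerivAt_L y := hasDerivAt_const y M.δ

/-- Looking for `R`-evidence until the log-odds reach `-r`, then action `ℓ`. -/
def huntPiece (M : Model) (r : ℝ) : Piece where
  R y := M.δ - M.k - M.k * Real.exp (-y)
  L y := M.δ - M.k * (y + r)
  R' y := M.k * Real.exp (-y)
  L' _ := -M.k
  hasDerivAt_R y := by
    have := (((hasDerivAt_neg y).exp).const_mul M.k).const_sub (M.δ - M.k)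
    exact this.congr_deriv (by ring)
  hasDerivAt_L y := by
    have := (((hasDerivAt_id y).add_const r).const_mul M.k).const_sub M.δ
    simpa using this

/-- Looking for `L`-evidence until the log-odds reach `0`, then splitting attention. -/
def confirmPiece (M : Model) : Piece where
  R y := M.δ - 2 * M.k + M.k * y
  L y := M.δ - M.k - M.k * Real.exp y
  R' _ := M.k
  L' y := -(M.k * Real.exp y)
  hasDerivAt_R y := by
    have := ((hasDerivAt_id y).const_mul M.k).const_add (M.δ - 2 * M.k)
    simpa using this
  hasDerivAt_L y := ((Real.hasDerivAt_exp y).const_mul M.k).const_sub (M.δ - M.k)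

/-- Thresholds of the Bayesian solution in log-odds, on the side where `ℓ` is the better action:
the DM stops up to `-r`, looks for `R`-evidence from `-r` to `s`, and for `L`-evidence above `s`. -/
structure Thresholds (M : Model) where
  r : ℝ
  s : ℝ
  r_pos : 0 < r
  exp_r : Real.exp r * M.k = M.δ - M.k
  neg_r_lt_s : -r < s
  s_nonpos : s ≤ 0
  -- In terms of values at the belief with log-odds `y`: `hunt` says that `huntPiece` is worth at
  -- least split attention, `switch` that `huntPiece` and `confirmPiece` are worth the same at `s`,
  -- and `confirm` that `confirmPiece` is worth at least as much from `s` to `0`.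
  hunt : ∀ y ≤ s, y + r ≤ 1 + Real.exp y
  switch : s < 0 → s + r = Real.exp s * (2 - s)
  confirm : s < 0 → ∀ y, s ≤ y → y ≤ 0 → Real.exp y * (2 - y) ≤ y + r

lemma exp_mul_one_sub_le (y : ℝ) : Real.exp y * (1 - y) ≤ 1 := by
  have h1 := Real.add_one_le_exp (-y)
  have h2 : Real.exp y * Real.exp (-y) = 1 := by rw [← Real.exp_add]; simp
  nlinarith [Real.exp_pos y]

/-- Stopping is left where `R`-evidence pays for its cost, at `p * M.δ = M.k`; this belief has
log-odds `-r` with `exp r = (M.δ - M.k) / M.k`. The bound on the cost makes this ratio exceed `1`.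
-/
theorem Thresholds.nonempty (M : Model) (hc : M.c < M.cBar) : Nonempty (Thresholds M) := by
  have hk := M.k_pos
  have h2k : 2 * M.k < M.δ := by
    rw [Model.cBar] at hc
    have : M.lam * (2 * M.k) < M.lam * M.δ := by linarith [M.lam_mul_k]
    exact lt_of_mul_lt_mul_left this M.lam_pos.le
  have hpos : 1 < (M.δ - M.k) / M.k := by rw [lt_div_iff₀ hk]; linarith
  set r := Real.log ((M.δ - M.k) / M.k) with hr
  have hr0 : 0 < r := Real.log_pos hpos
  have hexp : Real.exp r * M.k = M.δ - M.k := by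
    rw [hr, Real.exp_log (by linarith)]; field_simp
  -- `r ≤ 2` amounts to `M.cLow ≤ M.c`: looking for `R`-evidence is then optimal all the way up to
  -- `0`. Otherwise `s` is the zero of the decreasing function `f`, which is positive at `-r` and
  -- equals `2 - r < 0` at `0`.
  rcases le_or_gt r 2 with h2 | h2
  · refine ⟨⟨r, 0, hr0, hexp, by linarith, le_rfl, fun y _ => ?_, fun h => absurd h (lt_irrefl 0),
      fun h => absurd h (lt_irrefl 0)⟩⟩
    linarith [Real.add_one_le_exp y]
  · let f : ℝ → ℝ := fun y => Real.exp y * (2 - y) - (y + r)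
    have hf : ∀ y, HasDerivAt f (Real.exp y * (1 - y) - 1) y := by
      intro y
      have := ((Real.hasDerivAt_exp y).mul ((hasDerivAt_id y).const_sub 2)).sub
        ((hasDerivAt_id y).add_const r)
      exact this.congr_deriv (by simp only [id]; ring)
    have hanti : Antitone f := by
      refine antitone_of_deriv_nonpos (fun y => (hf y).differentiableAt) fun y => ?_
      rw [(hf y).deriv]; linarith [exp_mul_one_sub_le y]
    have hcont : Continuous f := continuous_iff_continuousAt.2 fun y => (hf y).continuousAt
    have hl : 0 < f (-r) := by
      simp only [f]; have := Real.exp_pos (-r); nlinarith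
    have hr' : f 0 < 0 := by simp [f]; linarith
    obtain ⟨s, hs, hs0⟩ := intermediate_value_Icc' (by linarith : -r ≤ 0) hcont.continuousOn
      (show (0 : ℝ) ∈ Icc (f 0) (f (-r)) from ⟨hr'.le, hl.le⟩)
    refine ⟨⟨r, s, hr0, hexp, lt_of_le_of_ne hs.1 ?_, hs.2, fun y hy => ?_, fun _ => ?_,
      fun _ y hy _ => ?_⟩⟩
    · rintro rfl; exact hl.ne' hs0
    -- `y + r ≤ exp y * (2 - y) = exp y + exp y * (1 - y) ≤ exp y + 1`.
    · have h1 := hanti hy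
      rw [hs0] at h1
      simp only [f] at h1
      linarith [exp_mul_one_sub_le y]
    · simp only [f] at hs0; linarith
    · have h1 := hanti hy
      rw [hs0] at h1
      simp only [f] at h1; linarith

/-! ### The Bayesian solution on the lower side -/

lemma U_one_le_U_zero (M : Model) {y : ℝ} (hy : y ≤ 0) :
    M.U 1 (Real.sigmoid y) ≤ M.U 0 (Real.sigmoid y) := by
  have h1 := sigmoid_eq_exp_mul y
  have h2 := one_sub_sigmoid_pos y
  have h3 : Real.exp y ≤ 1 := Real.exp_le_one_iff.2 hy
  have h4 : Real.sigmoid y ≤ 1 - Real.sigmoid y := by nlinarith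
  have := mul_le_mul_of_nonneg_left h4 M.δ_pos.le
  simp only [Model.U]; linarith

namespace Thresholds

variable {M : Model} (T : Thresholds M)

lemma exp_mul_δ_sub_k (y : ℝ) : Real.exp y * (M.δ - M.k) = M.k * Real.exp (y + T.r) := by
  rw [← T.exp_r, Real.exp_add]; ring

/-- The gain from looking for `R`-evidence has the sign of `exp (y + r) - 1`. Looking for
`L`-evidence cannot pay, since `ℓ` already earns `M.δ` in world `L`. -/
lemma good_stopPiece {y : ℝ} (hy : y ≤ -T.r) : (stopPiece M).Good M (Real.sigmoid y) y := by
  have h1 := sigmoid_eq_exp_mul y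
  have h2 := one_sub_sigmoid_pos y
  have hk := M.k_pos
  have hy0 : y ≤ 0 := by linarith [T.r_pos]
  have hU := U_one_le_U_zero M hy0
  have hℓ : M.U 0 (Real.sigmoid y) = (stopPiece M).val (Real.sigmoid y) y := by
    simp only [Model.U, Piece.val, stopPiece]; ring
  have h3 := T.exp_mul_δ_sub_k y
  have h4 : Real.exp (y + T.r) ≤ 1 := Real.exp_le_one_iff.2 (by linarith)
  have h5 := M.lam_mul_k
  refine ⟨hℓ.le, hU.trans hℓ.le, ?_, ?_⟩
  · have : (stopPiece M).gainLeft M (Real.sigmoid y) y =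
        M.lam * ((1 - Real.sigmoid y) * (Real.exp y * (M.δ - M.k) - M.k)) := by
      simp only [Piece.gainLeft, stopPiece]
      rw [← h5]
      linear_combination (-M.lam * M.k + M.lam * M.δ) * h1
    rw [this, h3]
    exact mul_nonpos_of_nonneg_of_nonpos M.lam_pos.le
      (mul_nonpos_of_nonneg_of_nonpos h2.le (by nlinarith))
  · simp only [Piece.gainRight, stopPiece]
    have := M.c_pos
    linarith

lemma val_hunt (y : ℝ) : (huntPiece M T.r).val (Real.sigmoid y) y =
    (1 - Real.sigmoid y) * (M.k * Real.exp (y + T.r) - M.k + M.δ - M.k * (y + T.r)) := by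
  rw [← T.exp_mul_δ_sub_k]
  have h1 := sigmoid_eq_exp_mul y
  have h3 : Real.exp y * Real.exp (-y) = 1 := by rw [← Real.exp_add]; simp
  simp only [Piece.val, huntPiece]
  linear_combination (M.δ - M.k - M.k * Real.exp (-y)) * h1 - (1 - Real.sigmoid y) * M.k * h3

lemma gainLeft_hunt (p y : ℝ) : (huntPiece M T.r).gainLeft M p y = 0 := by
  simp only [Piece.gainLeft, huntPiece]; rw [← M.lam_mul_k]; ring

lemma le_val_hunt (y : ℝ) : M.U 0 (Real.sigmoid y) ≤ (huntPiece M T.r).val (Real.sigmoid y) y := by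
  rw [T.val_hunt, Model.U]
  have h2 := one_sub_sigmoid_pos y
  have h3 := Real.add_one_le_exp (y + T.r)
  have h4 := mul_le_mul_of_nonneg_left h3 M.k_pos.le
  have h5 := mul_le_mul_of_nonneg_left (a := 1 - Real.sigmoid y) (show M.δ ≤ M.k * Real.exp (y + T.r)
    - M.k + M.δ - M.k * (y + T.r) by linarith) h2.le
  linarith

/-- Looking for `R`-evidence is exactly compensated, so by `Piece.gainLeft_add_gainRight` the other
source is unattractive as soon as the value is at least that of split attention, which is what
`T.hunt` provides. -/
lemma good_hunt {y : ℝ} (hy : y ≤ T.s) : (huntPiece M T.r).Good M (Real.sigmoid y) y := by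
  refine ⟨T.le_val_hunt y, (U_one_le_U_zero M (hy.trans T.s_nonpos)).trans (T.le_val_hunt y),
    (T.gainLeft_hunt _ y).le, ?_⟩
  have h1 := Piece.gainLeft_add_gainRight M (huntPiece M T.r) (Real.sigmoid y) y
  rw [T.gainLeft_hunt, zero_add, ← M.lam_mul_k] at h1
  have h2 : M.δ - 2 * M.k ≤ (huntPiece M T.r).val (Real.sigmoid y) y := by
    rw [T.val_hunt, ← T.exp_mul_δ_sub_k]
    have h3 := one_sub_sigmoid_pos y
    have h4 := mul_le_mul_of_nonneg_left (T.hunt y hy) M.k_pos.le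
    have h5 := sigmoid_eq_exp_mul y
    have h6 := mul_le_mul_of_nonneg_left (a := 1 - Real.sigmoid y)
      (show (M.δ - 2 * M.k) * (1 + Real.exp y) ≤
        Real.exp y * (M.δ - M.k) - M.k + M.δ - M.k * (y + T.r) by linarith) h3.le
    have h7 : (1 - Real.sigmoid y) * ((M.δ - 2 * M.k) * (1 + Real.exp y)) = M.δ - 2 * M.k := by
      linear_combination -(M.δ - 2 * M.k) * h5
    linarith
  rw [h1]
  have := mul_le_mul_of_nonneg_left h2 M.lam_pos.le
  linarith

lemma gainRight_confirm (p y : ℝ) : (confirmPiece M).gainRight M p y = 0 := by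
  simp only [Piece.gainRight, confirmPiece]; rw [← M.lam_mul_k]; ring

lemma val_confirm_sub_val_hunt (y : ℝ) :
    (confirmPiece M).val (Real.sigmoid y) y - (huntPiece M T.r).val (Real.sigmoid y) y =
      (1 - Real.sigmoid y) * (M.k * (y + T.r - Real.exp y * (2 - y))) := by
  rw [T.val_hunt, ← T.exp_mul_δ_sub_k]
  have h1 := sigmoid_eq_exp_mul y
  simp only [Piece.val, confirmPiece]
  linear_combination (M.δ - 2 * M.k + M.k * y) * h1

/-- Stopping is ruled out by comparison with `huntPiece`. The value exceeds that of split attention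
by a positive multiple of `1 - exp y * (1 - y)`, which is nonnegative and takes care of
`R`-evidence. -/
lemma good_confirm (hs : T.s < 0) {y : ℝ} (hy : T.s ≤ y) (hy0 : y ≤ 0) :
    (confirmPiece M).Good M (Real.sigmoid y) y := by
  have h0 := one_sub_sigmoid_pos y
  have hle : (huntPiece M T.r).val (Real.sigmoid y) y ≤ (confirmPiece M).val (Real.sigmoid y) y := by
    rw [← sub_nonneg, T.val_confirm_sub_val_hunt]
    exact mul_nonneg h0.le (mul_nonneg M.k_pos.le (by linarith [T.confirm hs y hy hy0]))
  have hℓ := (T.le_val_hunt y).trans hle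
  refine ⟨hℓ, (U_one_le_U_zero M hy0).trans hℓ, ?_, (gainRight_confirm _ y).le⟩
  have h1 := Piece.gainLeft_add_gainRight M (confirmPiece M) (Real.sigmoid y) y
  rw [gainRight_confirm, add_zero, ← M.lam_mul_k] at h1
  have h2 : M.δ - 2 * M.k ≤ (confirmPiece M).val (Real.sigmoid y) y := by
    have h5 := sigmoid_eq_exp_mul y
    have h4 := mul_le_mul_of_nonneg_left (exp_mul_one_sub_le y) M.k_pos.le
    have h6 := mul_nonneg h0.le (sub_nonneg.2 h4)
    have h7 : (confirmPiece M).val (Real.sigmoid y) y - (M.δ - 2 * M.k) =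
        (1 - Real.sigmoid y) * (M.k * 1 - M.k * (Real.exp y * (1 - y))) := by
      simp only [Piece.val, confirmPiece]
      linear_combination (M.k * y) * h5
    linarith
  rw [h1]
  have := mul_le_mul_of_nonneg_left h2 M.lam_pos.le
  linarith

/-- The piece that contains the log-odds `y ≤ 0` and those just below. -/
def piece (y : ℝ) : Piece :=
  if y ≤ -T.r then stopPiece M else if y ≤ T.s then huntPiece M T.r else confirmPiece M

/-- The piece that contains the log-odds just above `y < 0`. -/
def nextPiece (y : ℝ) : Piece :=
  if y < -T.r then stopPiece M else if y < T.s then huntPiece M T.r else confirmPiece M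

lemma piece_eventually_left (y : ℝ) : ∀ᶠ x in 𝓝[<] y, T.piece x = T.piece y := by
  have hs := T.neg_r_lt_s
  rcases le_or_gt y (-T.r) with h | h
  · filter_upwards [self_mem_nhdsWithin] with x hx
    rw [piece, piece, if_pos h, if_pos (le_of_lt (lt_of_lt_of_le hx h))]
  · have h1 : ∀ᶠ x in 𝓝[<] y, -T.r < x := nhdsWithin_le_nhds (lt_mem_nhds h)
    rcases le_or_gt y T.s with h' | h'
    · filter_upwards [self_mem_nhdsWithin, h1] with x hx hx1
      rw [piece, piece, if_neg (not_le.2 hx1), if_neg (not_le.2 h), if_pos h',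
        if_pos (le_of_lt (lt_of_lt_of_le hx h'))]
    · filter_upwards [h1, nhdsWithin_le_nhds (lt_mem_nhds h')] with x hx1 hx2
      rw [piece, piece, if_neg (not_le.2 hx1), if_neg (not_le.2 h), if_neg (not_le.2 h'),
        if_neg (not_le.2 hx2)]

lemma piece_eventually_right (y : ℝ) : ∀ᶠ x in 𝓝[>] y, T.piece x = T.nextPiece y := by
  have hs := T.neg_r_lt_s
  rcases lt_or_ge y (-T.r) with h | h
  · filter_upwards [nhdsWithin_le_nhds (gt_mem_nhds h)] with x hx
    rw [piece, nextPiece, if_pos h, if_pos (le_of_lt hx)]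
  · rcases lt_or_ge y T.s with h' | h'
    · filter_upwards [self_mem_nhdsWithin, nhdsWithin_le_nhds (gt_mem_nhds h')] with x hx hx2
      rw [piece, nextPiece, if_neg (not_le.2 (lt_of_le_of_lt h hx)), if_neg (not_lt.2 h), if_pos h',
        if_pos hx2.le]
    · filter_upwards [self_mem_nhdsWithin] with x hx
      rw [piece, nextPiece, if_neg (not_le.2 (lt_of_le_of_lt h hx)), if_neg (not_lt.2 h),
        if_neg (not_lt.2 h'), if_neg (not_le.2 (lt_of_le_of_lt h' hx))]

lemma good_piece {y : ℝ} (hy : y ≤ 0) : (T.piece y).Good M (Real.sigmoid y) y := by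
  rw [piece]
  split_ifs with h1 h2
  · exact T.good_stopPiece h1
  · exact T.good_hunt h2
  · exact T.good_confirm (lt_of_lt_of_le (not_le.1 h2) hy) (not_le.1 h2).le hy

lemma good_nextPiece {y : ℝ} (hy : y < 0) : (T.nextPiece y).Good M (Real.sigmoid y) y := by
  rw [nextPiece]
  split_ifs with h1 h2
  · exact T.good_stopPiece h1.le
  · exact T.good_hunt h2.le
  · exact T.good_confirm (lt_of_le_of_lt (not_lt.1 h2) hy) (not_lt.1 h2) hy.le

/-- Value matching: the pieces agree at `-r` by the choice of their constants and at `s` by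
`T.switch`, at the belief of the state itself. At other beliefs they need not agree at `s`. -/
lemma val_nextPiece {y : ℝ} (hy : y < 0) :
    (T.nextPiece y).val (Real.sigmoid y) y = (T.piece y).val (Real.sigmoid y) y := by
  have hs := T.neg_r_lt_s
  rcases lt_trichotomy y (-T.r) with h | h | h
  · rw [nextPiece, piece, if_pos h, if_pos h.le]
  · rw [nextPiece, piece, if_neg h.not_lt, if_pos h.le, if_pos (by linarith), T.val_hunt]
    subst h
    simp only [Piece.val, stopPiece, neg_add_cancel, Real.exp_zero]; ring
  · rw [nextPiece, piece, if_neg h.not_gt, if_neg (not_le.2 h)]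
    rcases lt_trichotomy y T.s with h' | h' | h'
    · rw [if_pos h', if_pos h'.le]
    · rw [if_neg h'.not_lt, if_pos h'.le, ← sub_eq_zero, T.val_confirm_sub_val_hunt, h',
        T.switch (h' ▸ hy)]
      ring
    · rw [if_neg h'.not_gt, if_neg (not_le.2 h')]

/-- The value of a Bayesian DM is decreasing in the belief on the lower side. -/
lemma piece_R_le_L {y : ℝ} (hy : y ≤ 0) : (T.piece y).R y ≤ (T.piece y).L y := by
  have hk := M.k_pos
  rw [piece]
  split_ifs with h1 h2
  · exact M.δ_pos.le
  · have h3 := T.hunt y h2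
    have h4 : Real.exp y ≤ Real.exp (-y) := Real.exp_le_exp.2 (by linarith)
    simp only [huntPiece]; nlinarith
  · have h4 : Real.exp y ≤ 1 := Real.exp_le_one_iff.2 hy
    simp only [confirmPiece]; nlinarith

end Thresholds

/-! ### The Bayesian upper bound -/

namespace Piece

/-- The expected loss relative to the payoff `M.δ`, divided by the standard deviation of the
state of the world. -/
def loss (M : Model) (P : Piece) (y : ℝ) : ℝ :=
  Real.exp (y / 2) * (M.δ - P.R y) + Real.exp (-y / 2) * (M.δ - P.L y)

def loss' (M : Model) (P : Piece) (y : ℝ) : ℝ :=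
  Real.exp (y / 2) * ((M.δ - P.R y) / 2 - P.R' y) +
    Real.exp (-y / 2) * (-(M.δ - P.L y) / 2 - P.L' y)

lemma hasDerivAt_loss (M : Model) (P : Piece) (y : ℝ) :
    HasDerivAt (P.loss M) (P.loss' M y) y := by
  have h1 := (((hasDerivAt_id y).div_const 2).exp).mul ((P.hasDerivAt_R y).const_sub M.δ)
  have h2 := (((hasDerivAt_neg y).div_const 2).exp).mul ((P.hasDerivAt_L y).const_sub M.δ)
  refine (h1.add h2).congr_deriv ?_
  simp only [loss', id]; ring

lemma sigmoid_eq_mul_exp_half (y : ℝ) :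
    Real.sigmoid y = (1 - Real.sigmoid y) * Real.exp (y / 2) * Real.exp (y / 2) := by
  rw [mul_assoc, ← Real.exp_add, add_halves, mul_comm, ← sigmoid_eq_exp_mul]

lemma one_sub_sigmoid_eq (y : ℝ) :
    1 - Real.sigmoid y = (1 - Real.sigmoid y) * Real.exp (y / 2) * Real.exp (-y / 2) := by
  rw [mul_assoc, ← Real.exp_add, neg_div, add_neg_cancel, Real.exp_zero, mul_one]

/-- The factor `(1 - p) * exp (y / 2)` is `√(p (1 - p))`, because `exp y = p / (1 - p)`. -/
lemma mul_loss (M : Model) (P : Piece) (y : ℝ) :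
    (1 - Real.sigmoid y) * Real.exp (y / 2) * P.loss M y = M.δ - P.val (Real.sigmoid y) y := by
  have h1 := sigmoid_eq_mul_exp_half y
  have h2 := one_sub_sigmoid_eq y
  simp only [loss, val]
  linear_combination -(M.δ - P.R y) * h1 - (M.δ - P.L y) * h2

/-- Multiplied by `√(p (1 - p))`, the difference of the two sides is `gainLeft`. The normalization
replaces the belief-dependent arrival rate of news by discounting at the constant rate `M.lam / 2`.
-/
lemma Good.loss_left {M : Model} {P : Piece} {y : ℝ} (h : P.Good M (Real.sigmoid y) y) :
    M.lam * P.loss' M y ≤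
      M.c * (Real.exp (y / 2) + Real.exp (-y / 2)) - M.lam / 2 * P.loss M y := by
  have h0 : 0 < (1 - Real.sigmoid y) * Real.exp (y / 2) :=
    mul_pos (one_sub_sigmoid_pos y) (Real.exp_pos _)
  have h1 := sigmoid_eq_mul_exp_half y
  have h2 := one_sub_sigmoid_eq y
  have h3 := h.left
  have h4 : (1 - Real.sigmoid y) * Real.exp (y / 2) *
      (M.lam * P.loss' M y - (M.c * (Real.exp (y / 2) + Real.exp (-y / 2)) -
        M.lam / 2 * P.loss M y)) = P.gainLeft M (Real.sigmoid y) y := by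
    simp only [loss, loss', gainLeft]
    linear_combination -(-M.c + M.lam * (M.δ - P.R y) - M.lam * P.R' y) * h1 -
      (-M.c - M.lam * P.L' y) * h2
  nlinarith

lemma Good.loss_right {M : Model} {P : Piece} {y : ℝ} (h : P.Good M (Real.sigmoid y) y) :
    -(M.lam * P.loss' M y) ≤
      M.c * (Real.exp (y / 2) + Real.exp (-y / 2)) - M.lam / 2 * P.loss M y := by
  have h0 : 0 < (1 - Real.sigmoid y) * Real.exp (y / 2) :=
    mul_pos (one_sub_sigmoid_pos y) (Real.exp_pos _)
  have h1 := sigmoid_eq_mul_exp_half y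
  have h2 := one_sub_sigmoid_eq y
  have h3 := h.right
  have h4 : (1 - Real.sigmoid y) * Real.exp (y / 2) *
      (-(M.lam * P.loss' M y) - (M.c * (Real.exp (y / 2) + Real.exp (-y / 2)) -
        M.lam / 2 * P.loss M y)) = P.gainRight M (Real.sigmoid y) y := by
    simp only [loss, loss', gainRight]
    linear_combination -(-M.c + M.lam * P.R' y) * h1 -
      (-M.c + M.lam * (M.δ - P.L y) + M.lam * P.L' y) * h2
  nlinarith

/-- The terminal condition of the verification: the loss is at most that of playing `ℓ` at once. -/
lemma Good.loss_le {M : Model} {P : Piece} {y : ℝ} (h : P.Good M (Real.sigmoid y) y) :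
    P.loss M y ≤ M.δ * Real.exp (y / 2) := by
  have h0 : 0 < (1 - Real.sigmoid y) * Real.exp (y / 2) :=
    mul_pos (one_sub_sigmoid_pos y) (Real.exp_pos _)
  have h1 := sigmoid_eq_mul_exp_half y
  have h2 := P.mul_loss M y
  have h3 := h.le_ℓ
  refine le_of_mul_le_mul_left ?_ h0
  rw [h2]
  have : (1 - Real.sigmoid y) * Real.exp (y / 2) * (M.δ * Real.exp (y / 2)) =
    M.δ * Real.sigmoid y := by linear_combination -M.δ * h1
  rw [this]; simp only [Model.U] at h3; linarith

end Piece

lemma eventually_ge_of_hasDerivAt {f : ℝ → ℝ} {f' y ε : ℝ} (hf : HasDerivAt f f' y)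
    (hε : 0 < ε) : ∀ᶠ x in 𝓝 y, f y + f' * (x - y) - ε * |x - y| ≤ f x := by
  filter_upwards [(hasDerivAt_iff_isLittleO.1 hf).def hε] with x hx
  rw [Real.norm_eq_abs, Real.norm_eq_abs, smul_eq_mul] at hx
  have := (abs_le.1 hx).1
  linarith

namespace Thresholds

variable {M : Model} (T : Thresholds M)

/-- The normalized loss of the Bayesian solution. -/
def loss (y : ℝ) : ℝ := (T.piece y).loss M y

/-- The largest rate at which the normalized loss may fall along a path of beliefs. -/
def slack (y : ℝ) : ℝ := M.c * (Real.exp (y / 2) + Real.exp (-y / 2)) - M.lam / 2 * T.loss y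

lemma loss_nextPiece {y : ℝ} (hy : y < 0) : (T.nextPiece y).loss M y = T.loss y := by
  have h0 : 0 < (1 - Real.sigmoid y) * Real.exp (y / 2) :=
    mul_pos (one_sub_sigmoid_pos y) (Real.exp_pos _)
  refine mul_left_cancel₀ h0.ne' ?_
  rw [loss, Piece.mul_loss, Piece.mul_loss, T.val_nextPiece hy]

/-- The slack bounds both `M.lam * loss'` and its negative. -/
lemma slack_nonneg {y : ℝ} (hy : y ≤ 0) : 0 ≤ T.slack y := by
  have h1 := (T.good_piece hy).loss_left
  have h2 := (T.good_piece hy).loss_right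
  simp only [slack, loss]
  linarith

/-- Linear minorants take the place of a derivative, since `T.loss` may have kinks where pieces
meet. They suffice because only decreases of the loss have to be controlled. -/
lemma eventually_loss_ge {y ε : ℝ} (hy : y ≤ 0) (hε : 0 < ε) :
    ∀ᶠ x in 𝓝[≤] y, T.loss y - (T.slack y / M.lam + ε) * |x - y| ≤ T.loss x := by
  have hl := M.lam_pos
  have h1 := T.piece_eventually_left y
  have h2 := eventually_ge_of_hasDerivAt ((T.piece y).hasDerivAt_loss M y) hε
  have h3 : (T.piece y).loss' M y ≤ T.slack y / M.lam := by
    rw [le_div_iff₀ hl, mul_comm]; exact (T.good_piece hy).loss_left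
  rw [eventually_nhdsWithin_iff] at h1 ⊢
  filter_upwards [h1, h2] with x hx1 hx2 hx
  rcases eq_or_lt_of_le (mem_Iic.1 hx) with rfl | hlt
  · simp
  · rw [loss, loss, hx1 hlt]
    have h4 : |x - y| = -(x - y) := abs_of_neg (by linarith)
    have h5 := mul_le_mul_of_nonneg_left h3 (sub_nonneg.2 hlt.le)
    rw [h4] at hx2 ⊢
    linarith

lemma eventually_loss_ge_right {y ε : ℝ} (hy : y < 0) (hε : 0 < ε) :
    ∀ᶠ x in 𝓝[>] y, T.loss y - (T.slack y / M.lam + ε) * |x - y| ≤ T.loss x := by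
  have hl := M.lam_pos
  have h1 := T.piece_eventually_right y
  have h2 := eventually_ge_of_hasDerivAt ((T.nextPiece y).hasDerivAt_loss M y) hε
  have h3 : -(T.nextPiece y).loss' M y ≤ T.slack y / M.lam := by
    have := (T.good_nextPiece hy).loss_right
    rw [T.loss_nextPiece hy] at this
    rw [le_div_iff₀ hl, slack]; linarith
  filter_upwards [h1, nhdsWithin_le_nhds h2, self_mem_nhdsWithin] with x hx1 hx2 hx
  rw [← T.loss_nextPiece hy]
  rw [loss, hx1]
  have h4 : |x - y| = x - y := abs_of_pos (sub_pos.2 hx)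
  have h5 := mul_le_mul_of_nonneg_left h3 (sub_nonneg.2 (le_of_lt (mem_Ioi.1 hx)))
  rw [h4] at hx2 ⊢
  linarith

lemma eventually_loss_ge_nonpos {y ε : ℝ} (hy : y ≤ 0) (hε : 0 < ε) :
    ∀ᶠ x in 𝓝 y, x ≤ 0 → T.loss y - (T.slack y / M.lam + ε) * |x - y| ≤ T.loss x := by
  have h1 := T.eventually_loss_ge hy hε
  rw [eventually_nhdsWithin_iff] at h1
  rcases eq_or_lt_of_le hy with rfl | hlt
  · exact h1
  · have h2 := T.eventually_loss_ge_right hlt hε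
    rw [eventually_nhdsWithin_iff] at h2
    filter_upwards [h1, h2] with x hx1 hx2 _
    rcases le_or_gt x y with h | h
    · exact hx1 h
    · exact hx2 h

lemma continuousOn_loss : ContinuousOn T.loss (Iic 0) := by
  have hleft : ∀ y, ContinuousWithinAt T.loss (Iio y) y := fun y => by
    refine ((T.piece y).hasDerivAt_loss M y).continuousAt.continuousWithinAt.congr_of_eventuallyEq
      ?_ rfl
    filter_upwards [T.piece_eventually_left y] with x hx
    rw [loss, hx]
  intro y hy
  rcases eq_or_lt_of_le (mem_Iic.1 hy) with rfl | hlt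
  · exact continuousWithinAt_Iio_iff_Iic.1 (hleft 0)
  · refine (continuousAt_iff_continuous_left'_right'.2 ⟨hleft y, ?_⟩).continuousWithinAt
    refine ((T.nextPiece y).hasDerivAt_loss M y).continuousAt.continuousWithinAt.congr_of_eventuallyEq
      ?_ (T.loss_nextPiece hlt).symm
    filter_upwards [T.piece_eventually_right y] with x hx
    rw [loss, hx]

lemma exp_half_add_exp_neg_half (z : ℝ) :
    Real.exp (-|z| / 2) + Real.exp (- -|z| / 2) = Real.exp (z / 2) + Real.exp (-z / 2) := by
  rcases abs_cases z with ⟨h, _⟩ | ⟨h, _⟩ <;> rw [h]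
  · rw [neg_neg, add_comm]
  · rw [neg_neg]

/-- Along a path of log-odds of speed at most `M.lam`, the discounted loss of the Bayesian solution
plus the accumulated cost does not decrease. -/
lemma loss_le_along {z : ℝ → ℝ} (hz : ∀ t u, t ≤ u → |z u - z t| ≤ M.lam * (u - t)) {S : ℝ}
    (hS : 0 ≤ S) :
    T.loss (-|z 0|) ≤ Real.exp (-M.lam / 2 * S) * T.loss (-|z S|) +
      M.c * ∫ u in (0 : ℝ)..S, Real.exp (-M.lam / 2 * u) *
        (Real.exp (z u / 2) + Real.exp (-z u / 2)) := by
  have hl := M.lam_pos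
  have hzc : Continuous z := by
    refine (LipschitzWith.of_dist_le_mul (K := M.lam.toNNReal) fun x y => ?_).continuous
    rw [Real.coe_toNNReal _ hl.le, Real.dist_eq, Real.dist_eq]
    rcases le_total x y with h | h
    · rw [abs_sub_comm x y, abs_of_nonneg (sub_nonneg.2 h), abs_sub_comm]; exact hz x y h
    · rw [abs_of_nonneg (sub_nonneg.2 h)]; exact hz y x h
  set g : ℝ → ℝ := fun u => Real.exp (-M.lam / 2 * u) *
    (Real.exp (z u / 2) + Real.exp (-z u / 2)) with hg
  have hgc : Continuous g := by fun_prop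
  have hwc : Continuous fun t => T.loss (-|z t|) :=
    T.continuousOn_loss.comp_continuous (by fun_prop) fun t => by simp
  set Φ : ℝ → ℝ := fun t => Real.exp (-M.lam / 2 * t) * T.loss (-|z t|) +
    M.c * ∫ u in (0 : ℝ)..t, g u with hΦ
  have hIc : Continuous fun t => ∫ u in (0 : ℝ)..t, g u :=
    intervalIntegral.continuous_primitive (fun a b => hgc.intervalIntegrable a b) 0
  have hΦc : Continuous Φ := by fun_prop
  -- `Φ` need not be differentiable; for its monotonicity it is enough that the right slopes of `-Φ`
  -- at `t` are eventually below every `ε > 0`.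
  have key : ∀ ⦃t⦄, t ∈ Icc 0 S → -Φ t ≤ -Φ 0 := by
    refine image_le_of_liminf_slope_right_le_deriv_boundary (f := fun t => -Φ t)
      (B := fun _ => -Φ 0) (B' := fun _ => 0) hΦc.neg.continuousOn le_rfl continuousOn_const
      (fun t _ => hasDerivWithinAt_const _ _ _) fun t ht ε hε => Eventually.frequently ?_
    set y := -|z t| with hy
    have hy0 : y ≤ 0 := by simp [hy]
    set ε₁ := ε / (2 * M.lam) with hε₁
    have hε₁0 : 0 < ε₁ := by positivity
    -- `b` lets the loss fall at the largest admissible rate `slack`. It agrees with `Φ` at `t`,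
    -- where its derivative is zero by the definition of `slack`. It stays below `Φ` up to `ε / 2 *
    -- (u - t)`: the error `ε₁` per unit of log-odds becomes `M.lam * ε₁ = ε / 2` per unit of time.
    set b : ℝ → ℝ := fun u => Real.exp (-M.lam / 2 * u) * (T.loss y - (u - t) * T.slack y) +
      M.c * ∫ v in (0 : ℝ)..u, g v with hb
    have hbd : HasDerivAt b 0 t := by
      have h1 := ((hasDerivAt_id t).const_mul (-M.lam / 2)).exp
      have h2 := (((hasDerivAt_id t).sub_const t).mul_const (T.slack y)).const_sub (T.loss y)
      have h3 := (intervalIntegral.integral_hasDerivAt_right (hgc.intervalIntegrable 0 t)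
        (hgc.stronglyMeasurableAtFilter _ _) hgc.continuousAt).const_mul M.c
      refine ((h1.mul h2).add h3).congr_deriv ?_
      have h4 := exp_half_add_exp_neg_half (z t)
      simp only [id, hg, slack]
      rw [hy, h4]; ring
    have hb1 := nhdsWithin_le_nhds (s := Ioi t)
      (eventually_ge_of_hasDerivAt hbd (half_pos (half_pos hε)))
    have hyc : Tendsto (fun u => -|z u|) (𝓝[>] t) (𝓝 y) :=
      (hzc.abs.neg.tendsto t).mono_left nhdsWithin_le_nhds
    filter_upwards [hb1, hyc.eventually (T.eventually_loss_ge_nonpos hy0 hε₁0),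
      self_mem_nhdsWithin] with u hu1 hu2 hu
    have hut : 0 < u - t := sub_pos.2 hu
    have hd : |-|z u| - y| ≤ M.lam * (u - t) := by
      rw [hy, neg_sub_neg, abs_sub_comm]
      exact (abs_abs_sub_abs_le _ _).trans (hz t u (le_of_lt hu))
    have h5 : T.loss y - (u - t) * T.slack y - ε / 2 * (u - t) ≤ T.loss (-|z u|) := by
      have h6 := hu2 (by simp)
      have h7 : (T.slack y / M.lam + ε₁) * |-|z u| - y| ≤
          (T.slack y / M.lam + ε₁) * (M.lam * (u - t)) :=
        mul_le_mul_of_nonneg_left hd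
          (add_nonneg (div_nonneg (T.slack_nonneg hy0) hl.le) hε₁0.le)
      have h8 : (T.slack y / M.lam + ε₁) * (M.lam * (u - t)) =
          (u - t) * T.slack y + ε / 2 * (u - t) := by rw [hε₁]; field_simp
      linarith
    have hexp0 : 0 < Real.exp (-M.lam / 2 * u) := Real.exp_pos _
    have hexp1 : Real.exp (-M.lam / 2 * u) ≤ 1 := by
      refine Real.exp_le_one_iff.2 ?_
      have : 0 ≤ u := ht.1.trans (le_of_lt hu)
      nlinarith
    have h9 : b u - ε / 2 * (u - t) ≤ Φ u := by
      simp only [hb, hΦ]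
      have h10 := mul_le_mul_of_nonneg_left h5 hexp0.le
      have h11 : Real.exp (-M.lam / 2 * u) * (ε / 2 * (u - t)) ≤ 1 * (ε / 2 * (u - t)) :=
        mul_le_mul_of_nonneg_right hexp1 (by positivity)
      linarith
    have h12 : b t = Φ t := by simp only [hb, hΦ]; rw [← hy]; ring
    rw [h12, abs_of_pos hut] at hu1
    rw [slope_def_field, div_lt_iff₀ hut]
    nlinarith
  have h1 := key (right_mem_Icc.2 hS)
  have h2 : Φ 0 = T.loss (-|z 0|) := by simp [hΦ]
  have h3 : Φ 0 ≤ Φ S := by linarith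
  rwa [h2] at h3

end Thresholds

/-! ### The value of the candidate bounds the payoff of every plan -/

namespace Thresholds

variable {M : Model} (T : Thresholds M)

/-- The value of the Bayesian solution at the belief with log-odds `y`. -/
def bayes (y : ℝ) : ℝ := (T.piece (-|y|)).val (Real.sigmoid (-|y|)) (-|y|)

/-- The standard deviation `√(p (1 - p))` is even in the log-odds. -/
lemma scale_neg_abs (y : ℝ) : (1 - Real.sigmoid (-|y|)) * Real.exp (-|y| / 2) =
    (1 - Real.sigmoid y) * Real.exp (y / 2) := by
  rcases abs_cases y with ⟨h, _⟩ | ⟨h, _⟩ <;> rw [h]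
  · rw [Real.sigmoid_neg, sub_sub_cancel]
    conv_lhs => rw [Piece.sigmoid_eq_mul_exp_half]
    rw [mul_assoc, ← Real.exp_add, ← add_div, add_neg_cancel, zero_div, Real.exp_zero, mul_one]
  · rw [neg_neg]

/-- Upper bound for the payoff collected until time `S` by a Bayesian DM who then stops. -/
lemma integral_core_le {α : ℝ → ℝ} (hα : IsShare α) {S : ℝ} (hS : 0 ≤ S) {ρ : ℝ}
    (hρ : ρ ∈ Icc (0 : ℝ) 1) (y : ℝ) :
    Real.sigmoid y * ((∫ t in (0 : ℝ)..S, core M α t) +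
        Real.exp (-M.lam * ∫ u in (0 : ℝ)..S, α u) * M.U ρ 1) +
      (1 - Real.sigmoid y) * ((∫ t in (0 : ℝ)..S, core M (fun u => 1 - α u) t) +
        Real.exp (-M.lam * ∫ u in (0 : ℝ)..S, (1 - α u)) * M.U ρ 0) ≤ T.bayes y := by
  have hl := M.lam_pos
  set A : ℝ → ℝ := fun t => ∫ u in (0 : ℝ)..t, α u with hA
  set z : ℝ → ℝ := fun t => y - M.lam * (2 * A t - t) with hz
  set h0 := (1 - Real.sigmoid y) * Real.exp (y / 2) with hh0
  have hh0pos : 0 < h0 := mul_pos (one_sub_sigmoid_pos y) (Real.exp_pos _)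
  have hAc : Continuous A := hα.continuous_integral
  have hzc : Continuous z := by fun_prop
  have hlip : ∀ t u, t ≤ u → |z u - z t| ≤ M.lam * (u - t) := by
    intro t u htu
    have h1 := hα.integral_nonneg htu
    have h2 := hα.integral_le htu
    rw [← hα.integral_sub] at h1 h2
    have h3 : z u - z t = M.lam * ((u - t) - 2 * (A u - A t)) := by simp only [hz]; ring
    rw [h3, abs_mul, abs_of_pos hl]
    refine mul_le_mul_of_nonneg_left (abs_le.2 ⟨?_, ?_⟩) hl.le <;> simp only [hA] <;> linarith
  -- The joint probability of world `R` and no news until `t`: its logarithm splits into a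
  -- deterministic decay at rate `M.lam / 2` and half of the log-odds `z t`. In world `L` the
  -- log-odds enter with the opposite sign.
  have hR : ∀ t, Real.sigmoid y * Real.exp (-M.lam * A t) =
      h0 * (Real.exp (-M.lam / 2 * t) * Real.exp (z t / 2)) := by
    intro t
    rw [Piece.sigmoid_eq_mul_exp_half y, ← hh0, mul_assoc, ← Real.exp_add, ← Real.exp_add]
    congr 2; simp only [hz]; ring
  have hL : ∀ t, (1 - Real.sigmoid y) * Real.exp (-M.lam * ∫ u in (0 : ℝ)..t, (1 - α u)) =
      h0 * (Real.exp (-M.lam / 2 * t) * Real.exp (-z t / 2)) := by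
    intro t
    rw [hα.integral_compl, Piece.one_sub_sigmoid_eq y, ← hh0, mul_assoc, ← Real.exp_add,
      ← Real.exp_add]
    congr 2; simp only [hz, hA]; ring
  have hz0 : z 0 = y := by simp [hz, hA]
  have hpath := T.loss_le_along hlip hS
  rw [hz0] at hpath
  have hI : (∫ u in (0 : ℝ)..S, Real.exp (-M.lam / 2 * u) *
      (Real.exp (z u / 2) + Real.exp (-z u / 2))) =
      (∫ u in (0 : ℝ)..S, Real.exp (-M.lam / 2 * u) * Real.exp (z u / 2)) +
        ∫ u in (0 : ℝ)..S, Real.exp (-M.lam / 2 * u) * Real.exp (-z u / 2) := by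
    rw [← intervalIntegral.integral_add]
    · refine intervalIntegral.integral_congr fun u _ => ?_
      ring
    · exact (by fun_prop : Continuous fun u => Real.exp (-M.lam / 2 * u) *
        Real.exp (z u / 2)).intervalIntegrable _ _
    · exact (by fun_prop : Continuous fun u => Real.exp (-M.lam / 2 * u) *
        Real.exp (-z u / 2)).intervalIntegrable _ _
  have hIR : Real.sigmoid y * ∫ u in (0 : ℝ)..S, Real.exp (-M.lam * A u) =
      h0 * ∫ u in (0 : ℝ)..S, Real.exp (-M.lam / 2 * u) * Real.exp (z u / 2) := by
    rw [← intervalIntegral.integral_const_mul, ← intervalIntegral.integral_const_mul]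
    exact intervalIntegral.integral_congr fun u _ => hR u
  have hIL : (1 - Real.sigmoid y) *
      ∫ u in (0 : ℝ)..S, Real.exp (-M.lam * ∫ v in (0 : ℝ)..u, (1 - α v)) =
      h0 * ∫ u in (0 : ℝ)..S, Real.exp (-M.lam / 2 * u) * Real.exp (-z u / 2) := by
    rw [← intervalIntegral.integral_const_mul, ← intervalIntegral.integral_const_mul]
    exact intervalIntegral.integral_congr fun u _ => hL u
  -- On the right is the normalized loss of the terminal mixed action, a mean of two numbers each at
  -- least `M.δ * exp (-|z S| / 2)`, the loss of the better action.
  have hloss : T.loss (-|z S|) ≤ M.δ * ((1 - ρ) * Real.exp (z S / 2) +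
      ρ * Real.exp (-z S / 2)) := by
    have hneg : -|z S| ≤ 0 := by simp
    refine (T.good_piece hneg).loss_le.trans (mul_le_mul_of_nonneg_left ?_ M.δ_pos.le)
    have h1 : Real.exp (-|z S| / 2) ≤ Real.exp (z S / 2) :=
      Real.exp_le_exp.2 (by linarith [neg_abs_le (z S)])
    have h2 : Real.exp (-|z S| / 2) ≤ Real.exp (-z S / 2) :=
      Real.exp_le_exp.2 (by linarith [le_abs_self (z S)])
    nlinarith [mul_le_mul_of_nonneg_left h1 (sub_nonneg.2 hρ.2),
      mul_le_mul_of_nonneg_left h2 hρ.1]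
  have hval : h0 * T.loss (-|y|) = M.δ - T.bayes y := by
    rw [hh0, ← scale_neg_abs, loss, Piece.mul_loss, bayes]
  rw [hα.integral_core M hS, hα.compl.integral_core M hS]
  have hRS := hR S
  have hLS := hL S
  simp only [Model.U]
  rw [hI] at hpath
  have h1 := mul_le_mul_of_nonneg_left hpath hh0pos.le
  have h2 := mul_le_mul_of_nonneg_left hloss
    (mul_nonneg hh0pos.le (Real.exp_pos (-M.lam / 2 * S)).le)
  rw [hval] at h1
  simp only [hA] at hRS hIR
  linear_combination h1 + h2 - M.δ * (1 - ρ) * hRS - M.δ * ρ * hLS - M.c * hIR - M.c * hIL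

/-- A plan that never stops is a limit of truncations. Each truncation is bounded by the plan that
stops at `t` and plays `ℓ`, whose terminal payoff is nonnegative and can be dropped. -/
theorem planPayoffs_le {y v : ℝ} (hv : v ∈ planPayoffs M (Real.sigmoid y)) : v ≤ T.bayes y := by
  obtain ⟨α, S, ρ, hmeas, hmem, hρ, hfin, rfl⟩ := hv
  have hα : IsShare α := ⟨hmeas, hmem⟩
  rcases eq_or_ne S ⊤ with rfl | hS
  · have hs : NeverStops (plan α ⊤ ρ) := fun t _ => ⟨rfl, by simp [plan]⟩
    have hi := (finitePayoff_never M hs).1 hfin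
    rw [payoff, payoffR_never M hs, payoffL_never M hs]
    have h1 := intervalIntegral_tendsto_integral_Ioi 0 hi.1 tendsto_id
    have h2 := intervalIntegral_tendsto_integral_Ioi 0 hi.2 tendsto_id
    refine le_of_tendsto ((h1.const_mul (Real.sigmoid y)).add
      (h2.const_mul (1 - Real.sigmoid y))) ?_
    filter_upwards [eventually_ge_atTop 0] with t ht
    have h3 := T.integral_core_le hα ht (ρ := 0) ⟨le_rfl, zero_le_one⟩ y
    have h4 : 0 ≤ (1 - Real.sigmoid y) * (Real.exp (-M.lam * ∫ u in (0 : ℝ)..t, (1 - α u)) *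
        M.U 0 0) := mul_nonneg (one_sub_sigmoid_pos y).le
          (mul_nonneg (Real.exp_pos _).le (by simp [Model.U, M.δ_pos.le]))
    have h5 : M.U 0 1 = 0 := by simp [Model.U]
    rw [h5] at h3
    simp only [id, plan]
    linarith
  · have hs : StopsAt (plan α S ρ) S.toReal := fun t ht => by
      refine ⟨rfl, ?_⟩
      simp only [plan]
      congr 1
      exact propext (ENNReal.le_ofReal_iff_toReal_le hS ht)
    rw [payoff, payoffR_stops M hs ENNReal.toReal_nonneg, payoffL_stops M hs ENNReal.toReal_nonneg]
    exact T.integral_core_le hα ENNReal.toReal_nonneg hρ y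

/-- A policy that stops at a given time or never, and attains the upper bound, is optimal. -/
theorem isBayesOptimal {s : Policy} {y : ℝ} {S : ℝ≥0∞} (hα : IsShare fun t => (s t).α)
    (hs : ∀ t, 0 ≤ t → (s t).ν = 0 ∧ (s t).m = if S ≤ ENNReal.ofReal t then 1 else 0)
    (hρ : (s S.toReal).ρ ∈ Icc (0 : ℝ) 1) (hfin : FinitePayoff M s)
    (hval : payoff M s (Real.sigmoid y) = T.bayes y) : IsBayesOptimal M s (Real.sigmoid y) := by
  refine IsGreatest.isLUB ⟨⟨fun t => (s t).α, S, (s S.toReal).ρ, hα.meas, hα.mem, hρ, ?_⟩,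
    fun v hv => hval ▸ T.planPayoffs_le hv⟩
  set q := plan (fun t => (s t).α) S (s S.toReal).ρ with hq
  rcases eq_or_ne S ⊤ with rfl | hS
  · have h1 : NeverStops s := fun t ht => by simpa using hs t ht
    have h2 : NeverStops q := fun t _ => ⟨rfl, by simp [hq, plan]⟩
    rw [payoff, payoff, payoffR_never M h1, payoffL_never M h1, payoffR_never M h2,
      payoffL_never M h2]
    exact ⟨(finitePayoff_never M h2).2 ((finitePayoff_never M h1).1 hfin), rfl⟩
  · have h0 : ∀ t, 0 ≤ t → (S ≤ ENNReal.ofReal t ↔ S.toReal ≤ t) :=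
      fun t ht => ENNReal.le_ofReal_iff_toReal_le hS ht
    have h1 : StopsAt s S.toReal := fun t ht => by simpa only [h0 t ht] using hs t ht
    have h2 : StopsAt q S.toReal := fun t ht => ⟨rfl, by simp only [hq, plan, h0 t ht]⟩
    have hS0 : 0 ≤ S.toReal := ENNReal.toReal_nonneg
    refine ⟨finitePayoff_stops M h2 hS0 hα, ?_⟩
    rw [payoff, payoff, payoffR_stops M h1 hS0, payoffL_stops M h1 hS0, payoffR_stops M h2 hS0,
      payoffL_stops M h2 hS0]
    rfl

end Thresholds

/-! ### State paths in log-odds -/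

def logOdds (q : ℝ) : ℝ := Real.log (q / (1 - q))

@[simp]
lemma logOdds_sigmoid (y : ℝ) : logOdds (Real.sigmoid y) = y := by
  have h := one_sub_sigmoid_pos y
  have h1 : Real.sigmoid y / (1 - Real.sigmoid y) = Real.exp y := by
    rw [div_eq_iff h.ne']; exact sigmoid_eq_exp_mul y
  rw [logOdds, h1, Real.log_exp]

lemma sigmoid_logOdds {q : ℝ} (hq : q ∈ Ioo (0 : ℝ) 1) : Real.sigmoid (logOdds q) = q := by
  have h0 : q ∈ range Real.sigmoid := by rw [Real.range_sigmoid]; exact hq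
  obtain ⟨y, rfl⟩ := h0
  rw [logOdds_sigmoid]

lemma sigmoid_mem (y : ℝ) : Real.sigmoid y ∈ Ioo (0 : ℝ) 1 :=
  ⟨Real.sigmoid_pos y, Real.sigmoid_lt_one y⟩

lemma measurable_logOdds : Measurable logOdds := by unfold logOdds; fun_prop

lemma hasDerivAt_logOdds {q : ℝ} (hq : q ∈ Ioo (0 : ℝ) 1) :
    HasDerivAt logOdds (1 / (q * (1 - q))) q := by
  have h0 : q ≠ 0 := hq.1.ne'
  have h1 : 1 - q ≠ 0 := (sub_pos.2 hq.2).ne'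
  have := ((hasDerivAt_id q).div ((hasDerivAt_id q).const_sub 1) h1).log (div_ne_zero h0 h1)
  refine this.congr_deriv ?_
  simp only [id, Pi.div_apply]; field_simp; ring

lemma continuousAt_logOdds {q : ℝ} (hq : q ∈ Ioo (0 : ℝ) 1) : ContinuousAt logOdds q :=
  (hasDerivAt_logOdds hq).continuousAt

lemma logOdds_le_iff {q y : ℝ} (hq : q ∈ Ioo (0 : ℝ) 1) : logOdds q ≤ y ↔ q ≤ Real.sigmoid y := by
  conv_rhs => rw [← sigmoid_logOdds hq]
  exact Real.sigmoid_le_iff.symm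

lemma le_logOdds_iff {q y : ℝ} (hq : q ∈ Ioo (0 : ℝ) 1) : y ≤ logOdds q ↔ Real.sigmoid y ≤ q := by
  conv_rhs => rw [← sigmoid_logOdds hq]
  exact Real.sigmoid_le_iff.symm

/-- `y` is the path that starts at `y₀` and whose right derivative is `v` of its position. -/
structure IsFlowPath (v : ℝ → ℝ) (y₀ : ℝ) (y : ℝ → ℝ) : Prop where
  init : ∀ t, t ≤ 0 → y t = y₀
  cont : Continuous y
  law : ∀ t, 0 ≤ t → HasDerivWithinAt y (v (y t)) (Ioi t) t

/-- A local condition on a piecewise constant velocity under which motion from `x` is determined. -/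
def RightUnique (v : ℝ → ℝ) (x : ℝ) : Prop :=
  (v x = 0 ∧ (∀ᶠ z in 𝓝[>] x, v z ≤ 0) ∧ ∀ᶠ z in 𝓝[<] x, 0 ≤ v z) ∨
    (0 < v x ∧ ∀ᶠ z in 𝓝[>] x, v z = v x) ∨ (v x < 0 ∧ ∀ᶠ z in 𝓝[<] x, v z = v x)

/-- The deviation from uniform motion is not expanded: its product with its own right derivative is
nonpositive. At a rest point the neighbouring velocities point back or vanish; otherwise the path
enters the side on which the velocity is constant. -/
lemma IsFlowPath.eventually_eq {v : ℝ → ℝ} {y₀ : ℝ} {y : ℝ → ℝ} (h : IsFlowPath v y₀ y) {t : ℝ}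
    (ht : 0 ≤ t) (hv : RightUnique v (y t)) :
    ∀ᶠ u in 𝓝[>] t, y u = y t + v (y t) * (u - t) := by
  have hcont : Tendsto y (𝓝[>] t) (𝓝 (y t)) := (h.cont.tendsto t).mono_left nhdsWithin_le_nhds
  have hslope : Tendsto (slope y t) (𝓝[>] t) (𝓝 (v (y t))) := by
    have := hasDerivWithinAt_iff_tendsto_slope.1 (h.law t ht)
    rwa [sdiff_singleton_eq_self (by simp)] at this
  have key : ∀ᶠ u in 𝓝[>] t, (y u - y t - v (y t) * (u - t)) * (v (y u) - v (y t)) ≤ 0 := by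
    rcases hv with ⟨h0, hr, hl⟩ | ⟨h0, hr⟩ | ⟨h0, hl⟩
    · rw [eventually_nhdsWithin_iff] at hr hl
      filter_upwards [hcont.eventually hr, hcont.eventually hl] with u h1 h2
      rw [h0, zero_mul, sub_zero, sub_zero]
      rcases lt_trichotomy (y u) (y t) with h3 | h3 | h3
      · exact mul_nonpos_of_nonpos_of_nonneg (by linarith) (h2 h3)
      · rw [h3, sub_self, zero_mul]
      · exact mul_nonpos_of_nonneg_of_nonpos (by linarith) (h1 h3)
    · rw [eventually_nhdsWithin_iff] at hr
      filter_upwards [hcont.eventually hr, hslope.eventually (lt_mem_nhds h0),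
        self_mem_nhdsWithin] with u h1 h2 h3
      rw [slope_def_field, div_pos_iff_of_pos_right (sub_pos.2 h3), sub_pos] at h2
      rw [h1 h2, sub_self, mul_zero]
    · rw [eventually_nhdsWithin_iff] at hl
      filter_upwards [hcont.eventually hl, hslope.eventually (gt_mem_nhds h0),
        self_mem_nhdsWithin] with u h1 h2 h3
      rw [slope_def_field, div_lt_iff₀ (sub_pos.2 h3), zero_mul, sub_neg] at h2
      rw [h1 h2, sub_self, mul_zero]
  obtain ⟨b, hb, hb'⟩ := (mem_nhdsGT_iff_exists_Ioo_subset).1 key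
  filter_upwards [Ioo_mem_nhdsGT hb] with u hu
  -- The squared deviation starts at zero and has nonpositive right derivative, so it stays zero.
  have hle := image_le_of_deriv_right_le_deriv_boundary
    (f := fun s => (y s - y t - v (y t) * (s - t)) ^ 2)
    (f' := fun s => 2 * ((y s - y t - v (y t) * (s - t)) * (v (y s) - v (y t))))
    (a := t) (b := u) (B := fun _ => 0) (B' := fun _ => 0)
    (by have := h.cont; fun_prop) (fun s hs => ?_) (by simp) continuousOn_const
    (fun s _ => hasDerivWithinAt_const _ _ _) (fun s hs => ?_) (right_mem_Icc.2 hu.1.le)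
  · have := pow_eq_zero_iff (two_ne_zero) |>.1 (le_antisymm hle (sq_nonneg _))
    linarith
  · have h1 := (h.law s (ht.trans hs.1)).Ici_of_Ioi
    have h2 := ((h1.sub_const (y t)).sub
      ((((hasDerivWithinAt_id s (Ici s)).sub_const t).const_mul (v (y t))))).pow 2
    refine h2.congr_deriv ?_
    simp only [Pi.sub_apply, id]; ring
  · rcases eq_or_lt_of_le hs.1 with rfl | hlt
    · simp
    · have : (y s - y t - v (y t) * (s - t)) * (v (y s) - v (y t)) ≤ 0 :=
        hb' ⟨hlt, hs.2.trans hu.2⟩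
      linarith

/-- The set of times at which two paths agree is closed, and by local determinacy it extends to the
right of each of its points. -/
theorem IsFlowPath.unique {v : ℝ → ℝ} (hv : ∀ x, RightUnique v x) {y₀ : ℝ} {y z : ℝ → ℝ}
    (hy : IsFlowPath v y₀ y) (hz : IsFlowPath v y₀ z) : y = z := by
  ext t
  rcases le_or_gt t 0 with ht | ht
  · rw [hy.init t ht, hz.init t ht]
  · have hcl : IsClosed ({u | y u = z u} ∩ Icc 0 t) :=
      (isClosed_eq hy.cont hz.cont).inter isClosed_Icc
    refine hcl.Icc_subset_of_forall_mem_nhdsWithin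
      ((hy.init 0 le_rfl).trans (hz.init 0 le_rfl).symm) ?_ (right_mem_Icc.2 ht.le)
    rintro u ⟨hu, hu0, -⟩
    replace hu : y u = z u := hu
    filter_upwards [hy.eventually_eq hu0 (hv _), hz.eventually_eq hu0 (hv _)] with w h1 h2
    rw [h1, h2, hu]

/-- Time derivative of the log-odds of the state under the control `u`. -/
def vel (M : Model) (u : Control) : ℝ := -(2 * u.α - 1) * M.lam

lemma IsStatePath.isFlowPath {M : Model} {ctrl : ℝ → Control} {y₀ : ℝ} {x : ℝ → ℝ}
    (h : IsStatePath M (fun q => ctrl (logOdds q)) (Real.sigmoid y₀) x) :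
    IsFlowPath (fun y => vel M (ctrl y)) y₀ (fun t => logOdds (x t)) where
  init t ht := by rw [h.init t ht, logOdds_sigmoid]
  cont := continuous_iff_continuousAt.2 fun t =>
    (continuousAt_logOdds (h.mem t)).comp h.cont.continuousAt
  law t ht := by
    have h0 : x t ≠ 0 := (h.mem t).1.ne'
    have h1 : 1 - x t ≠ 0 := (sub_pos.2 (h.mem t).2).ne'
    refine ((hasDerivAt_logOdds (h.mem t)).comp_hasDerivWithinAt t (h.law t ht)).congr_deriv ?_
    simp only [vel, Model.drift]; field_simp

lemma IsFlowPath.isStatePath {M : Model} {ctrl : ℝ → Control} {y₀ : ℝ} {y : ℝ → ℝ}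
    (h : IsFlowPath (fun y => vel M (ctrl y)) y₀ y) :
    IsStatePath M (fun q => ctrl (logOdds q)) (Real.sigmoid y₀) (fun t => Real.sigmoid (y t)) where
  init t ht := by rw [h.init t ht]
  cont := h.cont.sigmoid
  mem t := sigmoid_mem _
  law t ht := by
    refine ((Real.hasDerivAt_sigmoid (y t)).comp_hasDerivWithinAt t (h.law t ht)).congr_deriv ?_
    simp only [vel, Model.drift, logOdds_sigmoid]; ring

theorem existsUnique_statePath {M : Model} {ctrl : ℝ → Control}
    (hv : ∀ y, RightUnique (fun y => vel M (ctrl y)) y) {y₀ : ℝ} {y : ℝ → ℝ}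
    (h : IsFlowPath (fun y => vel M (ctrl y)) y₀ y) :
    ∃! x, IsStatePath M (fun q => ctrl (logOdds q)) (Real.sigmoid y₀) x := by
  refine ⟨_, h.isStatePath, fun x hx => ?_⟩
  have := hx.isFlowPath.unique hv h
  ext t
  rw [← congrFun this t, sigmoid_logOdds (hx.mem t)]

/-- `statePath` is a choice; uniqueness identifies it with any explicit path. -/
theorem induced_eq {M : Model} {ctrl : ℝ → Control}
    (hv : ∀ y, RightUnique (fun y => vel M (ctrl y)) y) {y₀ : ℝ} {y : ℝ → ℝ}
    (h : IsFlowPath (fun y => vel M (ctrl y)) y₀ y) (t : ℝ) :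
    induced M (fun q => ctrl (logOdds q)) (Real.sigmoid y₀) t = ctrl (y t) := by
  have h1 := existsUnique_statePath hv h
  have h2 : IsStatePath M (fun q => ctrl (logOdds q)) (Real.sigmoid y₀)
      (statePath M (fun q => ctrl (logOdds q)) (Real.sigmoid y₀)) :=
    Classical.epsilon_spec h1.exists
  rw [induced, h1.unique h2 h.isStatePath, logOdds_sigmoid]

/-! ### Two-phase behaviour -/

/-- From log-odds `y` on, the control is `u₀` until time `τ` and then `u₁`, with the state at rest
and the DM either stopping or waiting for news forever. -/
structure Phases (M : Model) (ctrl : ℝ → Control) (y τ : ℝ) (u₀ u₁ : Control) : Prop where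
  τ_nonneg : 0 ≤ τ
  before : ∀ t, 0 ≤ t → t < τ → ctrl (y + vel M u₀ * t) = u₀
  after : ctrl (y + vel M u₀ * τ) = u₁
  α₀ : u₀.α = 1 ∨ u₀.α = 0
  ν₀ : u₀.ν = 0
  m₀ : u₀.m = 0
  α₁ : u₁.α = 1 / 2
  ν₁ : u₁.ν = 0
  m₁ : u₁.m = 1 ∨ u₁.m = 0

def ramp (y a τ t : ℝ) : ℝ := y + a * max 0 (min t τ)

lemma ramp_of_lt {y a τ t : ℝ} (ht : 0 ≤ t) (h : t < τ) : ramp y a τ t = y + a * t := by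
  rw [ramp, min_eq_left h.le, max_eq_right ht]

lemma ramp_of_ge {y a τ t : ℝ} (hτ : 0 ≤ τ) (h : τ ≤ t) : ramp y a τ t = y + a * τ := by
  rw [ramp, min_eq_right h, max_eq_right hτ]

namespace Phases

variable {M : Model} {ctrl : ℝ → Control} {y τ : ℝ} {u₀ u₁ : Control}

lemma ctrl_ramp (h : Phases M ctrl y τ u₀ u₁) {t : ℝ} (ht : 0 ≤ t) :
    ctrl (ramp y (vel M u₀) τ t) = if t < τ then u₀ else u₁ := by
  split_ifs with hlt
  · rw [ramp_of_lt ht hlt, h.before t ht hlt]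
  · rw [ramp_of_ge h.τ_nonneg (not_lt.1 hlt), h.after]

lemma isFlowPath (h : Phases M ctrl y τ u₀ u₁) :
    IsFlowPath (fun y => vel M (ctrl y)) y (ramp y (vel M u₀) τ) where
  init t ht := by rw [ramp, max_eq_left ((min_le_left _ _).trans ht), mul_zero, add_zero]
  cont := by unfold ramp; fun_prop
  law t ht := by
    simp only [h.ctrl_ramp ht]
    split_ifs with hlt
    · have h1 : HasDerivWithinAt (fun t => y + vel M u₀ * t) (vel M u₀) (Ioi t) t := by
        simpa using (((hasDerivAt_id t).const_mul (vel M u₀)).const_add y).hasDerivWithinAt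
      refine h1.congr_of_eventuallyEq ?_ (ramp_of_lt ht hlt)
      filter_upwards [Ioo_mem_nhdsGT hlt] with u hu
      exact ramp_of_lt (ht.trans hu.1.le) hu.2
    · have h1 : vel M u₁ = 0 := by rw [vel, h.α₁]; ring
      rw [h1]
      refine (hasDerivWithinAt_const t (Ioi t) (y + vel M u₀ * τ)).congr_of_eventuallyEq ?_
        (ramp_of_ge h.τ_nonneg (not_lt.1 hlt))
      filter_upwards [self_mem_nhdsWithin] with u hu
      exact ramp_of_ge h.τ_nonneg ((not_lt.1 hlt).trans (le_of_lt hu))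

end Phases

/-! ### Payoffs of two-phase policies -/

/-- Payoff in a state whose evidence gets attention `β ∈ {0, 1}` until `τ`, when the continuation
payoff is `X`. -/
def phaseValue (M : Model) (β τ X : ℝ) : ℝ :=
  β * ((M.δ - M.k) * (1 - Real.exp (-M.lam * τ))) - (1 - β) * (M.c * τ) +
    Real.exp (-M.lam * (β * τ)) * X

lemma integral_eq_of_eqOn {β : ℝ → ℝ} {b τ t : ℝ} (h : ∀ u, 0 ≤ u → u < τ → β u = b)
    (ht : 0 ≤ t) (htτ : t ≤ τ) : ∫ u in (0 : ℝ)..t, β u = b * t := by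
  rw [intervalIntegral.integral_of_le ht, integral_Ioc_eq_integral_Ioo,
    setIntegral_congr_fun (g := fun _ => b) measurableSet_Ioo
      fun u hu => h u hu.1.le (hu.2.trans_le htτ)]
  simp [ht, mul_comm]

lemma integral_core_phase (M : Model) {β : ℝ → ℝ} {b τ : ℝ} (hb : b = 1 ∨ b = 0) (hτ : 0 ≤ τ)
    (h : ∀ u, 0 ≤ u → u < τ → β u = b) :
    ∫ t in (0 : ℝ)..τ, core M β t = phaseValue M b τ 0 := by
  have hone : IsShare fun _ => (1 : ℝ) := ⟨measurable_const, fun _ => ⟨zero_le_one, le_rfl⟩⟩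
  have h1 : ∫ t in (0 : ℝ)..τ, core M β t =
      ∫ t in (0 : ℝ)..τ, Real.exp (-M.lam * (b * t)) * (M.lam * b * M.δ - M.c) := by
    rw [intervalIntegral.integral_of_le hτ, intervalIntegral.integral_of_le hτ,
      integral_Ioc_eq_integral_Ioo, integral_Ioc_eq_integral_Ioo]
    refine setIntegral_congr_fun measurableSet_Ioo fun t ht => ?_
    simp only [core]
    rw [integral_eq_of_eqOn h ht.1.le ht.2.le, h t ht.1.le ht.2]
  rw [h1]
  rcases hb with rfl | rfl
  · have h2 := hone.integral_exp M hτ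
    simp only [intervalIntegral.integral_const, sub_zero, smul_eq_mul, mul_one] at h2
    rw [phaseValue, ← h2, intervalIntegral.integral_mul_const, intervalIntegral.integral_mul_const,
      ← M.lam_mul_k]
    simp only [one_mul]; ring
  · simp [phaseValue]; ring

lemma core_tail (M : Model) {β : ℝ → ℝ} (hβ : IsShare β) {b τ : ℝ} (hτ : 0 ≤ τ)
    (h : ∀ u, 0 ≤ u → u < τ → β u = b) (h' : ∀ u, τ ≤ u → β u = 1 / 2) {t : ℝ} (ht : τ ≤ t) :
    core M β t = Real.exp (-M.lam * (b * τ)) * Real.exp (M.lam / 2 * τ) *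
      (M.lam * (1 / 2) * M.δ - M.c) * Real.exp (-(M.lam / 2) * t) := by
  have h1 : ∫ u in (0 : ℝ)..t, β u = b * τ + (t - τ) / 2 := by
    rw [← integral_eq_of_eqOn h hτ le_rfl, ← intervalIntegral.integral_add_adjacent_intervals
      (hβ.intervalIntegrable 0 τ) (hβ.intervalIntegrable τ t)]
    congr 1
    rw [intervalIntegral.integral_congr (g := fun _ => (1 / 2 : ℝ))]
    · simp; ring
    · intro u hu
      rw [uIcc_of_le ht] at hu
      exact h' u hu.1
  rw [core, h1, h' t ht, ← Real.exp_add, mul_right_comm _ _ (Real.exp (-(M.lam / 2) * t)),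
    ← Real.exp_add]
  congr 2; ring

lemma integrableOn_core_tail (M : Model) {β : ℝ → ℝ} (hβ : IsShare β) {b τ : ℝ} (hτ : 0 ≤ τ)
    (h : ∀ u, 0 ≤ u → u < τ → β u = b) (h' : ∀ u, τ ≤ u → β u = 1 / 2) :
    IntegrableOn (core M β) (Ioi τ) := by
  have hl : -(M.lam / 2) < 0 := by linarith [M.lam_pos]
  refine IntegrableOn.congr_fun ?_
    (fun t ht => (core_tail M hβ hτ h h' (le_of_lt ht)).symm) measurableSet_Ioi
  exact Integrable.const_mul (integrableOn_exp_mul_Ioi hl τ) _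

lemma integrableOn_core_split (M : Model) {β : ℝ → ℝ} (hβ : IsShare β) {b τ : ℝ} (hτ : 0 ≤ τ)
    (h : ∀ u, 0 ≤ u → u < τ → β u = b) (h' : ∀ u, τ ≤ u → β u = 1 / 2) :
    IntegrableOn (core M β) (Ioi 0) := by
  rw [← Ioc_union_Ioi_eq_Ioi hτ]
  exact ((intervalIntegrable_iff_integrableOn_Ioc_of_le hτ).1
    (hβ.intervalIntegrable_core M 0 τ)).union (integrableOn_core_tail M hβ hτ h h')

/-- From `τ` on, news arrives at rate `M.lam / 2` in either world, so the continuation is worth `M.δ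
- M.c / (M.lam / 2)`. -/
lemma integral_core_split (M : Model) {β : ℝ → ℝ} (hβ : IsShare β) {b τ : ℝ} (hb : b = 1 ∨ b = 0)
    (hτ : 0 ≤ τ) (h : ∀ u, 0 ≤ u → u < τ → β u = b) (h' : ∀ u, τ ≤ u → β u = 1 / 2) :
    ∫ t in Ioi (0 : ℝ), core M β t = phaseValue M b τ (M.δ - 2 * M.k) := by
  have hl := M.lam_pos
  have hl' : -(M.lam / 2) < 0 := by linarith
  rw [← Ioc_union_Ioi_eq_Ioi hτ, setIntegral_union Ioc_disjoint_Ioi_same measurableSet_Ioi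
    ((intervalIntegrable_iff_integrableOn_Ioc_of_le hτ).1 (hβ.intervalIntegrable_core M 0 τ))
    (integrableOn_core_tail M hβ hτ h h'), ← intervalIntegral.integral_of_le hτ,
    integral_core_phase M hb hτ h,
    setIntegral_congr_fun measurableSet_Ioi fun t ht => core_tail M hβ hτ h h' (le_of_lt ht),
    integral_const_mul, integral_exp_mul_Ioi hl']
  have h1 : Real.exp (M.lam / 2 * τ) * Real.exp (-(M.lam / 2) * τ) = 1 := by
    rw [← Real.exp_add]; simp
  have h2 : (M.lam * (1 / 2) * M.δ - M.c) = M.lam / 2 * (M.δ - 2 * M.k) := by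
    rw [← M.lam_mul_k]; ring
  rw [h2, phaseValue, phaseValue, mul_zero, add_zero]
  congr 1
  generalize Real.exp (M.lam / 2 * τ) = E at h1 ⊢
  generalize Real.exp (-(M.lam / 2) * τ) = F at h1 ⊢
  field_simp
  linear_combination (M.δ - 2 * M.k) * h1

/-- The policy uses the control `u₀` until time `τ` and then `u₁`, as in `Phases`. -/
structure TwoPhase (s : Policy) (τ : ℝ) (u₀ u₁ : Control) : Prop where
  eq : ∀ t, 0 ≤ t → s t = if t < τ then u₀ else u₁
  share : IsShare fun t => (s t).α
  τ_nonneg : 0 ≤ τ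
  α₀ : u₀.α = 1 ∨ u₀.α = 0
  ν₀ : u₀.ν = 0
  m₀ : u₀.m = 0
  α₁ : u₁.α = 1 / 2
  ν₁ : u₁.ν = 0
  m₁ : u₁.m = 1 ∨ u₁.m = 0

namespace TwoPhase

variable {M : Model} {s : Policy} {τ : ℝ} {u₀ u₁ : Control}

lemma eq_before (h : TwoPhase s τ u₀ u₁) {t : ℝ} (ht : 0 ≤ t) (h' : t < τ) : s t = u₀ := by
  rw [h.eq t ht, if_pos h']

lemma eq_after (h : TwoPhase s τ u₀ u₁) {t : ℝ} (h' : τ ≤ t) : s t = u₁ := by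
  rw [h.eq t (h.τ_nonneg.trans h'), if_neg (not_lt.2 h')]

lemma stopsAt (h : TwoPhase s τ u₀ u₁) (hm : u₁.m = 1) : StopsAt s τ := fun t ht => by
  rcases lt_or_ge t τ with h' | h'
  · rw [h.eq_before ht h', if_neg (not_le.2 h')]; exact ⟨h.ν₀, h.m₀⟩
  · rw [h.eq_after h', if_pos h']; exact ⟨h.ν₁, hm⟩

lemma neverStops (h : TwoPhase s τ u₀ u₁) (hm : u₁.m = 0) : NeverStops s := fun t ht => by
  rcases lt_or_ge t τ with h' | h'
  · rw [h.eq_before ht h']; exact ⟨h.ν₀, h.m₀⟩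
  · rw [h.eq_after h']; exact ⟨h.ν₁, hm⟩

lemma α_compl (h : TwoPhase s τ u₀ u₁) : 1 - u₀.α = 1 ∨ 1 - u₀.α = 0 := by
  rcases h.α₀ with h | h <;> rw [h] <;> norm_num

lemma compl_before (h : TwoPhase s τ u₀ u₁) :
    ∀ u, 0 ≤ u → u < τ → 1 - (s u).α = 1 - u₀.α := fun u hu hu' => by rw [h.eq_before hu hu']

lemma compl_after (h : TwoPhase s τ u₀ u₁) : ∀ u, τ ≤ u → 1 - (s u).α = 1 / 2 := fun u hu => by
  rw [h.eq_after hu, h.α₁]; norm_num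

lemma α_before (h : TwoPhase s τ u₀ u₁) :
    ∀ u, 0 ≤ u → u < τ → (s u).α = u₀.α := fun u hu hu' => by rw [h.eq_before hu hu']

lemma α_after (h : TwoPhase s τ u₀ u₁) : ∀ u, τ ≤ u → (s u).α = 1 / 2 := fun u hu => by
  rw [h.eq_after hu, h.α₁]

lemma finitePayoff (h : TwoPhase s τ u₀ u₁) : FinitePayoff M s := by
  rcases h.m₁ with hm | hm
  · exact finitePayoff_stops M (h.stopsAt hm) h.τ_nonneg h.share
  · rw [finitePayoff_never M (h.neverStops hm)]
    exact ⟨integrableOn_core_split M h.share h.τ_nonneg h.α_before h.α_after,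
      integrableOn_core_split M h.share.compl h.τ_nonneg h.compl_before h.compl_after⟩

lemma payoffR_eq_of_stopping (h : TwoPhase s τ u₀ u₁) (hm : u₁.m = 1) :
    payoffR M s = phaseValue M u₀.α τ (M.U u₁.ρ 1) := by
  rw [payoffR_stops M (h.stopsAt hm) h.τ_nonneg,
    integral_core_phase M h.α₀ h.τ_nonneg h.α_before, noNewsR,
    integral_eq_of_eqOn h.α_before h.τ_nonneg le_rfl, h.eq_after le_rfl]
  simp only [phaseValue]; ring

lemma payoffL_eq_of_stopping (h : TwoPhase s τ u₀ u₁) (hm : u₁.m = 1) :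
    payoffL M s = phaseValue M (1 - u₀.α) τ (M.U u₁.ρ 0) := by
  rw [payoffL_stops M (h.stopsAt hm) h.τ_nonneg,
    integral_core_phase M h.α_compl h.τ_nonneg h.compl_before, noNewsL,
    integral_eq_of_eqOn h.compl_before h.τ_nonneg le_rfl, h.eq_after le_rfl]
  simp only [phaseValue]; ring

lemma payoffR_eq_of_wait (h : TwoPhase s τ u₀ u₁) (hm : u₁.m = 0) :
    payoffR M s = phaseValue M u₀.α τ (M.δ - 2 * M.k) := by
  rw [payoffR_never M (h.neverStops hm),
    integral_core_split M h.share h.α₀ h.τ_nonneg h.α_before h.α_after]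

lemma payoffL_eq_of_wait (h : TwoPhase s τ u₀ u₁) (hm : u₁.m = 0) :
    payoffL M s = phaseValue M (1 - u₀.α) τ (M.δ - 2 * M.k) := by
  rw [payoffL_never M (h.neverStops hm),
    integral_core_split M h.share.compl h.α_compl h.τ_nonneg h.compl_before h.compl_after]

lemma isBayesOptimal (T : Thresholds M) (h : TwoPhase s τ u₀ u₁)
    (hρ : ∀ t, (s t).ρ ∈ Icc (0 : ℝ) 1) {y : ℝ}
    (hval : payoff M s (Real.sigmoid y) = T.bayes y) : IsBayesOptimal M s (Real.sigmoid y) := by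
  rcases h.m₁ with hm | hm
  · refine T.isBayesOptimal (S := ENNReal.ofReal τ) h.share (fun t ht => ?_) (hρ _)
      h.finitePayoff hval
    simp only [ENNReal.ofReal_le_ofReal_iff ht]
    exact h.stopsAt hm t ht
  · exact T.isBayesOptimal (S := ⊤) h.share (fun t ht => by simpa using h.neverStops hm t ht)
      (hρ _) h.finitePayoff hval

end TwoPhase

/-! ### The equilibrium strategy -/

/-- The control with the roles of the two states of the world exchanged. -/
def Control.mirror (u : Control) : Control := ⟨1 - u.α, u.ν, u.m, 1 - u.ρ⟩

def stopControl : Control := ⟨1 / 2, 0, 1, 0⟩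

def huntControl : Control := ⟨1, 0, 0, 0⟩

def confirmControl : Control := ⟨0, 0, 0, 0⟩

def splitControl : Control := ⟨1 / 2, 0, 0, 1 / 2⟩

def hedgeControl : Control := ⟨1 / 2, 0, 1, 1 / 2⟩

/-- The control in the states whose belief set contains `1/2` in its interior. -/
def midControl (M : Model) : Control :=
  if M.δ / 2 ≤ M.δ - 2 * M.k then splitControl else hedgeControl

def midValue (M : Model) : ℝ := max (M.δ - 2 * M.k) (M.δ / 2)

lemma vel_mirror (M : Model) (u : Control) : vel M u.mirror = -vel M u := by
  simp only [vel, Control.mirror]; ring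

/-- Continuation payoff in state `R` when the control stays `u` forever. -/
def restR (M : Model) (u : Control) : ℝ := if u.m = 1 then M.U u.ρ 1 else M.δ - 2 * M.k

/-- Continuation payoff in state `L` when the control stays `u` forever. -/
def restL (M : Model) (u : Control) : ℝ := if u.m = 1 then M.U u.ρ 0 else M.δ - 2 * M.k

lemma restR_mirror (M : Model) (u : Control) : restR M u.mirror = restL M u := by
  simp only [restR, restL, Control.mirror, Model.U]; ring_nf

lemma restL_mirror (M : Model) (u : Control) : restL M u.mirror = restR M u := by
  simp only [restR, restL, Control.mirror, Model.U]; ring_nf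

lemma RightUnique.congr {v w : ℝ → ℝ} {x : ℝ} (h : RightUnique v x) (hvw : w =ᶠ[𝓝 x] v) :
    RightUnique w x := by
  have hx := hvw.eq_of_nhds
  have hr : w =ᶠ[𝓝[>] x] v := hvw.filter_mono nhdsWithin_le_nhds
  have hl : w =ᶠ[𝓝[<] x] v := hvw.filter_mono nhdsWithin_le_nhds
  rcases h with ⟨h0, h1, h2⟩ | ⟨h0, h1⟩ | ⟨h0, h1⟩
  · refine Or.inl ⟨hx.trans h0, ?_, ?_⟩
    · filter_upwards [hr, h1] with z hz hz'; rwa [hz]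
    · filter_upwards [hl, h2] with z hz hz'; rwa [hz]
  · refine Or.inr (Or.inl ⟨by rwa [hx], ?_⟩)
    filter_upwards [hr, h1] with z hz hz'; rw [hz, hx, hz']
  · refine Or.inr (Or.inr ⟨by rwa [hx], ?_⟩)
    filter_upwards [hl, h1] with z hz hz'; rw [hz, hx, hz']

lemma tendsto_const_sub_left (Δ y : ℝ) : Tendsto (fun z => Δ - z) (𝓝[<] y) (𝓝[>] (Δ - y)) := by
  refine tendsto_nhdsWithin_iff.2 ⟨((continuous_const.sub continuous_id).tendsto y).mono_left
    nhdsWithin_le_nhds, ?_⟩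
  filter_upwards [self_mem_nhdsWithin] with z hz
  exact sub_lt_sub_left (mem_Iio.1 hz) Δ

lemma tendsto_const_sub_right (Δ y : ℝ) : Tendsto (fun z => Δ - z) (𝓝[>] y) (𝓝[<] (Δ - y)) := by
  refine tendsto_nhdsWithin_iff.2 ⟨((continuous_const.sub continuous_id).tendsto y).mono_left
    nhdsWithin_le_nhds, ?_⟩
  filter_upwards [self_mem_nhdsWithin] with z hz
  exact sub_lt_sub_left (mem_Ioi.1 hz) Δ

lemma RightUnique.mirror {v : ℝ → ℝ} {Δ y : ℝ} (h : RightUnique v (Δ - y)) :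
    RightUnique (fun z => -v (Δ - z)) y := by
  have hl := tendsto_const_sub_left Δ y
  have hr := tendsto_const_sub_right Δ y
  rcases h with ⟨h0, h1, h2⟩ | ⟨h0, h1⟩ | ⟨h0, h1⟩
  · refine Or.inl ⟨by simp [h0], ?_, ?_⟩
    · filter_upwards [hr.eventually h2] with z hz; linarith
    · filter_upwards [hl.eventually h1] with z hz; linarith
  · refine Or.inr (Or.inr ⟨by linarith, ?_⟩)
    filter_upwards [hl.eventually h1] with z hz; rw [hz]
  · refine Or.inr (Or.inl ⟨by linarith, ?_⟩)
    filter_upwards [hr.eventually h1] with z hz; rw [hz]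

namespace Thresholds

variable {M : Model} (T : Thresholds M)

/-- The control of a Bayesian DM with log-odds `y ≤ 0`. -/
def control (y : ℝ) : Control :=
  if y ≤ -T.r then stopControl else if y ≤ T.s then huntControl
  else if y < 0 then confirmControl else splitControl

/-- The control of the ambiguity-averse DM when the log-odds of the highest belief are `y`. -/
def fullControl (Δ y : ℝ) : Control :=
  if y ≤ 0 then T.control y else if y < Δ then midControl M else (T.control (Δ - y)).mirror

def fullPiece (Δ y : ℝ) : Piece :=
  if y ≤ 0 then T.piece y else if y < Δ then constPiece (midValue M) else (T.piece (Δ - y)).mirror Δ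

lemma control_stopping {y : ℝ} (h : y ≤ -T.r) : T.control y = stopControl := if_pos h

lemma control_hunt {y : ℝ} (h : -T.r < y) (h' : y ≤ T.s) : T.control y = huntControl := by
  rw [control, if_neg (not_le.2 h), if_pos h']

lemma control_confirm {y : ℝ} (h : T.s < y) (h' : y < 0) : T.control y = confirmControl := by
  rw [control, if_neg (not_le.2 (T.neg_r_lt_s.trans h)), if_neg (not_le.2 h), if_pos h']

lemma control_split {y : ℝ} (h : T.s < y) (h' : 0 ≤ y) : T.control y = splitControl := by
  rw [control, if_neg (not_le.2 (T.neg_r_lt_s.trans h)), if_neg (not_le.2 h), if_neg (not_lt.2 h')]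

/-- When `Δ = 0` the point `0` lies on both sides, and there the lower rule is used. It coincides
with its mirror image only if it is to split attention, that is, if `s < 0`. -/
lemma fullControl_mirror {Δ x : ℝ} (hΔ : 0 ≤ Δ) (hx : x ≤ 0) (h : 0 < Δ ∨ x < 0 ∨ T.s < 0) :
    T.fullControl Δ (Δ - x) = (T.control x).mirror := by
  by_cases h0 : Δ - x ≤ 0
  · have hx0 : x = 0 := by linarith
    have hΔ0 : Δ = 0 := by linarith
    have hs : T.s < 0 := by
      rcases h with h | h | h
      · linarith
      · linarith
      · exact h
    rw [fullControl, if_pos h0, hΔ0, hx0, sub_zero, T.control_split hs le_rfl]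
    simp only [splitControl, Control.mirror]; norm_num
  · rw [fullControl, if_neg h0, if_neg (by linarith), sub_sub_cancel]

lemma fullControl_low {Δ x : ℝ} (hx : x ≤ 0) : T.fullControl Δ x = T.control x := if_pos hx

lemma vel_stopControl (M : Model) : vel M stopControl = 0 := by simp [vel, stopControl]

lemma vel_split (M : Model) : vel M splitControl = 0 := by simp [vel, splitControl]

lemma vel_hunt (M : Model) : vel M huntControl = -M.lam := by norm_num [vel, huntControl]

lemma vel_confirm (M : Model) : vel M confirmControl = M.lam := by norm_num [vel, confirmControl]

lemma vel_mid (M : Model) : vel M (midControl M) = 0 := by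
  rw [midControl]; split_ifs <;> simp [vel, splitControl, hedgeControl]

/-- `-r` and, when `s < 0`, also `0` are rest points towards which neighbouring states move or where
they rest. The point `s` is repelling when `s < 0`; the convention that `R`-evidence is sought at
`s` itself determines the motion. -/
lemma rightUnique_control (y : ℝ) : RightUnique (fun y => vel M (T.control y)) y := by
  have hl := M.lam_pos
  have hrs := T.neg_r_lt_s
  have hs := T.s_nonpos
  have hr := T.r_pos
  rcases le_or_gt y (-T.r) with h | h
  · refine Or.inl ⟨by simp only [T.control_stopping h, vel_stopControl], ?_, ?_⟩
    · filter_upwards [nhdsWithin_le_nhds (gt_mem_nhds (lt_of_le_of_lt h hrs))] with z hz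
      rcases le_or_gt z (-T.r) with h' | h'
      · rw [T.control_stopping h', vel_stopControl]
      · rw [T.control_hunt h' hz.le, vel_hunt]; linarith
    · filter_upwards [self_mem_nhdsWithin] with z hz
      rw [T.control_stopping (le_of_lt (lt_of_lt_of_le hz h)), vel_stopControl]
  rcases le_or_gt y T.s with h' | h'
  · refine Or.inr (Or.inr ⟨by simp only [T.control_hunt h h', vel_hunt]; linarith, ?_⟩)
    filter_upwards [self_mem_nhdsWithin, nhdsWithin_le_nhds (lt_mem_nhds h)] with z hz hz'
    rw [T.control_hunt h h', T.control_hunt hz' (le_of_lt (lt_of_lt_of_le hz h'))]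
  rcases lt_or_ge y 0 with h0 | h0
  · refine Or.inr (Or.inl ⟨by simp only [T.control_confirm h' h0, vel_confirm]; linarith, ?_⟩)
    filter_upwards [self_mem_nhdsWithin, nhdsWithin_le_nhds (gt_mem_nhds h0)] with z hz hz'
    rw [T.control_confirm h' h0, T.control_confirm (h'.trans hz) hz']
  · refine Or.inl ⟨by simp only [T.control_split h' h0, vel_split], ?_, ?_⟩
    · filter_upwards [self_mem_nhdsWithin] with z hz
      rw [T.control_split (h'.trans hz) (h0.trans (le_of_lt hz)), vel_split]
    · filter_upwards [nhdsWithin_le_nhds (lt_mem_nhds h')] with z hz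
      rcases lt_or_ge z 0 with h1 | h1
      · rw [T.control_confirm hz h1, vel_confirm]; exact hl.le
      · rw [T.control_split hz h1, vel_split]

lemma vel_control_of_pos {y : ℝ} (hy : 0 < y) : vel M (T.control y) = 0 := by
  rw [T.control_split (T.s_nonpos.trans_lt hy) hy.le, vel_split]

lemma vel_fullControl_low {Δ y : ℝ} (h : y ≤ 0 ∨ y < Δ) :
    vel M (T.fullControl Δ y) = vel M (T.control y) := by
  rw [fullControl]
  split_ifs with h0 h1
  · rfl
  · rw [vel_mid, T.vel_control_of_pos (not_le.1 h0)]
  · exact absurd (h.resolve_left h0) h1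

lemma vel_fullControl_high {Δ y : ℝ} (h : 0 < y) :
    vel M (T.fullControl Δ y) = -vel M (T.control (Δ - y)) := by
  rw [fullControl, if_neg (not_le.2 h)]
  split_ifs with h1
  · rw [vel_mid, T.vel_control_of_pos (sub_pos.2 h1), neg_zero]
  · rw [vel_mirror]

lemma rightUnique_fullControl {Δ : ℝ} (hΔ : 0 ≤ Δ) (y : ℝ) :
    RightUnique (fun y => vel M (T.fullControl Δ y)) y := by
  have hl := M.lam_pos
  rcases lt_trichotomy y 0 with h | rfl | h
  · refine (T.rightUnique_control y).congr ?_
    filter_upwards [gt_mem_nhds h] with z hz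
    exact T.vel_fullControl_low (Or.inl hz.le)
  · rcases hΔ.eq_or_lt with rfl | hΔ
    -- Without ambiguity `0` is either repelling (`s = 0`, the tie being resolved downwards) or an
    -- absorbing point of split attention, reached from both sides.
    · rcases T.s_nonpos.eq_or_lt with hs | hs
      · have h1 : -T.r < 0 := by linarith [T.r_pos]
        have h2 : ∀ z, -T.r < z → z ≤ 0 → vel M (T.fullControl 0 z) = -M.lam := fun z hz hz' => by
          rw [T.vel_fullControl_low (Or.inl hz'), T.control_hunt hz (hz'.trans hs.ge), vel_hunt]
        refine Or.inr (Or.inr ⟨by simp only [h2 0 h1 le_rfl]; linarith, ?_⟩)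
        filter_upwards [self_mem_nhdsWithin, nhdsWithin_le_nhds (lt_mem_nhds h1)] with z hz hz'
        rw [h2 z hz' (le_of_lt hz), h2 0 h1 le_rfl]
      · refine Or.inl ⟨?_, ?_, ?_⟩
        · simp only [T.vel_fullControl_low (Or.inl le_rfl), T.control_split hs le_rfl, vel_split]
        · filter_upwards [self_mem_nhdsWithin,
            nhdsWithin_le_nhds (gt_mem_nhds (neg_pos.2 hs))] with z hz hz'
          rw [T.vel_fullControl_high hz, T.control_confirm (by linarith)
            (by linarith [mem_Ioi.1 hz]), vel_confirm]
          linarith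
        · filter_upwards [self_mem_nhdsWithin, nhdsWithin_le_nhds (lt_mem_nhds hs)] with z hz hz'
          rw [T.vel_fullControl_low (Or.inl (le_of_lt hz)), T.control_confirm hz' hz, vel_confirm]
          exact hl.le
    · refine (T.rightUnique_control 0).congr ?_
      filter_upwards [gt_mem_nhds hΔ] with z hz
      exact T.vel_fullControl_low (Or.inr hz)
  · refine (T.rightUnique_control (Δ - y)).mirror.congr ?_
    filter_upwards [lt_mem_nhds h] with z hz
    exact T.vel_fullControl_high hz

/-- The duration `τ` is the distance to the rest point, `-r` or `0`, divided by the speed. The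
second conjunct keeps the path on the lower side, and away from `0` unless it starts there or `s <
0`, as `fullControl_mirror` requires. -/
lemma phases_control {y : ℝ} (hy : y ≤ 0) : ∃ τ u₀ u₁, Phases M T.control y τ u₀ u₁ ∧
    (∀ t, 0 ≤ t → t ≤ τ → y + vel M u₀ * t ≤ 0 ∧ (y + vel M u₀ * t ≤ y ∨ T.s < 0)) ∧
    phaseValue M u₀.α τ (restR M u₁) = (T.piece y).R y ∧
    phaseValue M (1 - u₀.α) τ (restL M u₁) = (T.piece y).L y := by
  have hl := M.lam_pos
  have hs := T.s_nonpos
  have hrs := T.neg_r_lt_s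
  rcases le_or_gt y (-T.r) with h | h
  · refine ⟨0, huntControl, stopControl, ⟨le_rfl, fun t h1 h2 => absurd h1 (not_le.2 h2),
      by rw [mul_zero, add_zero, T.control_stopping h], Or.inl rfl, rfl, rfl, rfl, rfl, Or.inl rfl⟩,
      fun t h1 h2 => ?_, ?_, ?_⟩
    · rw [le_antisymm h2 h1, mul_zero, add_zero]; exact ⟨hy, Or.inl le_rfl⟩
    all_goals
      rw [piece, if_pos h]
      simp [phaseValue, restR, restL, stopControl, huntControl, stopPiece, Model.U]
  rcases le_or_gt y T.s with h' | h'
  · have hlt : M.lam * ((y + T.r) / M.lam) = y + T.r := mul_div_cancel₀ _ hl.ne'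
    refine ⟨(y + T.r) / M.lam, huntControl, stopControl, ⟨div_nonneg (by linarith) hl.le,
      fun t h1 h2 => ?_, ?_, Or.inl rfl, rfl, rfl, rfl, rfl, Or.inl rfl⟩, fun t h1 h2 => ?_, ?_, ?_⟩
    · rw [lt_div_iff₀ hl] at h2
      rw [vel_hunt]
      exact T.control_hunt (by linarith) (by nlinarith)
    · rw [vel_hunt, neg_mul, hlt]; exact T.control_stopping (by linarith)
    · rw [vel_hunt]
      have : 0 ≤ M.lam * t := mul_nonneg hl.le h1
      exact ⟨by linarith, Or.inl (by linarith)⟩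
    · rw [piece, if_neg (not_le.2 h), if_pos h']
      simp only [phaseValue, restR, huntControl, stopControl, huntPiece, Model.U, one_mul]
      have h1 : M.k * Real.exp (-y) = (M.δ - M.k) * Real.exp (-M.lam * ((y + T.r) / M.lam)) := by
        rw [neg_mul, hlt, ← T.exp_r, mul_comm _ M.k, mul_assoc, ← Real.exp_add]
        congr 2; ring
      rw [h1]; simp; ring
    · rw [piece, if_neg (not_le.2 h), if_pos h']
      simp only [phaseValue, restL, huntControl, stopControl, huntPiece, Model.U]
      have h1 : M.c * ((y + T.r) / M.lam) = M.k * (y + T.r) := by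
        rw [← M.lam_mul_k]; field_simp
      rw [sub_self, sub_zero, h1]; simp; ring
  rcases hy.lt_or_eq with h0 | rfl
  · have hlt : M.lam * (-y / M.lam) = -y := mul_div_cancel₀ _ hl.ne'
    refine ⟨-y / M.lam, confirmControl, splitControl, ⟨div_nonneg (by linarith) hl.le,
      fun t h1 h2 => ?_, ?_, Or.inr rfl, rfl, rfl, rfl, rfl, Or.inr rfl⟩, fun t h1 h2 => ?_, ?_, ?_⟩
    · rw [lt_div_iff₀ hl] at h2
      rw [vel_confirm]
      exact T.control_confirm (by nlinarith) (by linarith)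
    · rw [vel_confirm, hlt]; exact T.control_split (by linarith) (by linarith)
    · rw [le_div_iff₀ hl] at h2
      rw [vel_confirm]
      exact ⟨by linarith, Or.inr (h'.trans h0)⟩
    · rw [piece, if_neg (not_le.2 h), if_neg (not_le.2 h')]
      simp only [phaseValue, restR, confirmControl, splitControl, confirmPiece]
      have h1 : M.c * (-y / M.lam) = -(M.k * y) := by rw [← M.lam_mul_k]; field_simp
      rw [h1]; simp; ring
    · rw [piece, if_neg (not_le.2 h), if_neg (not_le.2 h')]
      simp only [phaseValue, restL, confirmControl, splitControl, confirmPiece, sub_zero, one_mul]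
      rw [neg_mul, hlt, neg_neg]; simp; ring
  · refine ⟨0, huntControl, splitControl, ⟨le_rfl, fun t h1 h2 => absurd h1 (not_le.2 h2),
      by rw [mul_zero, add_zero, T.control_split h' le_rfl], Or.inl rfl, rfl, rfl, rfl, rfl,
      Or.inr rfl⟩, fun t h1 h2 => ?_, ?_, ?_⟩
    · rw [le_antisymm h2 h1, mul_zero, add_zero]; exact ⟨le_rfl, Or.inl le_rfl⟩
    all_goals
      rw [piece, if_neg (not_le.2 h), if_neg (not_le.2 h')]
      simp [phaseValue, restR, restL, splitControl, huntControl, confirmPiece]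
    ring

lemma phases_fullControl {Δ : ℝ} (hΔ : 0 ≤ Δ) (y : ℝ) :
    ∃ τ u₀ u₁, Phases M (T.fullControl Δ) y τ u₀ u₁ ∧
      phaseValue M u₀.α τ (restR M u₁) = (T.fullPiece Δ y).R y ∧
      phaseValue M (1 - u₀.α) τ (restL M u₁) = (T.fullPiece Δ y).L y := by
  rcases le_or_gt y 0 with hy | hy
  · obtain ⟨τ, u₀, u₁, h, hle, hR, hL⟩ := T.phases_control hy
    refine ⟨τ, u₀, u₁, ⟨h.τ_nonneg, fun t h1 h2 => ?_, ?_, h.α₀, h.ν₀, h.m₀, h.α₁, h.ν₁, h.m₁⟩,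
      ?_, ?_⟩
    · rw [T.fullControl_low (hle t h1 h2.le).1, h.before t h1 h2]
    · rw [T.fullControl_low (hle τ h.τ_nonneg le_rfl).1, h.after]
    · rw [fullPiece, if_pos hy, hR]
    · rw [fullPiece, if_pos hy, hL]
  rcases lt_or_ge y Δ with hyΔ | hyΔ
  · have hc : T.fullControl Δ y = midControl M := by
      rw [fullControl, if_neg (not_le.2 hy), if_pos hyΔ]
    have hp : T.fullPiece Δ y = constPiece (midValue M) := by
      rw [fullPiece, if_neg (not_le.2 hy), if_pos hyΔ]
    refine ⟨0, huntControl, midControl M, ⟨le_rfl, fun t h1 h2 => absurd h1 (not_le.2 h2),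
      by rw [mul_zero, add_zero, hc], Or.inl rfl, rfl, rfl, ?_, ?_, ?_⟩, ?_, ?_⟩
    · rw [midControl]; split_ifs <;> rfl
    · rw [midControl]; split_ifs <;> rfl
    · rw [midControl]; split_ifs
      · exact Or.inr rfl
      · exact Or.inl rfl
    all_goals
      rw [hp, midControl, midValue]
      split_ifs with h
      · simp [phaseValue, restR, restL, splitControl, huntControl, constPiece, max_eq_left h]
      · simp [phaseValue, restR, restL, hedgeControl, huntControl, constPiece, Model.U,
          max_eq_right (le_of_lt (not_le.1 h))]
        ring
  · have hx : Δ - y ≤ 0 := by linarith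
    obtain ⟨τ, u₀, u₁, h, hle, hR, hL⟩ := T.phases_control hx
    have hm : ∀ t, 0 ≤ t → t ≤ τ → T.fullControl Δ (y + vel M u₀.mirror * t) =
        (T.control (Δ - y + vel M u₀ * t)).mirror := fun t h1 h2 => by
      obtain ⟨h3, h4⟩ := hle t h1 h2
      rw [vel_mirror, show y + -vel M u₀ * t = Δ - (Δ - y + vel M u₀ * t) by ring]
      refine T.fullControl_mirror hΔ h3 ?_
      rcases h4 with h4 | h4
      · rcases hΔ.eq_or_lt with rfl | h5
        · exact Or.inr (Or.inl (by linarith))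
        · exact Or.inl h5
      · exact Or.inr (Or.inr h4)
    refine ⟨τ, u₀.mirror, u₁.mirror, ⟨h.τ_nonneg, fun t h1 h2 => ?_, ?_, ?_, h.ν₀, h.m₀, ?_, h.ν₁,
      h.m₁⟩, ?_, ?_⟩
    · rw [hm t h1 h2.le, h.before t h1 h2]
    · rw [hm τ h.τ_nonneg le_rfl, h.after]
    · simp only [Control.mirror]; rcases h.α₀ with h | h <;> rw [h] <;> norm_num
    · simp only [Control.mirror]; rw [h.α₁]; norm_num
    · rw [fullPiece, if_neg (not_le.2 hy), if_neg (not_lt.2 hyΔ), restR_mirror]; exact hL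
    · rw [fullPiece, if_neg (not_le.2 hy), if_neg (not_lt.2 hyΔ), restL_mirror]
      simp only [Control.mirror, sub_sub_cancel]; exact hR

end Thresholds

/-! ### The Hamilton-Jacobi-Bellman conditions in terms of pieces -/

namespace Piece

/-- The net value increase from the control `u` when the continuation value is given by `P`. -/
def net (M : Model) (P : Piece) (u : Control) (p y : ℝ) : ℝ :=
  u.m * (M.U u.ρ p - P.val p y) + (1 - u.m) * (u.ν * (M.U u.ρ p - P.val p y) +
    (u.α * P.gainLeft M p y + (1 - u.α) * P.gainRight M p y))

/-- For a fixed continuation piece, the gain of a control is a combination with nonnegative weights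
of the gains from the two actions and from full attention to either source. -/
lemma Good.net_nonpos {M : Model} {P : Piece} {p y : ℝ} (h : P.Good M p y) {u : Control}
    (hu : u.Valid) : P.net M u p y ≤ 0 := by
  have hU : M.U u.ρ p - P.val p y ≤ 0 := by
    have h1 := mul_le_mul_of_nonneg_left h.le_r hu.ρ_mem.1
    have h2 := mul_le_mul_of_nonneg_left h.le_ℓ (sub_nonneg.2 hu.ρ_mem.2)
    have h3 : M.U u.ρ p = u.ρ * M.U 1 p + (1 - u.ρ) * M.U 0 p := by simp only [Model.U]; ring
    linarith
  have h1 := mul_nonpos_of_nonneg_of_nonpos hu.m_mem.1 hU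
  have h2 := mul_nonpos_of_nonneg_of_nonpos hu.ν_nonneg hU
  have h3 := mul_nonpos_of_nonneg_of_nonpos hu.α_mem.1 h.left
  have h4 := mul_nonpos_of_nonneg_of_nonpos (sub_nonneg.2 hu.α_mem.2) h.right
  have h5 := mul_nonpos_of_nonneg_of_nonpos (sub_nonneg.2 hu.m_mem.2) (add_nonpos h2 (add_nonpos h3 h4))
  exact add_nonpos h1 h5

/-- The function `V` has the values of the piece `P` in the states along `F`. -/
def Represents (P : Piece) (V : ℝ → ℝ → ℝ) (F : Filter ℝ) : Prop :=
  ∀ᶠ z in F, ∀ x, V x z = P.val x (logOdds z)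

section Limits

variable {P : Piece} {V : ℝ → ℝ → ℝ} {S : Set ℝ} {q : ℝ}

lemma hasDerivAt_val_left (P : Piece) (p y : ℝ) :
    HasDerivAt (fun x => P.val x y) (P.R y - P.L y) p := by
  have := ((hasDerivAt_id p).mul_const (P.R y)).add
    (((hasDerivAt_id p).const_sub 1).mul_const (P.L y))
  exact this.congr_deriv (by ring)

lemma hasDerivAt_val_right (P : Piece) (p : ℝ) {z : ℝ} (hz : z ∈ Ioo (0 : ℝ) 1) :
    HasDerivAt (fun z => P.val p (logOdds z))
      ((p * P.R' (logOdds z) + (1 - p) * P.L' (logOdds z)) / (z * (1 - z))) z := by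
  have h1 := hasDerivAt_logOdds hz
  have := (((P.hasDerivAt_R (logOdds z)).comp z h1).const_mul p).add
    (((P.hasDerivAt_L (logOdds z)).comp z h1).const_mul (1 - p))
  exact this.congr_deriv (by ring)

lemma Represents.tendsto (h : P.Represents V (𝓝[S] q)) (hq : q ∈ Ioo (0 : ℝ) 1) (p : ℝ) :
    Tendsto (fun z => V p z) (𝓝[S] q) (𝓝 (P.val p (logOdds q))) := by
  refine Tendsto.congr' (f₁ := fun z => P.val p (logOdds z)) ?_
    ((hasDerivAt_val_right P p hq).continuousAt.tendsto.mono_left nhdsWithin_le_nhds)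
  filter_upwards [h] with z hz using (hz p).symm

lemma Represents.tendsto_deriv_left (h : P.Represents V (𝓝[S] q)) (hq : q ∈ Ioo (0 : ℝ) 1)
    (p : ℝ) : Tendsto (fun z => deriv (fun x => V x z) p) (𝓝[S] q)
      (𝓝 (P.R (logOdds q) - P.L (logOdds q))) := by
  have h1 := continuousAt_logOdds hq
  have h2 : ContinuousAt (fun z => P.R (logOdds z) - P.L (logOdds z)) q :=
    ((P.hasDerivAt_R _).continuousAt.comp h1).sub ((P.hasDerivAt_L _).continuousAt.comp h1)
  refine Tendsto.congr' ?_ (h2.tendsto.mono_left nhdsWithin_le_nhds)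
  filter_upwards [h] with z hz
  rw [funext hz, (hasDerivAt_val_left P p _).deriv]

lemma Represents.eventually_hasDerivAt (h : P.Represents V (𝓝[S] q)) (hS : IsOpen S)
    (hq : q ∈ Ioo (0 : ℝ) 1) (p : ℝ) : ∀ᶠ z in 𝓝[S] q, HasDerivAt (fun z => V p z)
      ((p * P.R' (logOdds z) + (1 - p) * P.L' (logOdds z)) / (z * (1 - z))) z := by
  filter_upwards [eventually_eventually_nhdsWithin.2 h, self_mem_nhdsWithin,
    nhdsWithin_le_nhds (isOpen_Ioo.mem_nhds hq)] with z hz hzS hz01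
  rw [hS.nhdsWithin_eq hzS] at hz
  refine (hasDerivAt_val_right P p hz01).congr_of_eventuallyEq ?_
  filter_upwards [hz] with w hw using hw p

/-- A piece with continuous derivatives. -/
def ContDeriv (P : Piece) : Prop := Continuous P.R' ∧ Continuous P.L'

lemma Represents.tendsto_deriv_right (h : P.Represents V (𝓝[S] q)) (hS : IsOpen S)
    (hP : P.ContDeriv) (hq : q ∈ Ioo (0 : ℝ) 1) (p : ℝ) :
    Tendsto (fun z => deriv (fun z => V p z) z) (𝓝[S] q)
      (𝓝 ((p * P.R' (logOdds q) + (1 - p) * P.L' (logOdds q)) / (q * (1 - q)))) := by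
  have h1 := continuousAt_logOdds hq
  have h0 : q * (1 - q) ≠ 0 := mul_ne_zero hq.1.ne' (sub_pos.2 hq.2).ne'
  have h2 : ContinuousAt (fun z => (p * P.R' (logOdds z) + (1 - p) * P.L' (logOdds z)) /
      (z * (1 - z))) q := by
    refine ContinuousAt.div ?_ (by fun_prop) h0
    exact ((hP.1.continuousAt.comp h1).const_mul p).add
      ((hP.2.continuousAt.comp h1).const_mul (1 - p))
  refine Tendsto.congr' ?_ (h2.tendsto.mono_left nhdsWithin_le_nhds)
  filter_upwards [h.eventually_hasDerivAt hS hq p] with z hz using hz.deriv.symm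

lemma Represents.hasLimits (h : P.Represents V (𝓝[S] q)) (hS : IsOpen S) (hP : P.ContDeriv)
    (hq : q ∈ Ioo (0 : ℝ) 1) (p : ℝ) : HasLimits V p (𝓝[S] q) := by
  refine ⟨?_, ⟨_, h.tendsto hq p⟩, ⟨_, h.tendsto_deriv_left hq p⟩,
    ⟨_, h.tendsto_deriv_right hS hP hq p⟩⟩
  filter_upwards [h, h.eventually_hasDerivAt hS hq p] with z hz hz'
  refine ⟨?_, hz'.differentiableAt⟩
  rw [funext hz]
  exact (hasDerivAt_val_left P p _).differentiableAt

/-- The factor `q * (1 - q)` in the drift cancels the derivative of the log-odds. -/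
lemma Represents.G_eq (h : P.Represents V (𝓝[S] q)) (hS : IsOpen S) (hP : P.ContDeriv)
    (hq : q ∈ Ioo (0 : ℝ) 1) [(𝓝[S] q).NeBot] {M : Model} {u : Control}
    (hu : ahead u.α q = 𝓝[S] q) (p : ℝ) : G M V u p q = P.net M u p (logOdds q) := by
  have h0 : q ≠ 0 := hq.1.ne'
  have h0' : 1 - q ≠ 0 := (sub_pos.2 hq.2).ne'
  rw [G, hu, (h.tendsto hq p).limUnder_eq, (h.tendsto_deriv_left hq p).limUnder_eq,
    (h.tendsto_deriv_right hS hP hq p).limUnder_eq]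
  have h3 : (p * P.R' (logOdds q) + (1 - p) * P.L' (logOdds q)) / (q * (1 - q)) *
      M.drift u.α q = -(2 * u.α - 1) * M.lam *
        (p * P.R' (logOdds q) + (1 - p) * P.L' (logOdds q)) := by
    simp only [Model.drift]; field_simp
  simp only [h3]
  simp only [net, gainLeft, gainRight, val, Model.drift]
  ring

end Limits

/-- Both drifts vanish, and in `net` the derivatives of the piece cancel, so only the value at the
state itself matters and no regularity is needed. -/
lemma G_eq_of_half {P : Piece} {V : ℝ → ℝ → ℝ} {q : ℝ} (h : ∀ x, V x q = P.val x (logOdds q))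
    {M : Model} {u : Control} (hu : u.α = 1 / 2) (p : ℝ) :
    G M V u p q = P.net M u p (logOdds q) := by
  have ha : ahead u.α q = pure q := by rw [ahead, hu]; simp
  have h1 : limUnder (pure q) (fun z => V p z) = V p q :=
    (tendsto_pure_nhds (fun z => V p z) q).limUnder_eq
  have h2 := gainLeft_add_gainRight M P p (logOdds q)
  rw [G, ha, h1, h p]
  simp only [net, hu, Model.drift]
  linear_combination -(1 - u.m) / 2 * h2

lemma ContDeriv.mirror {P : Piece} (h : P.ContDeriv) (Δ : ℝ) : (P.mirror Δ).ContDeriv :=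
  ⟨(h.2.comp (by fun_prop : Continuous fun y => Δ - y)).neg,
    (h.1.comp (by fun_prop : Continuous fun y => Δ - y)).neg⟩

lemma mirror_constPiece (w Δ : ℝ) : (constPiece w).mirror Δ = constPiece w := by
  simp [mirror, constPiece]

/-- The control `u` is exactly compensated at every belief, when the value is given by `P` at the
state itself, by `Pl` just below it and by `Pr` just above it. -/
def Balanced (M : Model) (u : Control) (P Pl Pr : Piece) (y : ℝ) : Prop :=
  u.ν = 0 ∧ ((u.α = 1 ∧ u.m = 0 ∧ ∀ p, Pl.gainLeft M p y = 0) ∨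
    (u.α = 0 ∧ u.m = 0 ∧ ∀ p, Pr.gainRight M p y = 0) ∨
    (u.α = 1 / 2 ∧ u.m = 1 ∧ ∀ p, M.U u.ρ p = P.val p y) ∨
    (u.α = 1 / 2 ∧ u.m = 0 ∧ ∀ p, P.gainLeft M p y + P.gainRight M p y = 0))

lemma Balanced.mirror {M : Model} {u : Control} {P Pl Pr : Piece} {Δ y : ℝ}
    (h : Balanced M u P Pl Pr (Δ - y)) :
    Balanced M u.mirror (P.mirror Δ) (Pr.mirror Δ) (Pl.mirror Δ) y := by
  obtain ⟨hν, h⟩ := h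
  refine ⟨hν, ?_⟩
  rcases h with ⟨h1, h2, h3⟩ | ⟨h1, h2, h3⟩ | ⟨h1, h2, h3⟩ | ⟨h1, h2, h3⟩
  · exact Or.inr (Or.inl ⟨by simp [Control.mirror, h1], h2, fun p => by
      rw [gainRight_mirror, h3]⟩)
  · exact Or.inl ⟨by simp [Control.mirror, h1], h2, fun p => by rw [gainLeft_mirror, h3]⟩
  · refine Or.inr (Or.inr (Or.inl ⟨by simp only [Control.mirror, h1]; norm_num, h2, fun p => ?_⟩))
    rw [val_mirror, ← h3]; simp only [Control.mirror, Model.U]; ring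
  · refine Or.inr (Or.inr (Or.inr ⟨by simp only [Control.mirror, h1]; norm_num, h2, fun p => ?_⟩))
    rw [gainLeft_mirror, gainRight_mirror, add_comm, h3]

end Piece

lemma stopPiece_contDeriv (M : Model) : (stopPiece M).ContDeriv :=
  ⟨continuous_const, continuous_const⟩

lemma huntPiece_contDeriv (M : Model) (r : ℝ) : (huntPiece M r).ContDeriv :=
  ⟨by simp only [huntPiece]; fun_prop, continuous_const⟩

lemma confirmPiece_contDeriv (M : Model) : (confirmPiece M).ContDeriv :=
  ⟨continuous_const, by simp only [confirmPiece]; fun_prop⟩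

lemma constPiece_contDeriv (w : ℝ) : (constPiece w).ContDeriv :=
  ⟨continuous_const, continuous_const⟩

/-- At belief `1/2` both actions pay `M.δ / 2`, and either source has the same gain, nonpositive as
soon as the constant is at least `M.δ - 2 * M.k`. The maximum of these two numbers meets both
requirements. -/
lemma good_midPiece (M : Model) (y : ℝ) : (constPiece (midValue M)).Good M (1 / 2) y := by
  have h1 : M.δ - 2 * M.k ≤ midValue M := le_max_left _ _
  have h2 : M.δ / 2 ≤ midValue M := le_max_right _ _
  have h3 := mul_le_mul_of_nonneg_left h1 M.lam_pos.le
  have h4 := M.lam_mul_k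
  refine ⟨?_, ?_, ?_, ?_⟩ <;>
    simp only [Model.U, Piece.val, Piece.gainLeft, Piece.gainRight, constPiece] <;> linarith

lemma balanced_mid (M : Model) (P Pr : Piece) (y : ℝ) :
    Piece.Balanced M (midControl M) (constPiece (midValue M)) P Pr y := by
  rw [midControl]
  split_ifs with h
  · refine ⟨rfl, Or.inr (Or.inr (Or.inr ⟨rfl, rfl, fun p => ?_⟩))⟩
    rw [Piece.gainLeft_add_gainRight, midValue, max_eq_left h]
    simp only [Piece.val, constPiece]
    linear_combination 2 * M.lam_mul_k
  · refine ⟨rfl, Or.inr (Or.inr (Or.inl ⟨rfl, rfl, fun p => ?_⟩))⟩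
    rw [midValue, max_eq_right (le_of_lt (not_le.1 h))]
    simp only [Piece.val, constPiece, hedgeControl, Model.U]; ring

/-- Log-odds of the worst-case belief. -/
def worstLogOdds (Δ y : ℝ) : ℝ := if y ≤ 0 then y else if y < Δ then 0 else y - Δ

namespace Thresholds

variable {M : Model} (T : Thresholds M)

lemma piece_contDeriv (y : ℝ) : (T.piece y).ContDeriv := by
  rw [piece]
  split_ifs
  exacts [stopPiece_contDeriv M, huntPiece_contDeriv M _, confirmPiece_contDeriv M]

lemma nextPiece_contDeriv (y : ℝ) : (T.nextPiece y).ContDeriv := by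
  rw [nextPiece]
  split_ifs
  exacts [stopPiece_contDeriv M, huntPiece_contDeriv M _, confirmPiece_contDeriv M]

/-- Each piece is the payoff of the control used there, so compensation holds in each world
separately and hence at every belief. The piece above the state matters only when the state drifts
upwards, which does not happen at `0`. -/
lemma balanced_control {y : ℝ} (hy : y ≤ 0) {Pr : Piece} (hPr : y < 0 → Pr = T.nextPiece y) :
    Piece.Balanced M (T.control y) (T.piece y) (T.piece y) Pr y := by
  rcases le_or_gt y (-T.r) with h | h
  · rw [T.control_stopping h, piece, if_pos h]
    refine ⟨rfl, Or.inr (Or.inr (Or.inl ⟨rfl, rfl, fun p => ?_⟩))⟩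
    simp only [Model.U, stopControl, Piece.val, stopPiece]; ring
  rcases le_or_gt y T.s with h' | h'
  · rw [T.control_hunt h h', piece, if_neg (not_le.2 h), if_pos h']
    exact ⟨rfl, Or.inl ⟨rfl, rfl, fun p => T.gainLeft_hunt p y⟩⟩
  rcases hy.lt_or_eq with h0 | rfl
  · rw [T.control_confirm h' h0, hPr h0, nextPiece, if_neg h.not_gt, if_neg h'.not_gt]
    exact ⟨rfl, Or.inr (Or.inl ⟨rfl, rfl, fun p => gainRight_confirm p y⟩)⟩
  · rw [T.control_split h' le_rfl, piece, if_neg (not_le.2 h), if_neg (not_le.2 h')]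
    refine ⟨rfl, Or.inr (Or.inr (Or.inr ⟨rfl, rfl, fun p => ?_⟩))⟩
    rw [Piece.gainLeft_add_gainRight]
    simp only [Piece.val, confirmPiece, Real.exp_zero]
    linear_combination 2 * M.lam_mul_k

/-- The local description of the value function at each state. -/
lemma exists_sides {Δ : ℝ} (hΔ : 0 ≤ Δ) (y : ℝ) : ∃ Pl Pr : Piece,
    (∀ᶠ x in 𝓝[<] y, T.fullPiece Δ x = Pl) ∧ (∀ᶠ x in 𝓝[>] y, T.fullPiece Δ x = Pr) ∧
    Pl.ContDeriv ∧ Pr.ContDeriv ∧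
    (T.fullPiece Δ y).Good M (Real.sigmoid (worstLogOdds Δ y)) y ∧
    Pl.Good M (Real.sigmoid (worstLogOdds Δ y)) y ∧
    Pr.Good M (Real.sigmoid (worstLogOdds Δ y)) y ∧
    Piece.Balanced M (T.fullControl Δ y) (T.fullPiece Δ y) Pl Pr y := by
  have hmirror : ∀ {P : Piece} {x : ℝ}, P.Good M (Real.sigmoid (Δ - x)) (Δ - x) →
      (P.mirror Δ).Good M (Real.sigmoid (x - Δ)) x := fun {P x} h => by
    refine Piece.Good.mirror ?_
    rwa [← Real.sigmoid_neg, neg_sub]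
  have hhalf : Real.sigmoid 0 = 1 / 2 := by rw [Real.sigmoid_zero]; norm_num
  rcases lt_trichotomy y 0 with hy | rfl | hy
  · have hw : worstLogOdds Δ y = y := if_pos hy.le
    have hp : T.fullPiece Δ y = T.piece y := if_pos hy.le
    rw [hw, hp, T.fullControl_low hy.le]
    refine ⟨T.piece y, T.nextPiece y, ?_, ?_, T.piece_contDeriv y, T.nextPiece_contDeriv y,
      T.good_piece hy.le, T.good_piece hy.le, T.good_nextPiece hy,
      T.balanced_control hy.le fun _ => rfl⟩
    · filter_upwards [T.piece_eventually_left y, self_mem_nhdsWithin] with x hx hxy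
      rw [fullPiece, if_pos (le_of_lt (lt_trans hxy hy)), hx]
    · filter_upwards [T.piece_eventually_right y, nhdsWithin_le_nhds (gt_mem_nhds hy)] with x hx hxy
      rw [fullPiece, if_pos hxy.le, hx]
  · have hw : worstLogOdds Δ 0 = 0 := if_pos le_rfl
    have hp : T.fullPiece Δ 0 = T.piece 0 := if_pos le_rfl
    rw [hw, hp, T.fullControl_low le_rfl]
    have hl : ∀ᶠ x in 𝓝[<] (0 : ℝ), T.fullPiece Δ x = T.piece 0 := by
      filter_upwards [T.piece_eventually_left 0, self_mem_nhdsWithin] with x hx hxy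
      rw [fullPiece, if_pos (le_of_lt hxy), hx]
    -- Just above `0` lies the mirrored solution if `Δ = 0`, and the constant middle value
    -- otherwise.
    rcases hΔ.eq_or_lt with rfl | hΔ
    · refine ⟨T.piece 0, (T.piece 0).mirror 0, hl, ?_, T.piece_contDeriv 0,
        (T.piece_contDeriv 0).mirror 0, T.good_piece le_rfl, T.good_piece le_rfl, ?_,
        T.balanced_control le_rfl fun h => absurd h (lt_irrefl 0)⟩
      · have := (tendsto_const_sub_right 0 0).eventually (by simpa using T.piece_eventually_left 0)
        filter_upwards [this, self_mem_nhdsWithin] with x hx hxy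
        rw [fullPiece, if_neg (not_le.2 hxy), if_neg (not_lt.2 (le_of_lt hxy)), hx]
      · have := hmirror (x := 0) (by simpa using T.good_piece le_rfl)
        rwa [sub_zero] at this
    · refine ⟨T.piece 0, constPiece (midValue M), hl, ?_, T.piece_contDeriv 0,
        constPiece_contDeriv _, T.good_piece le_rfl, T.good_piece le_rfl,
        hhalf ▸ good_midPiece M 0, T.balanced_control le_rfl fun h => absurd h (lt_irrefl 0)⟩
      filter_upwards [self_mem_nhdsWithin, nhdsWithin_le_nhds (gt_mem_nhds hΔ)] with x hx hx'
      rw [fullPiece, if_neg (not_le.2 hx), if_pos hx']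
  rcases lt_trichotomy y Δ with hyΔ | rfl | hyΔ
  · have hw : worstLogOdds Δ y = 0 := by rw [worstLogOdds, if_neg (not_le.2 hy), if_pos hyΔ]
    have hp : ∀ x, 0 < x → x < Δ → T.fullPiece Δ x = constPiece (midValue M) := fun x h1 h2 => by
      rw [fullPiece, if_neg (not_le.2 h1), if_pos h2]
    have hc : T.fullControl Δ y = midControl M := by
      rw [fullControl, if_neg (not_le.2 hy), if_pos hyΔ]
    have hnhds : ∀ᶠ x in 𝓝 y, T.fullPiece Δ x = constPiece (midValue M) := by
      filter_upwards [lt_mem_nhds hy, gt_mem_nhds hyΔ] with x h1 h2 using hp x h1 h2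
    have hgood := hhalf ▸ good_midPiece M y
    rw [hw, hp y hy hyΔ, hc]
    exact ⟨_, _, nhdsWithin_le_nhds hnhds, nhdsWithin_le_nhds hnhds, constPiece_contDeriv _,
      constPiece_contDeriv _, hgood, hgood, hgood, balanced_mid M _ _ y⟩
  · have hw : worstLogOdds y y = y - y := by
      rw [worstLogOdds, if_neg (not_le.2 hy), if_neg (lt_irrefl y)]
    have hp : T.fullPiece y y = (T.piece 0).mirror y := by
      rw [fullPiece, if_neg (not_le.2 hy), if_neg (lt_irrefl y), sub_self]
    have hc : T.fullControl y y = (T.control 0).mirror := by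
      rw [fullControl, if_neg (not_le.2 hy), if_neg (lt_irrefl y), sub_self]
    have hg : ((T.piece 0).mirror y).Good M (Real.sigmoid (y - y)) y :=
      hmirror (by rw [sub_self]; exact T.good_piece le_rfl)
    rw [hw, hp, hc]
    refine ⟨constPiece (midValue M), (T.piece 0).mirror y, ?_, ?_, constPiece_contDeriv _,
      (T.piece_contDeriv 0).mirror y, hg, ?_, hg, ?_⟩
    · filter_upwards [self_mem_nhdsWithin, nhdsWithin_le_nhds (lt_mem_nhds hy)] with x hx hx'
      rw [fullPiece, if_neg (not_le.2 hx'), if_pos (mem_Iio.1 hx)]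
    · have := (tendsto_const_sub_right y y).eventually
        (by rw [sub_self]; exact T.piece_eventually_left 0)
      filter_upwards [this, self_mem_nhdsWithin] with x hx hxy
      rw [fullPiece, if_neg (not_le.2 (hy.trans hxy)), if_neg (not_lt.2 (le_of_lt hxy)), hx]
    · rw [sub_self, hhalf]; exact good_midPiece M y
    · rw [← Piece.mirror_constPiece (midValue M) y]
      refine Piece.Balanced.mirror ?_
      rw [sub_self]
      exact T.balanced_control le_rfl fun h => absurd h (lt_irrefl 0)
  · have hx : Δ - y < 0 := by linarith
    have hw : worstLogOdds Δ y = y - Δ := by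
      rw [worstLogOdds, if_neg (not_le.2 hy), if_neg hyΔ.not_gt]
    have hp : T.fullPiece Δ y = (T.piece (Δ - y)).mirror Δ := by
      rw [fullPiece, if_neg (not_le.2 hy), if_neg hyΔ.not_gt]
    have hc : T.fullControl Δ y = (T.control (Δ - y)).mirror := by
      rw [fullControl, if_neg (not_le.2 hy), if_neg hyΔ.not_gt]
    have hnear : ∀ᶠ x in 𝓝 y, T.fullPiece Δ x = (T.piece (Δ - x)).mirror Δ := by
      filter_upwards [lt_mem_nhds hyΔ, lt_mem_nhds hy] with x h1 h2
      rw [fullPiece, if_neg (not_le.2 h2), if_neg h1.not_gt]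
    rw [hw, hp, hc]
    refine ⟨(T.nextPiece (Δ - y)).mirror Δ, (T.piece (Δ - y)).mirror Δ, ?_, ?_,
      (T.nextPiece_contDeriv _).mirror Δ, (T.piece_contDeriv _).mirror Δ,
      hmirror (T.good_piece hx.le), hmirror (T.good_nextPiece hx), hmirror (T.good_piece hx.le),
      (T.balanced_control hx.le fun _ => rfl).mirror⟩
    · filter_upwards [nhdsWithin_le_nhds hnear, (tendsto_const_sub_left Δ y).eventually
        (T.piece_eventually_right (Δ - y))] with x h1 h2
      rw [h1, h2]
    · filter_upwards [nhdsWithin_le_nhds hnear, (tendsto_const_sub_right Δ y).eventually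
        (T.piece_eventually_left (Δ - y))] with x h1 h2
      rw [h1, h2]

end Thresholds

lemma sigmoid_zero_eq : Real.sigmoid 0 = 1 / 2 := by rw [Real.sigmoid_zero]; norm_num

lemma mem_beliefSet_iff {Δ q p : ℝ} : p ∈ beliefSet Δ q ↔
    p ∈ Ioo (0 : ℝ) 1 ∧ p ≤ q ∧ logOdds q - Δ ≤ logOdds p := by
  simp only [beliefSet, logOdds, mem_ofPred_eq, sub_le_comm]

lemma lowest_eq {Δ q : ℝ} (hΔ : 0 ≤ Δ) (hq : q ∈ Ioo (0 : ℝ) 1) :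
    lowest Δ q = Real.sigmoid (logOdds q - Δ) := by
  refine IsLeast.csInf_eq ⟨mem_beliefSet_iff.2 ⟨sigmoid_mem _, ?_, by simp⟩, fun p hp => ?_⟩
  · rw [← le_logOdds_iff hq]; linarith
  · obtain ⟨hp, -, h⟩ := mem_beliefSet_iff.1 hp
    exact (le_logOdds_iff hp).1 h

/-! ### Payoffs of the two benchmark policies -/

lemma twoPhase_const {u : Control} (h1 : u.α = 1 / 2) (h2 : u.ν = 0) (h3 : u.m = 1 ∨ u.m = 0) :
    TwoPhase (fun _ => u) 0 huntControl u where
  eq t ht := by rw [if_neg (not_lt.2 ht)]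
  share := ⟨measurable_const, fun _ => by rw [h1]; norm_num⟩
  τ_nonneg := le_rfl
  α₀ := Or.inl rfl
  ν₀ := rfl
  m₀ := rfl
  α₁ := h1
  ν₁ := h2
  m₁ := h3

lemma payoff_split (M : Model) : payoff M splitPolicy (1 / 2) = M.δ - 2 * M.k := by
  have h : TwoPhase splitPolicy 0 huntControl splitControl :=
    twoPhase_const (u := splitControl) rfl rfl (Or.inr rfl)
  rw [payoff, h.payoffR_eq_of_wait rfl, h.payoffL_eq_of_wait rfl]
  simp [phaseValue]; ring

lemma payoff_hedged (M : Model) : payoff M hedgedPolicy (1 / 2) = M.δ / 2 := by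
  have h : TwoPhase hedgedPolicy 0 huntControl hedgeControl :=
    twoPhase_const (u := hedgeControl) rfl rfl (Or.inl rfl)
  rw [payoff, h.payoffR_eq_of_stopping rfl, h.payoffL_eq_of_stopping rfl]
  simp [phaseValue, hedgeControl, Model.U]; ring

lemma Phases.twoPhase {M : Model} {ctrl : ℝ → Control} {y τ : ℝ} {u₀ u₁ : Control}
    (h : Phases M ctrl y τ u₀ u₁) (hv : ∀ y, RightUnique (fun y => vel M (ctrl y)) y)
    (hmeas : Measurable fun y => (ctrl y).α) (hmem : ∀ y, (ctrl y).α ∈ Icc (0 : ℝ) 1) :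
    TwoPhase (induced M (fun q => ctrl (logOdds q)) (Real.sigmoid y)) τ u₀ u₁ where
  eq t ht := by rw [induced_eq hv h.isFlowPath, h.ctrl_ramp ht]
  share := by
    simp only [induced_eq hv h.isFlowPath]
    exact ⟨hmeas.comp h.isFlowPath.cont.measurable, fun t => hmem _⟩
  τ_nonneg := h.τ_nonneg
  α₀ := h.α₀
  ν₀ := h.ν₀
  m₀ := h.m₀
  α₁ := h.α₁
  ν₁ := h.ν₁
  m₁ := h.m₁

lemma TwoPhase.payoffR_eq {M : Model} {s : Policy} {τ : ℝ} {u₀ u₁ : Control}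
    (h : TwoPhase s τ u₀ u₁) : payoffR M s = phaseValue M u₀.α τ (restR M u₁) := by
  rcases h.m₁ with hm | hm
  · rw [h.payoffR_eq_of_stopping hm, restR, if_pos hm]
  · rw [h.payoffR_eq_of_wait hm, restR, if_neg (by rw [hm]; exact zero_ne_one)]

lemma TwoPhase.payoffL_eq {M : Model} {s : Policy} {τ : ℝ} {u₀ u₁ : Control}
    (h : TwoPhase s τ u₀ u₁) : payoffL M s = phaseValue M (1 - u₀.α) τ (restL M u₁) := by
  rcases h.m₁ with hm | hm
  · rw [h.payoffL_eq_of_stopping hm, restL, if_pos hm]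
  · rw [h.payoffL_eq_of_wait hm, restL, if_neg (by rw [hm]; exact zero_ne_one)]

lemma TwoPhase.closed_left {s : Policy} {τ : ℝ} {u₀ u₁ : Control} (h : TwoPhase s τ u₀ u₁)
    (I : Set ℝ) (hI : I ⊆ Ici 0) (hne : I.Nonempty) (hm : ∀ t ∈ I, (s t).m = 1) :
    (s (sInf I)).m = 1 := by
  have hτ : ∀ t ∈ I, τ ≤ t := fun t ht => by
    by_contra! hlt
    have := hm t ht
    rw [h.eq_before (hI ht) hlt, h.m₀] at this
    exact zero_ne_one this
  obtain ⟨t, ht⟩ := hne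
  have h1 := hm t ht
  rw [h.eq_after (hτ t ht)] at h1
  rw [h.eq_after (le_csInf ⟨t, ht⟩ hτ), h1]

lemma Control.Valid.mirror {u : Control} (h : u.Valid) : u.mirror.Valid where
  α_mem := ⟨sub_nonneg.2 h.α_mem.2, sub_le_self _ h.α_mem.1⟩
  ν_nonneg := h.ν_nonneg
  m_mem := h.m_mem
  ρ_mem := ⟨sub_nonneg.2 h.ρ_mem.2, sub_le_self _ h.ρ_mem.1⟩

lemma midControl_valid (M : Model) : (midControl M).Valid := by
  rw [midControl]
  split_ifs
  all_goals constructor <;> norm_num [splitControl, hedgeControl]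

/-! ### Admissibility and value of the strategy -/

namespace Thresholds

variable {M : Model} (T : Thresholds M)

/-- The strategy of the equilibrium. -/
def strategy (Δ : ℝ) : Strategy := fun q => T.fullControl Δ (logOdds q)

lemma control_valid (y : ℝ) : (T.control y).Valid := by
  rw [control]
  split_ifs
  all_goals constructor <;> norm_num [stopControl, huntControl, confirmControl, splitControl]

lemma fullControl_valid (Δ y : ℝ) : (T.fullControl Δ y).Valid := by
  rw [fullControl]
  split_ifs
  exacts [T.control_valid y, midControl_valid M, (T.control_valid _).mirror]

lemma measurable_control (f : Control → ℝ) : Measurable fun y => f (T.control y) := by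
  simp only [control, apply_ite f]
  exact Measurable.ite measurableSet_Iic measurable_const
    (Measurable.ite measurableSet_Iic measurable_const
      (Measurable.ite measurableSet_Iio measurable_const measurable_const))

lemma measurable_fullControl (Δ : ℝ) (f : Control → ℝ) :
    Measurable fun y => f (T.fullControl Δ y) := by
  simp only [fullControl, apply_ite f]
  exact Measurable.ite measurableSet_Iic (T.measurable_control f)
    (Measurable.ite measurableSet_Iio measurable_const
      ((T.measurable_control fun u => f u.mirror).comp (by fun_prop : Measurable fun y => Δ - y)))

section

variable {Δ : ℝ} (hΔ : 0 ≤ Δ)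
include hΔ

lemma exists_twoPhase {q : ℝ} (hq : q ∈ Ioo (0 : ℝ) 1) : ∃ τ u₀ u₁,
    TwoPhase (induced M (T.strategy Δ) q) τ u₀ u₁ ∧
    payoffR M (induced M (T.strategy Δ) q) = (T.fullPiece Δ (logOdds q)).R (logOdds q) ∧
    payoffL M (induced M (T.strategy Δ) q) = (T.fullPiece Δ (logOdds q)).L (logOdds q) := by
  obtain ⟨τ, u₀, u₁, h, hR, hL⟩ := T.phases_fullControl hΔ (logOdds q)
  have h1 := h.twoPhase (T.rightUnique_fullControl hΔ) (T.measurable_fullControl Δ fun u => u.α)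
    fun y => (T.fullControl_valid Δ y).α_mem
  rw [sigmoid_logOdds hq] at h1
  exact ⟨τ, u₀, u₁, h1, h1.payoffR_eq.trans hR, h1.payoffL_eq.trans hL⟩

lemma value_strategy {q : ℝ} (hq : q ∈ Ioo (0 : ℝ) 1) (p : ℝ) :
    value M (T.strategy Δ) p q = (T.fullPiece Δ (logOdds q)).val p (logOdds q) := by
  obtain ⟨τ, u₀, u₁, -, hR, hL⟩ := T.exists_twoPhase hΔ hq
  rw [value, payoff, hR, hL, Piece.val]

lemma strategy_admissible : Strategy.Admissible M (T.strategy Δ) where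
  valid q _ := T.fullControl_valid Δ _
  meas_α := (T.measurable_fullControl Δ fun u => u.α).comp measurable_logOdds
  meas_ν := (T.measurable_fullControl Δ fun u => u.ν).comp measurable_logOdds
  meas_m := (T.measurable_fullControl Δ fun u => u.m).comp measurable_logOdds
  meas_ρ := (T.measurable_fullControl Δ fun u => u.ρ).comp measurable_logOdds
  path q hq := by
    obtain ⟨τ, u₀, u₁, h, -, -⟩ := T.phases_fullControl hΔ (logOdds q)
    have := existsUnique_statePath (T.rightUnique_fullControl hΔ) h.isFlowPath
    rwa [sigmoid_logOdds hq] at this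
  policy q hq := by
    obtain ⟨τ, u₀, u₁, h, -, -⟩ := T.exists_twoPhase hΔ hq
    obtain ⟨τ', v₀, v₁, h', -, -⟩ := T.phases_fullControl hΔ (logOdds q)
    have heq := induced_eq (T.rightUnique_fullControl hΔ) h'.isFlowPath
    rw [sigmoid_logOdds hq] at heq
    have hmeas : ∀ f : Control → ℝ, Measurable fun t => f (induced M (T.strategy Δ) q t) := by
      intro f
      have h1 : (fun t => f (induced M (T.strategy Δ) q t)) = fun t => _ :=
        funext fun t => congrArg f (heq t)
      rw [h1]
      exact (T.measurable_fullControl Δ f).comp h'.isFlowPath.cont.measurable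
    refine ⟨fun t _ => T.fullControl_valid Δ _, hmeas fun u => u.α, hmeas fun u => u.ν,
      hmeas fun u => u.m, hmeas fun u => u.ρ, fun S => ?_, fun I hI hc hm =>
      h.closed_left I hI hc.nonempty hm, ?_⟩
    · refine integrableOn_zero.congr_fun (fun t ht => ?_) measurableSet_Icc
      rcases lt_or_ge t τ with hlt | hge
      · rw [h.eq_before ht.1 hlt, h.ν₀]
      · rw [h.eq_after hge, h.ν₁]
    · convert countable_empty
      refine eq_empty_iff_forall_notMem.2 fun t ht => ?_
      obtain ⟨ht0, ht1⟩ := ht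
      rcases lt_or_ge t τ with hlt | hge
      · rw [h.eq_before ht0 hlt, h.m₀] at ht1; exact lt_irrefl _ ht1.1
      · rw [h.eq_after hge] at ht1
        rcases h.m₁ with hm | hm <;> rw [hm] at ht1
        · exact lt_irrefl _ ht1.2
        · exact lt_irrefl _ ht1.1
  finite q hq := by
    obtain ⟨τ, u₀, u₁, h, -, -⟩ := T.exists_twoPhase hΔ hq
    exact h.finitePayoff

lemma represents_of_eventually {P : Piece} {q : ℝ} (hq : q ∈ Ioo (0 : ℝ) 1) {S S' : Set ℝ}
    (hS : Tendsto logOdds (𝓝[S] q) (𝓝[S'] logOdds q))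
    (h : ∀ᶠ y in 𝓝[S'] logOdds q, T.fullPiece Δ y = P) :
    P.Represents (value M (T.strategy Δ)) (𝓝[S] q) := by
  filter_upwards [hS.eventually h, nhdsWithin_le_nhds (isOpen_Ioo.mem_nhds hq)] with z hz hz01 x
  rw [T.value_strategy hΔ hz01, hz]

end

end Thresholds

lemma tendsto_logOdds_left {q : ℝ} (hq : q ∈ Ioo (0 : ℝ) 1) :
    Tendsto logOdds (𝓝[<] q) (𝓝[<] logOdds q) := by
  refine tendsto_nhdsWithin_iff.2 ⟨(continuousAt_logOdds hq).tendsto.mono_left nhdsWithin_le_nhds,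
    ?_⟩
  filter_upwards [self_mem_nhdsWithin, nhdsWithin_le_nhds (isOpen_Ioo.mem_nhds hq)] with z hz hz01
  rw [mem_Iio, ← not_le, le_logOdds_iff hz01, sigmoid_logOdds hq, not_le]
  exact hz

lemma tendsto_logOdds_right {q : ℝ} (hq : q ∈ Ioo (0 : ℝ) 1) :
    Tendsto logOdds (𝓝[>] q) (𝓝[>] logOdds q) := by
  refine tendsto_nhdsWithin_iff.2 ⟨(continuousAt_logOdds hq).tendsto.mono_left nhdsWithin_le_nhds,
    ?_⟩
  filter_upwards [self_mem_nhdsWithin, nhdsWithin_le_nhds (isOpen_Ioo.mem_nhds hq)] with z hz hz01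
  rw [mem_Ioi, ← not_le, logOdds_le_iff hz01, sigmoid_logOdds hq, not_le]
  exact hz

/-- The worst-case belief in the state `q`. -/
def worstBelief (Δ q : ℝ) : ℝ := Real.sigmoid (worstLogOdds Δ (logOdds q))

lemma worstBelief_mem {Δ q : ℝ} (hΔ : 0 ≤ Δ) (hq : q ∈ Ioo (0 : ℝ) 1) :
    worstBelief Δ q ∈ beliefSet Δ q := by
  rw [mem_beliefSet_iff, worstBelief, ← le_logOdds_iff hq, logOdds_sigmoid]
  refine ⟨sigmoid_mem _, ?_, ?_⟩ <;> rw [worstLogOdds] <;> split_ifs <;> linarith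

lemma U_sub_U (M : Model) (ρ ρ' p : ℝ) : M.U ρ p - M.U ρ' p = (ρ - ρ') * (M.δ * (2 * p - 1)) := by
  simp only [Model.U]; ring

lemma U_le_max (M : Model) {ρ : ℝ} (hρ : ρ ∈ Icc (0 : ℝ) 1) (p : ℝ) :
    M.U ρ p ≤ max (M.U 0 p) (M.U 1 p) := by
  have h1 := mul_le_mul_of_nonneg_left (le_max_right (M.U 0 p) (M.U 1 p)) hρ.1
  have h2 := mul_le_mul_of_nonneg_left (le_max_left (M.U 0 p) (M.U 1 p)) (sub_nonneg.2 hρ.2)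
  have h3 : M.U ρ p = ρ * M.U 1 p + (1 - ρ) * M.U 0 p := by simp only [Model.U]; ring
  linarith

/-! ### Worst-case beliefs, terminal actions and the saddle point -/

namespace Thresholds

variable {M : Model} (T : Thresholds M)

lemma control_action {y : ℝ} (hy : y ≤ 0) {ρ : ℝ} (hρ : 0 ≤ ρ) :
    M.U ρ (Real.sigmoid y) ≤ M.U (T.control y).ρ (Real.sigmoid y) := by
  rw [← sub_nonpos, U_sub_U]
  have h1 : 2 * Real.sigmoid y - 1 ≤ 0 := by
    have := Real.sigmoid_le hy
    rw [sigmoid_zero_eq] at this; linarith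
  have h2 : M.δ * (2 * Real.sigmoid y - 1) ≤ 0 := mul_nonpos_of_nonneg_of_nonpos M.δ_pos.le h1
  rcases hy.lt_or_eq with h0 | rfl
  · have h3 : (T.control y).ρ = 0 := by
      rw [control]; split_ifs <;> rfl
    rw [h3, sub_zero]
    exact mul_nonpos_of_nonneg_of_nonpos hρ h2
  · rw [sigmoid_zero_eq]; norm_num

lemma fullControl_action {Δ : ℝ} (y : ℝ) {ρ : ℝ} (hρ : ρ ∈ Icc (0 : ℝ) 1) :
    M.U ρ (Real.sigmoid (worstLogOdds Δ y)) ≤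
      M.U (T.fullControl Δ y).ρ (Real.sigmoid (worstLogOdds Δ y)) := by
  rw [worstLogOdds, fullControl]
  split_ifs with h0 h1
  · exact T.control_action h0 hρ.1
  · rw [← sub_nonpos, U_sub_U, sigmoid_zero_eq]; norm_num
  · have h := T.control_action (y := Δ - y) (by linarith) (ρ := 1 - ρ) (sub_nonneg.2 hρ.2)
    have h2 : ∀ r, M.U r (Real.sigmoid (y - Δ)) = M.U (1 - r) (Real.sigmoid (Δ - y)) := fun r => by
      rw [← neg_sub, Real.sigmoid_neg]; simp only [Model.U]; ring
    rw [h2, h2]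
    simp only [Control.mirror, sub_sub_cancel]
    exact h

/-- The value is affine in the belief with slope `R - L`: nonpositive on the lower side, zero in the
middle, nonnegative on the upper side. -/
lemma fullPiece_worst {Δ q p : ℝ} (hq : q ∈ Ioo (0 : ℝ) 1) (hp : p ∈ beliefSet Δ q) :
    (T.fullPiece Δ (logOdds q)).val (worstBelief Δ q) (logOdds q) ≤
      (T.fullPiece Δ (logOdds q)).val p (logOdds q) := by
  obtain ⟨hp01, hpq, hpΔ⟩ := mem_beliefSet_iff.1 hp
  rw [worstBelief, worstLogOdds, fullPiece]
  split_ifs with h0 h1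
  · rw [sigmoid_logOdds hq]
    have := mul_nonneg (sub_nonneg.2 hpq) (sub_nonneg.2 (T.piece_R_le_L h0))
    simp only [Piece.val]; linarith
  · refine le_of_eq ?_
    simp only [Piece.val, constPiece]; ring
  · have h2 := T.piece_R_le_L (y := Δ - logOdds q) (by linarith)
    have h3 := (le_logOdds_iff hp01).1 hpΔ
    have := mul_nonneg (sub_nonneg.2 h3) (sub_nonneg.2 h2)
    simp only [Piece.val, Piece.mirror]; linarith

/-- The value function solves the saddle-point conditions. -/
theorem isIntrapersonalEquilibrium {Δ : ℝ} (hΔ : 0 ≤ Δ) :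
    IsIntrapersonalEquilibrium M Δ (T.strategy Δ) (worstBelief Δ) := by
  -- The second claim holds at every belief `p`, not only at the worst-case one; this gives
  -- `hjb_zero` and `hjb_min` together. A competing control is evaluated with the piece on the side
  -- to which it drifts, so three pieces have to be good.
  have main : ∀ q ∈ Ioo (0 : ℝ) 1,
      (∀ p, HasLimits (value M (T.strategy Δ)) p (𝓝[<] q) ∧
        HasLimits (value M (T.strategy Δ)) p (𝓝[>] q)) ∧
      (∀ p, G M (value M (T.strategy Δ)) (T.strategy Δ q) p q = 0) ∧
      (∀ u : Control, u.Valid → G M (value M (T.strategy Δ)) u (worstBelief Δ q) q ≤ 0) ∧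
      (T.fullPiece Δ (logOdds q)).Good M (worstBelief Δ q) (logOdds q) ∧
      (0 < (T.strategy Δ q).ν ∨ 0 < (T.strategy Δ q).m →
        ∀ p, M.U (T.strategy Δ q).ρ p = (T.fullPiece Δ (logOdds q)).val p (logOdds q)) := by
    intro q hq
    obtain ⟨Pl, Pr, hl, hr, hPl, hPr, hg, hgl, hgr, hν, hbal⟩ := T.exists_sides hΔ (logOdds q)
    have hVl := T.represents_of_eventually hΔ hq (tendsto_logOdds_left hq) hl
    have hVr := T.represents_of_eventually hΔ hq (tendsto_logOdds_right hq) hr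
    have hV := T.value_strategy hΔ hq
    have hGl : ∀ (u : Control), 1 / 2 < u.α → ∀ p,
        G M (value M (T.strategy Δ)) u p q = Pl.net M u p (logOdds q) := fun u hu p =>
      hVl.G_eq isOpen_Iio hPl hq (by rw [ahead, if_pos hu]) p
    have hGr : ∀ (u : Control), u.α < 1 / 2 → ∀ p,
        G M (value M (T.strategy Δ)) u p q = Pr.net M u p (logOdds q) := fun u hu p =>
      hVr.G_eq isOpen_Ioi hPr hq (by rw [ahead, if_neg hu.not_gt, if_pos hu]) p
    have hGm : ∀ (u : Control), u.α = 1 / 2 → ∀ p,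
        G M (value M (T.strategy Δ)) u p q = (T.fullPiece Δ (logOdds q)).net M u p (logOdds q) :=
      fun u hu p => Piece.G_eq_of_half hV hu p
    refine ⟨fun p => ⟨hVl.hasLimits isOpen_Iio hPl hq p, hVr.hasLimits isOpen_Ioi hPr hq p⟩,
      fun p => ?_, fun u hu => ?_, hg, fun h p => ?_⟩
    · rw [strategy]
      rcases hbal with ⟨h1, h2, h3⟩ | ⟨h1, h2, h3⟩ | ⟨h1, h2, h3⟩ | ⟨h1, h2, h3⟩
      · rw [hGl _ (by rw [h1]; norm_num), Piece.net, hν, h1, h2, h3]; ring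
      · rw [hGr _ (by rw [h1]; norm_num), Piece.net, hν, h1, h2, h3]; ring
      · rw [hGm _ h1, Piece.net, h2, h3]; ring
      · rw [hGm _ h1, Piece.net, hν, h1, h2]; linear_combination (1 / 2) * h3 p
    · rcases lt_trichotomy u.α (1 / 2) with h | h | h
      · rw [hGr u h]; exact hgr.net_nonpos hu
      · rw [hGm u h]; exact hg.net_nonpos hu
      · rw [hGl u h]; exact hgl.net_nonpos hu
    · rw [strategy] at h ⊢
      rw [hν] at h
      have hm := h.resolve_left (lt_irrefl _)
      rcases hbal with ⟨h1, h2, h3⟩ | ⟨h1, h2, h3⟩ | ⟨h1, h2, h3⟩ | ⟨h1, h2, h3⟩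
      · rw [h2] at hm; exact absurd hm (lt_irrefl _)
      · rw [h2] at hm; exact absurd hm (lt_irrefl _)
      · exact h3 p
      · rw [h2] at hm; exact absurd hm (lt_irrefl _)
  refine ⟨⟨T.strategy_admissible hΔ, fun q hq => worstBelief_mem hΔ hq, fun q hq p hp => ?_,
    fun q hq => ?_, fun q hq h => ?_, fun q hq ρ hρ => T.fullControl_action _ hρ⟩,
    fun q hq p _ => (main q hq).1 p, fun q hq => (main q hq).2.1 _, fun q hq u hu => ?_,
    fun q hq p _ => ?_⟩
  · rw [T.value_strategy hΔ hq, T.value_strategy hΔ hq]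
    exact T.fullPiece_worst hq hp
  · rw [T.value_strategy hΔ hq]
    exact max_le (main q hq).2.2.2.1.le_ℓ (main q hq).2.2.2.1.le_r
  · rw [T.value_strategy hΔ hq]
    refine le_antisymm (max_le (main q hq).2.2.2.1.le_ℓ (main q hq).2.2.2.1.le_r) ?_
    rw [← (main q hq).2.2.2.2 h]
    exact U_le_max M (T.fullControl_valid Δ _).ρ_mem _
  · rw [(main q hq).2.1]; exact (main q hq).2.2.1 u hu
  · rw [(main q hq).2.1, (main q hq).2.1]

lemma isBayesOptimal_low {Δ q : ℝ} (hΔ : 0 ≤ Δ) (hq : q ∈ Ioo (0 : ℝ) 1) (h : logOdds q ≤ 0) :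
    IsBayesOptimal M (induced M (T.strategy Δ) q) q := by
  obtain ⟨τ, u₀, u₁, h2, -, -⟩ := T.exists_twoPhase hΔ hq
  have := h2.isBayesOptimal T (y := logOdds q) (fun t => (T.fullControl_valid Δ _).ρ_mem) ?_
  · rwa [sigmoid_logOdds hq] at this
  · rw [← value, T.value_strategy hΔ hq, bayes, abs_of_nonpos h, neg_neg, fullPiece, if_pos h]

/-- Reflection sends the lowest belief, with log-odds `y - Δ`, to the highest belief of the mirrored
problem, with log-odds `Δ - y ≤ 0`, where the strategy attains the bound `T.bayes`. -/
lemma isBayesOptimal_high {Δ q : ℝ} (hΔ : 0 ≤ Δ) (hq : q ∈ Ioo (0 : ℝ) 1) (h0 : 0 < logOdds q)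
    (h : Δ ≤ logOdds q) :
    IsBayesOptimal M (induced M (T.strategy Δ) q) (Real.sigmoid (logOdds q - Δ)) := by
  obtain ⟨τ, u₀, u₁, h2, -, -⟩ := T.exists_twoPhase hΔ hq
  refine h2.isBayesOptimal T (fun t => (T.fullControl_valid Δ _).ρ_mem) ?_
  rw [← value, T.value_strategy hΔ hq, bayes, abs_of_nonneg (sub_nonneg.2 h), neg_sub, fullPiece,
    if_neg (not_le.2 h0), if_neg (not_lt.2 h), Piece.val_mirror, ← Real.sigmoid_neg, neg_sub]

end Thresholds

end

end TwoNews

/-! ### The theorem -/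

theorem mainTheorem10 (M : TwoNews.Model) (Δ : ℝ) (hΔ : 0 ≤ Δ) (hc : M.c < M.cBar)
    (h : M.c < M.cLow ∨ TwoNews.SmallAmbiguity M Δ) :
    ∃ (σ : TwoNews.Strategy) (π : ℝ → ℝ),
      TwoNews.IsIntrapersonalEquilibrium M Δ σ π ∧
      ∀ q ∈ Set.Ioo (0 : ℝ) 1,
        (q ≤ 1 / 2 →
          TwoNews.IsBayesOptimal M (TwoNews.induced M σ q) q ∧ π q = q) ∧
        (1 / 2 ≤ TwoNews.lowest Δ q →
          TwoNews.IsBayesOptimal M (TwoNews.induced M σ q) (TwoNews.lowest Δ q) ∧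
            π q = TwoNews.lowest Δ q) ∧
        (TwoNews.lowest Δ q < 1 / 2 → 1 / 2 < q →
          π q = 1 / 2 ∧
          (TwoNews.payoff M TwoNews.hedgedPolicy (1 / 2) ≤
              TwoNews.payoff M TwoNews.splitPolicy (1 / 2) →
            (σ q).α = 1 / 2 ∧ (σ q).ν = 0 ∧ (σ q).m = 0) ∧
          (TwoNews.payoff M TwoNews.splitPolicy (1 / 2) <
              TwoNews.payoff M TwoNews.hedgedPolicy (1 / 2) →
            (σ q).m = 1 ∧ (σ q).ρ = 1 / 2)) := by
  obtain ⟨T⟩ := TwoNews.Thresholds.nonempty M hc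
  refine ⟨T.strategy Δ, TwoNews.worstBelief Δ, T.isIntrapersonalEquilibrium hΔ, fun q hq => ?_⟩
  have hiff : q ≤ 1 / 2 ↔ TwoNews.logOdds q ≤ 0 := by
    rw [TwoNews.logOdds_le_iff hq, TwoNews.sigmoid_zero_eq]
  have hiff' : 1 / 2 ≤ TwoNews.lowest Δ q ↔ Δ ≤ TwoNews.logOdds q := by
    rw [TwoNews.lowest_eq hΔ hq, ← TwoNews.sigmoid_zero_eq, Real.sigmoid_le_iff, sub_nonneg]
  have hlow : TwoNews.logOdds q ≤ 0 → TwoNews.worstBelief Δ q = q := fun h0 => by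
    rw [TwoNews.worstBelief, TwoNews.worstLogOdds, if_pos h0, TwoNews.sigmoid_logOdds hq]
  refine ⟨fun h1 => ⟨T.isBayesOptimal_low hΔ hq (hiff.1 h1), hlow (hiff.1 h1)⟩, fun h1 => ?_,
    fun h1 h2 => ?_⟩
  · rw [hiff'] at h1
    rcases le_or_gt (TwoNews.logOdds q) 0 with h0 | h0
    -- Here the log-odds of `q` lie between `Δ ≥ 0` and `0`, so `Δ = 0` and the belief set is a
    -- single point.
    · have h3 : TwoNews.lowest Δ q = q := by
        rw [TwoNews.lowest_eq hΔ hq, le_antisymm (h1.trans h0) hΔ, sub_zero,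
          TwoNews.sigmoid_logOdds hq]
      rw [h3]
      exact ⟨T.isBayesOptimal_low hΔ hq h0, hlow h0⟩
    · rw [TwoNews.lowest_eq hΔ hq]
      refine ⟨T.isBayesOptimal_high hΔ hq h0 h1, ?_⟩
      rw [TwoNews.worstBelief, TwoNews.worstLogOdds, if_neg (not_le.2 h0), if_neg (not_lt.2 h1)]
  · rw [← not_le, hiff', not_le] at h1
    rw [← not_le, hiff, not_le] at h2
    have hσ : T.strategy Δ q = TwoNews.midControl M := by
      rw [TwoNews.Thresholds.strategy, TwoNews.Thresholds.fullControl, if_neg (not_le.2 h2),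
        if_pos h1]
    rw [TwoNews.payoff_hedged, TwoNews.payoff_split, hσ, TwoNews.midControl]
    refine ⟨?_, fun h3 => ?_, fun h3 => ?_⟩
    · rw [TwoNews.worstBelief, TwoNews.worstLogOdds, if_neg (not_le.2 h2), if_pos h1,
        TwoNews.sigmoid_zero_eq]
    · rw [if_pos h3]; exact ⟨rfl, rfl, rfl⟩
    · rw [if_neg (not_le.2 h3)]; exact ⟨rfl, rfl⟩
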